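/- **Theorem.** Let $\mathcal G$ be an undirected weighted graph on $N\ge 1$ vertices $\mathcal V$ with real symmetric weighted adjacency matrix $W$, and let $u_1,\dots,u_N$ be an orthonormal basis of $\mathbb R^N$ consisting of eigenvectors of its Laplacian $L=D-W$, where $D$ is the diagonal matrix of the row sums of $W$. For a discrete time-vertex graph signal (DTVGS) $X\in\ell^2(\mathcal V\times\mathbb Z)$ (complex-valued), define its joint time-vertex Fourier transform $$\widehat X(i,f)=\sum_{v\in\mathcal V}u_i(v)\sum_{n\in\mathbb Z}X(v,n)\,e^{-2\pi \mathrm i fn},\qquad 1\le i\le N,$$ a $1$-periodic function of the normalized frequency $f$, the series in $n$ converging in $L^2$ over one period. Let $\mathcal F_1,\dots,\mathcal F_N\subseteq[-\tfrac12,\tfrac12]$ be (possibly empty) finite unions of intervals, and let $$\mathcal{BL}_D=\{X\in\ell^2(\mathcal V\times\mathbb Z):\ \widehat X(i,f)=0\text{ for a.e. } f\in[-\tfrac12,\tfrac12]\setminus\mathcal F_i,\ 1\le i\le N\}$$ be the space of all jointly bandlimited signals with these spectral supports. Let $B=\sum_{i}\mu(\mathcal F_i)$ be the joint bandwidth ($\mu$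 is Lebesgue measure) and let $B_{\mathcal G}=|\{i:\mathcal F_i\neq\emptyset\}|$ be the projection bandwidth in the vertex domain. Then there is a set $\mathcal S\subseteq\mathcal V\times\mathbb Z$ such that 1. $\mathcal S$ is a stable sampling set for $\mathcal{BL}_D$: there are constants $0<a$ and $b<\infty$ with $$a\|X\|^2\le\sum_{(v,n)\in\mathcal S}|X(v,n)|^2\le b\|X\|^2\qquad\text{for all }X\in\mathcal{BL}_D;$$ 2. its total sampling ratio is exactly $$R_D(\mathcal S):=\liminf_{n\to\infty}\frac{|\mathcal S\cap(\mathcal V\times[-n,n])|}{2nN}=\frac BN;$$ 3. at most $B_{\mathcal G}$ vertices are sampled: $|\{v:(v,n)\in\mathcal S\text{ for some }n\}|\le B_{\mathcal G}$. That is, critical sampling (stable sampling at total ratio $B/N$) is achievable, using at most $B_{\mathcal G}$ vertices. -/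

import Mathlib

open MeasureTheory Filter
open scoped ENNReal

noncomputable section

/-- The Laplacian `D - W` of the undirected weighted graph on the vertices `Fin N` with
symmetric weighted adjacency matrix `W`, where `D` is the diagonal matrix of degrees. -/
def graphLaplacian {N : ℕ} (W : Matrix (Fin N) (Fin N) ℝ) : Matrix (Fin N) (Fin N) ℝ :=
  Matrix.diagonal (fun v => ∑ w, W v w) - W

/-- `U` is a graph Fourier matrix of the graph with adjacency matrix `W`: its columns form an
orthonormal basis of real eigenvectors of the Laplacian, i.e. `L = U Λ Uᵀ` with `U` orthogonal and
`Λ` diagonal. The entry `U v i` is the `v`-th component of the `i`-th eigenvector. -/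
def IsGraphFourierMatrix {N : ℕ} (W U : Matrix (Fin N) (Fin N) ℝ) : Prop :=
  U ∈ Matrix.orthogonalGroup (Fin N) ℝ ∧
    ∃ eig : Fin N → ℝ, graphLaplacian W = U * Matrix.diagonal eig * U.transpose

/-- Discrete time-vertex graph signals: the Hilbert space `ℓ²(V × ℤ)`, with `V = Fin N`. -/
abbrev DTVGS (N : ℕ) : Type := lp (fun _ : Fin N × ℤ => ℂ) 2

/-- The discrete-time Fourier transform `f ↦ ∑ₙ x(n) e^{-2πifn}` of a square-summable sequence, as
an `L²` function of the normalized frequency `f = ω / 2π` (period `1`); the series converges in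
`L²`. -/
def dtft (x : ℤ → ℂ) : Lp ℂ 2 (AddCircle.haarAddCircle (T := (1 : ℝ))) :=
  ∑' n : ℤ, x n • fourierLp 2 (-n)

/-- The joint time-vertex Fourier transform: the `i`-th spectral function is
`∑ᵥ uᵢ(v) ∑ₙ X(v, n) e^{-2πifn}`. -/
def jft {N : ℕ} (U : Matrix (Fin N) (Fin N) ℝ) (X : DTVGS N) (i : Fin N) :
    Lp ℂ 2 (AddCircle.haarAddCircle (T := (1 : ℝ))) :=
  ∑ v : Fin N, ((U v i : ℝ) : ℂ) • dtft (fun n => X (v, n))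

/-- One period of the normalized frequency axis. -/
def freqPeriod : Set ℝ := Set.Icc (-1 / 2) (1 / 2)

/-- `A` is a union of finitely many intervals (of any kind, possibly degenerate or empty). -/
def IsFiniteUnionOfIntervals (A : Set ℝ) : Prop :=
  ∃ s : Finset (Set ℝ), (∀ J ∈ s, J.OrdConnected) ∧ A = ⋃ J ∈ s, J

/-- The space of jointly bandlimited signals with spectral supports `F i`: the `i`-th spectral
function vanishes (almost everywhere) off `F i` in one period. -/
def jointlyBandlimited {N : ℕ} (U : Matrix (Fin N) (Fin N) ℝ) (F : Fin N → Set ℝ) :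
    Set (DTVGS N) :=
  {X | ∀ i, ∀ᵐ f ∂(volume.restrict freqPeriod), f ∉ F i → jft U X i (f : UnitAddCircle) = 0}

/-- The joint bandwidth `B = ∑ᵢ μ(Fᵢ)`. -/
def jointBandwidth {N : ℕ} (F : Fin N → Set ℝ) : ℝ := ∑ i, volume.real (F i)

/-- The index set `I_f` of the spectral functions that are active at the frequency `f`. -/
def activeIndices {N : ℕ} (F : Fin N → Set ℝ) (f : ℝ) : Set (Fin N) := {i | f ∈ F i}

/-- The projection bandwidth `B_G` in the vertex domain: the cardinality of
`I = ⋃_{f ∈ ⋃ᵢ Fᵢ} I_f`. -/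
def vertexBandwidth {N : ℕ} (F : Fin N → Set ℝ) : ℕ :=
  (⋃ f ∈ ⋃ i, F i, activeIndices F f).ncard

/-- The total sampling ratio of `S ⊆ V × ℤ`: the lower limit of `|S ∩ (V × [-n, n])| / (2nN)`. -/
def totalSamplingRatio {N : ℕ} (S : Set (Fin N × ℤ)) : ℝ :=
  liminf (fun n : ℕ =>
    ((S ∩ (Set.univ ×ˢ Set.Icc (-(n : ℤ)) (n : ℤ))).ncard : ℝ) / (2 * (n : ℝ) * (N : ℝ))) atTop

/-- `S` is a stable sampling set for the class `Γ` of signals: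
`a ‖X‖² ≤ ∑_{(v, n) ∈ S} |X(v, n)|² ≤ b ‖X‖²` on `Γ` for some `0 < a` and `b < ∞`. -/
def IsStableSamplingSet {N : ℕ} (Γ : Set (DTVGS N)) (S : Set (Fin N × ℤ)) : Prop :=
  ∃ a b : ℝ, 0 < a ∧ ∀ X ∈ Γ,
    a * ‖X‖ ^ 2 ≤ ∑' p : S, ‖X (p : Fin N × ℤ)‖ ^ 2 ∧
    ∑' p : S, ‖X (p : Fin N × ℤ)‖ ^ 2 ≤ b * ‖X‖ ^ 2

/-- `S` is a critical sampling set for the jointly bandlimited signals with supports `F`: it is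
stable and its total sampling ratio is `B / N`. -/
def IsCriticalSamplingSet {N : ℕ} (U : Matrix (Fin N) (Fin N) ℝ) (F : Fin N → Set ℝ)
    (S : Set (Fin N × ℤ)) : Prop :=
  IsStableSamplingSet (jointlyBandlimited U F) S ∧
    totalSamplingRatio S = jointBandwidth F / N

/-- The set `S_G` of vertices that are sampled at some instant. -/
def sampledVertices {N : ℕ} (S : Set (Fin N × ℤ)) : Set (Fin N) := Prod.fst '' S

end

/-! Work in the frequency domain. At frequency `t` the spectral functions form a vector supported on
the set `K t` of active indices, and the spectrum seen at vertex `v` is the product of that vector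
with row `v` of `U`. The columns of `U` are independent, so the rows restricted to `K t` contain a
basis of `|K t|` rows; take the lexicographically first one (`greedy`). Let `A v` be the set of
frequencies at which `v` belongs to it. Then the indicators of the `A v` add up to `|K t|`, so the
measures of the `A v` add up to `B`. Vertex `v` is sampled on a set of integers that is stable for
functions supported in `A v` and has density `μ(A v)`. Off `A v`, row `v` is a combination of
earlier greedy rows, so the uncontrolled part of its spectrum is bounded by parts already recovered;
this triangular system (`exists_greedy_sampling`) gives stability. `greedy` is monotone in the set
of columns, so only the greedy rows for the columns with `F i` nonempty are ever used, and there are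
`B_G` of them.

The analytic input is the theorem of Kozma and Nitzan (`IsArcSet.exists_samples`): a finite union
`E` of arcs admits a stable set of integers of density `μ(E)`. Fold the circle `M` times onto
itself. The Fourier coefficients in the residue classes modulo `M` are those of `M` functions
obtained from the branch values by a Vandermonde matrix, whose greedy rows are the first ones. By
the same triangular argument it suffices to sample each level set of the number of branches in `E`
(`samples_interleave`). The left end points of the level sets are images of those of `E`, so one
inducts on their number.

For at least two left end points, some `M` makes every level set lose one (`exists_fold_redundant`).
Otherwise every folding would take just two consecutive values; Bessel's inequality for an indicator
function would then bound the exponential sums over the end points below their mean square in `M`.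
For one arc, `M` is chosen so that its folded length has fractional part at most `1/4`; on so short
an arc the orthogonal exponentials survive rounding of their frequencies to integers
(`perturbed_frame_bound`). -/

open scoped Topology

/-! ### Characters and Parseval on an interval -/

/-- The character `x ↦ e^{2πix}` of the real line. -/
noncomputable def ech (x : ℝ) : ℂ := Complex.exp ((2 * Real.pi * x : ℝ) * Complex.I)

lemma ech_add (x y : ℝ) : ech (x + y) = ech x * ech y := by
  rw [ech, ech, ech, ← Complex.exp_add]
  push_cast
  ring_nf

lemma norm_ech (x : ℝ) : ‖ech x‖ = 1 := Complex.norm_exp_ofReal_mul_I _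

lemma ech_zero : ech 0 = 1 := by simp [ech]

lemma ech_int (n : ℤ) : ech n = 1 := by
  rw [ech]
  have := Complex.exp_int_mul_two_pi_mul_I n
  push_cast
  rw [← this]
  ring_nf

lemma ech_add_int (x : ℝ) (n : ℤ) : ech (x + n) = ech x := by
  rw [ech_add, ech_int, mul_one]

lemma ech_eq_one_iff (x : ℝ) : ech x = 1 ↔ ∃ n : ℤ, x = n := by
  constructor
  · intro h
    rw [ech, Complex.exp_eq_one_iff] at h
    obtain ⟨n, hn⟩ := h
    refine ⟨n, ?_⟩
    have h2 : (2 * Real.pi * x : ℝ) * Complex.I = ((n * (2 * Real.pi) : ℝ) : ℂ) * Complex.I := by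
      rw [hn]; push_cast; ring
    have h3 := mul_right_cancel₀ Complex.I_ne_zero h2
    have h4 : 2 * Real.pi * x = n * (2 * Real.pi) := by exact_mod_cast h3
    have := Real.pi_pos
    nlinarith [mul_left_cancel₀ (show (2 * Real.pi) ≠ 0 by positivity)
      (show 2 * Real.pi * x = 2 * Real.pi * n by linarith)]
  · rintro ⟨n, rfl⟩
    exact ech_int n

lemma ech_pow (x : ℝ) (n : ℕ) : ech x ^ n = ech (n * x) := by
  rw [ech, ech, ← Complex.exp_nat_mul]
  congr 1
  push_cast
  ring

lemma ech_neg (x : ℝ) : ech (-x) = (starRingEnd ℂ) (ech x) := by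
  rw [ech, ech, ← Complex.exp_conj]
  congr 1
  rw [map_mul, Complex.conj_ofReal, Complex.conj_I]
  push_cast
  ring

lemma continuous_ech : Continuous ech := by
  unfold ech
  fun_prop

@[fun_prop]
lemma Continuous.ech {α : Type*} [TopologicalSpace α] {f : α → ℝ} (hf : Continuous f) :
    Continuous (fun x => ech (f x)) := continuous_ech.comp hf

@[fun_prop]
lemma Measurable.ech {α : Type*} [MeasurableSpace α] {f : α → ℝ} (hf : Measurable f) :
    Measurable (fun x => ech (f x)) := continuous_ech.measurable.comp hf

lemma fourier_eq_ech (n : ℤ) {T : ℝ} (x : ℝ) : fourier n (x : AddCircle T) = ech (n * x / T) := by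
  rw [fourier_coe_apply, ech]
  congr 1
  push_cast
  ring

/-- Multiplication by a unimodular measurable factor preserves membership in `L²`. -/
lemma MeasureTheory.MemLp.ech_mul {μ : Measure ℝ} {g : ℝ → ℂ} {p : ℝ≥0∞} (hg : MemLp g p μ)
    {f : ℝ → ℝ} (hf : Measurable f) : MemLp (fun x => ech (f x) * g x) p μ := by
  refine hg.of_le (hf.ech.aestronglyMeasurable.mul hg.1) (ae_of_all _ fun x => ?_)
  simp [norm_ech]

/-- Parseval without the factor `1 / (b - a)` in the coefficients, so that the length appears on the
energy side. -/
lemma hasSum_sq_ech {a b : ℝ} (hab : a < b) {g : ℝ → ℂ}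
    (hg : MemLp g 2 (volume.restrict (Set.Ioc a b))) :
    HasSum (fun n : ℤ => ‖∫ x in Set.Ioc a b, ech (-(n * x / (b - a))) * g x‖ ^ 2)
      ((b - a) * ∫ x in Set.Ioc a b, ‖g x‖ ^ 2) := by
  have h := (hasSum_sq_fourierCoeffOn hab hg).mul_left ((b - a) ^ 2)
  have hb : b - a ≠ 0 := by linarith
  convert! h using 1
  · ext n
    rw [fourierCoeffOn_eq_integral, intervalIntegral.integral_of_le hab.le, norm_smul, mul_pow]
    simp only [fourier_eq_ech, smul_eq_mul]
    rw [Real.norm_eq_abs, sq_abs, ← mul_assoc, ← mul_pow, mul_one_div_cancel hb, one_pow, one_mul]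
    congr 4
    ext x
    congr 2
    push_cast
    ring
  · rw [intervalIntegral.integral_of_le hab.le, smul_eq_mul]
    field_simp

lemma integrable_norm_sq {μ : Measure ℝ} {g : ℝ → ℂ} (hg : MemLp g 2 μ) :
    Integrable (fun x => ‖g x‖ ^ 2) μ := hg.integrable_norm_pow (by norm_num)

lemma bessel_ech {a b : ℝ} (hab : a < b) {g : ℝ → ℂ}
    (hg : MemLp g 2 (volume.restrict (Set.Ioc a b))) (s : Finset ℤ) :
    ∑ n ∈ s, ‖∫ x in Set.Ioc a b, ech (-(n * x / (b - a))) * g x‖ ^ 2 ≤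
      (b - a) * ∫ x in Set.Ioc a b, ‖g x‖ ^ 2 :=
  sum_le_hasSum s (fun _ _ => by positivity) (hasSum_sq_ech hab hg)

/-! ### Perturbed exponentials on a short interval -/

/-- The expansion of a small frequency perturbation in powers of the perturbation. -/
lemma hasSum_perturbation {c x₀ ν δ : ℝ} (hδ : |δ| ≤ 1 / 2) {g : ℝ → ℂ}
    (hg : MemLp g 2 (volume.restrict (Set.Ioc (x₀ - c) (x₀ + c)))) :
    HasSum (fun k : ℕ => (((-2 * Real.pi * δ : ℝ) * Complex.I) ^ k / (k.factorial : ℂ)) *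
        ∫ x in Set.Ioc (x₀ - c) (x₀ + c), ech (-(ν * (x - x₀))) * (((x - x₀ : ℝ) : ℂ) ^ k * g x))
      (∫ x in Set.Ioc (x₀ - c) (x₀ + c), ech (-((ν + δ) * (x - x₀))) * g x) := by
  set μ := volume.restrict (Set.Ioc (x₀ - c) (x₀ + c)) with hμ
  have hgi : Integrable g μ := hg.integrable (by norm_num)
  set z : ℂ := (-2 * Real.pi * δ : ℝ) * Complex.I with hz
  have hzn : ‖z‖ ≤ Real.pi := by
    rw [hz, norm_mul, Complex.norm_I, mul_one, Complex.norm_real, Real.norm_eq_abs, abs_mul,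
      abs_mul, abs_of_pos Real.pi_pos]
    norm_num
    nlinarith [Real.pi_pos]
  have hbd : ∀ k : ℕ, ∀ᵐ x ∂μ, ‖(z ^ k / (k.factorial : ℂ)) *
      (ech (-(ν * (x - x₀))) * (((x - x₀ : ℝ) : ℂ) ^ k * g x))‖ ≤
        ((Real.pi * c) ^ k / k.factorial) * ‖g x‖ := by
    intro k
    filter_upwards [ae_restrict_mem measurableSet_Ioc] with x hx
    have hxx : |x - x₀| ≤ c := by
      rw [abs_le]; constructor <;> linarith [hx.1, hx.2]
    rw [norm_mul, norm_mul, norm_ech, one_mul, norm_mul, norm_div, norm_pow, norm_pow,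
      Complex.norm_real, Real.norm_eq_abs, Complex.norm_natCast, mul_pow]
    have h1 : ‖z‖ ^ k ≤ Real.pi ^ k := pow_le_pow_left₀ (norm_nonneg _) hzn k
    have h2 : |x - x₀| ^ k ≤ c ^ k := pow_le_pow_left₀ (abs_nonneg _) hxx k
    calc ‖z‖ ^ k / (k.factorial : ℝ) * (|x - x₀| ^ k * ‖g x‖)
        = (‖z‖ ^ k * |x - x₀| ^ k) / (k.factorial : ℝ) * ‖g x‖ := by ring
      _ ≤ (Real.pi ^ k * c ^ k) / (k.factorial : ℝ) * ‖g x‖ := by gcongr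
  have hint : ∀ k : ℕ, Integrable (fun x => (z ^ k / (k.factorial : ℂ)) *
      (ech (-(ν * (x - x₀))) * (((x - x₀ : ℝ) : ℂ) ^ k * g x))) μ := by
    intro k
    refine (hgi.norm.const_mul ((Real.pi * c) ^ k / k.factorial)).mono' ?_ (hbd k)
    have : AEStronglyMeasurable (fun x => (z ^ k / (k.factorial : ℂ)) *
      (ech (-(ν * (x - x₀))) * ((x - x₀ : ℝ) : ℂ) ^ k)) μ := by
      apply Continuous.aestronglyMeasurable
      fun_prop
    refine (this.mul hgi.1).congr (ae_of_all _ fun x => ?_)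
    simp only [Pi.mul_apply]
    ring
  -- The terms are dominated by those of the series of `exp (π c)` times `‖g‖`, which permits
  -- exchanging sum and integral.
  have hsum : Summable fun k : ℕ => ∫ x, ‖(z ^ k / (k.factorial : ℂ)) *
      (ech (-(ν * (x - x₀))) * (((x - x₀ : ℝ) : ℂ) ^ k * g x))‖ ∂μ := by
    refine Summable.of_nonneg_of_le (fun k => by positivity) (fun k => ?_)
      ((Real.summable_pow_div_factorial (Real.pi * c)).mul_right (∫ x, ‖g x‖ ∂μ))
    rw [← integral_const_mul]
    exact integral_mono_ae (hint k).norm (hgi.norm.const_mul _) (hbd k)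
  have h := hasSum_integral_of_summable_integral_norm hint hsum
  convert! h using 1
  · ext k
    rw [integral_const_mul]
  · refine integral_congr_ae (ae_of_all _ fun x => ?_)
    dsimp only
    have hexp : HasSum (fun k : ℕ => (z * (x - x₀ : ℝ)) ^ k / (k.factorial : ℂ))
        (Complex.exp (z * (x - x₀ : ℝ))) := by
      rw [Complex.exp_eq_exp_ℂ]
      exact NormedSpace.expSeries_div_hasSum_exp (z * (x - x₀ : ℝ))
    have h2 := hexp.mul_right (ech (-(ν * (x - x₀))) * g x)
    have h3 : ech (-((ν + δ) * (x - x₀))) * g x =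
        Complex.exp (z * (x - x₀ : ℝ)) * (ech (-(ν * (x - x₀))) * g x) := by
      rw [← mul_assoc]
      congr 1
      rw [ech, ech, ← Complex.exp_add]
      congr 1
      rw [hz]
      push_cast
      ring
    rw [h3, ← h2.tsum_eq]
    congr 1
    ext k
    rw [mul_pow]
    ring

/-- **Stability of harmonic frames under small perturbations of the frequencies** (Duffin–Eachus):
on an interval of length `β ≤ 1/4`, the frequencies `n / β` may be moved by up to `1/2`. -/
lemma perturbed_frame_bound {β x₀ : ℝ} (hβ : 0 < β) (hβ' : β ≤ 1 / 4) {g : ℝ → ℂ}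
    (hg : MemLp g 2 (volume.restrict (Set.Ioc (x₀ - β / 2) (x₀ + β / 2)))) {l : ℤ → ℝ}
    (hl : ∀ n : ℤ, |l n - n / β| ≤ 1 / 2)
    (hs : Summable fun n : ℤ =>
      ‖∫ x in Set.Ioc (x₀ - β / 2) (x₀ + β / 2), ech (-(l n * x)) * g x‖ ^ 2) :
    β / 9 * ∫ x in Set.Ioc (x₀ - β / 2) (x₀ + β / 2), ‖g x‖ ^ 2 ≤
      ∑' n : ℤ, ‖∫ x in Set.Ioc (x₀ - β / 2) (x₀ + β / 2), ech (-(l n * x)) * g x‖ ^ 2 := by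
  set μ := volume.restrict (Set.Ioc (x₀ - β / 2) (x₀ + β / 2)) with hμ
  set R : ℝ := Real.sqrt (β * ∫ x, ‖g x‖ ^ 2 ∂μ) with hR
  have hI0 : 0 ≤ ∫ x, ‖g x‖ ^ 2 ∂μ := by positivity
  have hR0 : 0 ≤ R := Real.sqrt_nonneg _
  have hR2 : R ^ 2 = β * ∫ x, ‖g x‖ ^ 2 ∂μ := Real.sq_sqrt (by positivity)
  set T : ℝ := ∑' n : ℤ, ‖∫ x, ech (-(l n * x)) * g x ∂μ‖ ^ 2 with hT
  have hT0 : 0 ≤ T := tsum_nonneg fun n => by positivity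
  have hab : x₀ - β / 2 < x₀ + β / 2 := by linarith
  have hlen : (x₀ + β / 2) - (x₀ - β / 2) = β := by ring
  have hpow : ∀ k : ℕ, MemLp (fun x : ℝ => ((x - x₀ : ℝ) : ℂ) ^ k * g x) 2 μ := by
    intro k
    refine (hg.const_mul (((β / 2) ^ k : ℝ) : ℂ)).of_le ?_ ?_
    · refine AEStronglyMeasurable.mul (Continuous.aestronglyMeasurable ?_) hg.1
      fun_prop
    · filter_upwards [ae_restrict_mem measurableSet_Ioc] with x hx
      have hxx : |x - x₀| ≤ β / 2 := by
        rw [abs_le]; constructor <;> linarith [hx.1, hx.2]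
      rw [norm_mul, norm_mul, norm_pow, Complex.norm_real, Complex.norm_real, Real.norm_eq_abs,
        Real.norm_eq_abs, abs_of_nonneg (by positivity : 0 ≤ (β / 2) ^ k)]
      gcongr
  have hpow_int : ∀ k : ℕ, ∫ x, ‖((x - x₀ : ℝ) : ℂ) ^ k * g x‖ ^ 2 ∂μ ≤
      (β / 2) ^ (2 * k) * ∫ x, ‖g x‖ ^ 2 ∂μ := by
    intro k
    rw [← integral_const_mul]
    refine integral_mono_ae (integrable_norm_sq (hpow k)) ((integrable_norm_sq hg).const_mul _) ?_
    filter_upwards [ae_restrict_mem measurableSet_Ioc] with x hx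
    have hxx : |x - x₀| ≤ β / 2 := by
      rw [abs_le]; constructor <;> linarith [hx.1, hx.2]
    rw [norm_mul, norm_pow, Complex.norm_real, Real.norm_eq_abs, mul_pow, ← pow_mul, mul_comm k 2]
    gcongr
  -- the phase shift that centres the interval does not change absolute values
  have hshift : ∀ (ν : ℝ) (f : ℝ → ℂ), ‖∫ x, ech (-(ν * (x - x₀))) * f x ∂μ‖ =
      ‖∫ x, ech (-(ν * x)) * f x ∂μ‖ := by
    intro ν f
    have : ∀ x, ech (-(ν * (x - x₀))) * f x = ech (ν * x₀) * (ech (-(ν * x)) * f x) := by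
      intro x
      rw [← mul_assoc, ← ech_add]
      congr 2
      ring
    simp_rw [this]
    rw [integral_const_mul, norm_mul, norm_ech, one_mul]
  have hbes : ∀ (k : ℕ) (s : Finset ℤ), ∑ n ∈ s,
      ‖∫ x, ech (-(n / β * (x - x₀))) * (((x - x₀ : ℝ) : ℂ) ^ k * g x) ∂μ‖ ^ 2 ≤
        ((β / 2) ^ k * R) ^ 2 := by
    intro k s
    have h := bessel_ech hab (hpow k) s
    rw [hlen] at h
    have h2 : ∀ n : ℤ, ‖∫ x, ech (-(n / β * (x - x₀))) * (((x - x₀ : ℝ) : ℂ) ^ k * g x) ∂μ‖ =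
        ‖∫ x, ech (-(n * x / β)) * (((x - x₀ : ℝ) : ℂ) ^ k * g x) ∂μ‖ := by
      intro n
      rw [hshift]
      congr 3
      ext x
      congr 2
      ring
    simp_rw [h2]
    refine h.trans ?_
    rw [mul_pow, hR2, ← pow_mul, mul_comm k 2]
    calc β * ∫ x, ‖((x - x₀ : ℝ) : ℂ) ^ k * g x‖ ^ 2 ∂μ
        ≤ β * ((β / 2) ^ (2 * k) * ∫ x, ‖g x‖ ^ 2 ∂μ) := by gcongr; exact hpow_int k
      _ = _ := by ring
  -- On finitely many frequencies the Taylor terms `v k` are vectors in a Euclidean space: `v 0`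
  -- holds the unperturbed coefficients and the sum `u` the perturbed ones, so the triangle
  -- inequality compares them.
  have hfin : ∀ s : Finset ℤ,
      Real.sqrt (∑ n ∈ s, ‖∫ x, ech (-(n / β * (x - x₀))) * g x ∂μ‖ ^ 2) ≤
        Real.sqrt T + 2 / 3 * R := by
    intro s
    let v : ℕ → EuclideanSpace ℂ s := fun k => WithLp.toLp 2 fun n =>
      (((-2 * Real.pi * (l n - (n : ℤ) / β) : ℝ) * Complex.I) ^ k / (k.factorial : ℂ)) *
        ∫ x, ech (-((n : ℤ) / β * (x - x₀))) * (((x - x₀ : ℝ) : ℂ) ^ k * g x) ∂μ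
    let u : EuclideanSpace ℂ s := WithLp.toLp 2 fun n =>
      ∫ x, ech (-(l n * (x - x₀))) * g x ∂μ
    have hsum : HasSum v u := by
      have h1 : HasSum (fun k => WithLp.ofLp (v k)) (WithLp.ofLp u) := by
        rw [Pi.hasSum]
        intro n
        have h := hasSum_perturbation (x₀ := x₀) (c := β / 2) (ν := (n : ℤ) / β)
          (δ := l n - (n : ℤ) / β) (hl n) hg
        simpa only [v, u, add_sub_cancel] using h
      exact (PiLp.continuousLinearEquiv 2 ℂ (fun _ : s => ℂ)).hasSum.mp h1
    -- A factor `π` per power comes from the frequency shift and `β / 2` from the half-length; `π β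
    -- / 2 ≤ π / 8 < 2 / 5`. The factorial is not needed.
    have hvn : ∀ k, ‖v k‖ ≤ (2 / 5) ^ k * R := by
      intro k
      rw [EuclideanSpace.norm_eq]
      apply Real.sqrt_le_iff.mpr
      refine ⟨by positivity, ?_⟩
      have hle : ∀ n : s, ‖v k n‖ ^ 2 ≤ (Real.pi ^ k) ^ 2 *
          ‖∫ x, ech (-((n : ℤ) / β * (x - x₀))) * (((x - x₀ : ℝ) : ℂ) ^ k * g x) ∂μ‖ ^ 2 := by
        intro n
        simp only [v]
        rw [norm_mul, mul_pow]
        gcongr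
        rw [norm_div, norm_pow, Complex.norm_natCast, norm_mul, Complex.norm_I, mul_one,
          Complex.norm_real, Real.norm_eq_abs]
        have hf : (1 : ℝ) ≤ k.factorial := by exact_mod_cast k.factorial_pos
        refine (div_le_self (by positivity) hf).trans ?_
        gcongr
        rw [abs_mul, abs_mul, abs_of_pos Real.pi_pos]
        norm_num
        nlinarith [Real.pi_pos, hl n]
      calc ∑ n : s, ‖v k n‖ ^ 2 ≤ ∑ n : s, (Real.pi ^ k) ^ 2 *
          ‖∫ x, ech (-((n : ℤ) / β * (x - x₀))) * (((x - x₀ : ℝ) : ℂ) ^ k * g x) ∂μ‖ ^ 2 :=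
            Finset.sum_le_sum fun n _ => hle n
        _ = (Real.pi ^ k) ^ 2 * ∑ n ∈ s,
          ‖∫ x, ech (-((n : ℤ) / β * (x - x₀))) * (((x - x₀ : ℝ) : ℂ) ^ k * g x) ∂μ‖ ^ 2 := by
            rw [← Finset.mul_sum, ← Finset.sum_coe_sort s]
        _ ≤ (Real.pi ^ k) ^ 2 * ((β / 2) ^ k * R) ^ 2 := by gcongr; exact hbes k s
        _ = ((Real.pi * (β / 2)) ^ k * R) ^ 2 := by rw [mul_pow]; ring
        _ ≤ ((2 / 5) ^ k * R) ^ 2 := by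
            have hpi : Real.pi * (β / 2) ≤ 2 / 5 := by
              have := Real.pi_lt_d2
              nlinarith [Real.pi_pos]
            gcongr
    have hv0 : ‖v 0‖ = Real.sqrt (∑ n ∈ s, ‖∫ x, ech (-(n / β * (x - x₀))) * g x ∂μ‖ ^ 2) := by
      rw [EuclideanSpace.norm_eq, ← Finset.sum_coe_sort s]
      simp [v]
    have hu : ‖u‖ ≤ Real.sqrt T := by
      rw [EuclideanSpace.norm_eq]
      apply Real.sqrt_le_sqrt
      calc ∑ n : s, ‖u n‖ ^ 2 = ∑ n ∈ s, ‖∫ x, ech (-(l n * x)) * g x ∂μ‖ ^ 2 := by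
            rw [← Finset.sum_coe_sort s]
            refine Finset.sum_congr rfl fun n _ => ?_
            rw [← hshift]
        _ ≤ T := hs.sum_le_tsum s fun _ _ => by positivity
    -- `2 / 3` is the sum of `(2 / 5) ^ k` over `k ≥ 1`. Being less than `1`, it leaves `R / 3 ≤
    -- √T`, whence the constant `β / 9`.
    have htail : ‖u - v 0‖ ≤ 2 / 3 * R := by
      have h1 : HasSum (fun k => v (k + 1)) (u - v 0) := by
        simpa using (hasSum_nat_add_iff' 1).mpr hsum
      have hg : HasSum (fun k : ℕ => (2 / 5 : ℝ) ^ (k + 1) * R) (2 / 3 * R) := by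
        have := ((hasSum_geometric_of_lt_one (by norm_num : (0 : ℝ) ≤ 2 / 5)
          (by norm_num)).mul_left (2 / 5 : ℝ)).mul_right R
        convert! this using 1
        · ext k; ring
        · norm_num
      rw [← h1.tsum_eq]
      exact tsum_of_norm_bounded hg fun k => hvn (k + 1)
    rw [← hv0]
    calc ‖v 0‖ = ‖u - (u - v 0)‖ := by rw [sub_sub_cancel]
      _ ≤ ‖u‖ + ‖u - v 0‖ := norm_sub_le _ _
      _ ≤ _ := add_le_add hu htail
  have hR' : R ≤ Real.sqrt T + 2 / 3 * R := by
    have hpar := hasSum_sq_ech hab hg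
    rw [hlen] at hpar
    rw [hR]
    apply Real.sqrt_le_iff.mpr
    refine ⟨by positivity, ?_⟩
    refine hasSum_le_of_sum_le hpar fun s => ?_
    have h := hfin s
    rw [Real.sqrt_le_left (by positivity)] at h
    convert! h using 3 with n hn
    rw [hshift]
    congr 3
    ext x
    congr 2
    ring
  have h3 : R / 3 ≤ Real.sqrt T := by linarith
  have h4 : (R / 3) ^ 2 ≤ T := by
    rw [← Real.sq_sqrt hT0]
    gcongr
  rw [div_pow, hR2] at h4
  linarith

/-! ### Stable sampling by integers, and density -/

/-- Lebesgue measure on one period `(0, 1]`. -/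
noncomputable abbrev periodMeasure : Measure ℝ := volume.restrict (Set.Ioc 0 1)

/-- The `n`-th Fourier coefficient of a function on `(0, 1]`. -/
noncomputable def coef (g : ℝ → ℂ) (n : ℤ) : ℂ := ∫ x, ech (-(n * x)) * g x ∂periodMeasure

lemma hasSum_sq_coef {g : ℝ → ℂ} (hg : MemLp g 2 periodMeasure) :
    HasSum (fun n : ℤ => ‖coef g n‖ ^ 2) (∫ x, ‖g x‖ ^ 2 ∂periodMeasure) := by
  have h := hasSum_sq_ech zero_lt_one hg
  simpa only [sub_zero, div_one, one_mul, coef] using h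

lemma coef_congr {g g' : ℝ → ℂ} (h : g =ᵐ[periodMeasure] g') : coef g = coef g' := by
  ext n
  refine integral_congr_ae ?_
  filter_upwards [h] with x hx
  rw [hx]

/-- The frequencies `Λ` are a set of stable sampling for the functions on `(0, 1]` supported in
`E`. -/
def Samples (Λ : Set ℤ) (E : Set ℝ) : Prop :=
  ∃ c : ℝ, 0 < c ∧ ∀ g : ℝ → ℂ, Measurable g → MemLp g 2 periodMeasure →
    (∀ᵐ x ∂periodMeasure, x ∉ E → g x = 0) →
      c * ∫ x, ‖g x‖ ^ 2 ∂periodMeasure ≤ ∑' n : Λ, ‖coef g n‖ ^ 2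

/-- `Λ` has density `d` with bounded discrepancy. -/
def HasDensity (Λ : Set ℤ) (d : ℝ) : Prop :=
  ∃ C : ℝ, ∀ p q : ℤ, p ≤ q → |((Λ ∩ Set.Ico p q).ncard : ℝ) - d * (q - p)| ≤ C

/-- Truncating to `E` changes `g` only on a null set, so functions vanishing everywhere off `E`
suffice as tests. -/
lemma Samples.of_indicator {Λ : Set ℤ} {E : Set ℝ} (hE : MeasurableSet E) {c : ℝ} (hc : 0 < c)
    (h : ∀ g : ℝ → ℂ, Measurable g → MemLp g 2 periodMeasure → (∀ x, x ∉ E → g x = 0) →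
      c * ∫ x, ‖g x‖ ^ 2 ∂periodMeasure ≤ ∑' n : Λ, ‖coef g n‖ ^ 2) : Samples Λ E := by
  refine ⟨c, hc, fun g hg hL h0 => ?_⟩
  have hae : E.indicator g =ᵐ[periodMeasure] g := by
    filter_upwards [h0] with x hx
    by_cases hxE : x ∈ E
    · rw [Set.indicator_of_mem hxE]
    · rw [Set.indicator_of_notMem hxE, hx hxE]
  have h1 := h (E.indicator g) (hg.indicator hE) (hL.indicator hE)
    fun x hx => Set.indicator_of_notMem hx g
  rw [coef_congr hae] at h1
  convert! h1 using 2
  refine integral_congr_ae ?_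
  filter_upwards [hae] with x hx
  rw [hx]

lemma samples_univ (E : Set ℝ) : Samples Set.univ E := by
  refine ⟨1, one_pos, fun g _ hL _ => ?_⟩
  rw [one_mul, ← (hasSum_sq_coef hL).tsum_eq, tsum_univ (fun n : ℤ => ‖coef g n‖ ^ 2)]

lemma samples_empty {E : Set ℝ} (hE : volume (E ∩ Set.Ioc 0 1) = 0) : Samples ∅ E := by
  refine ⟨1, one_pos, fun g _ _ h0 => ?_⟩
  have h1 : ∀ᵐ x ∂periodMeasure, x ∉ E := by
    rw [ae_iff, Measure.restrict_apply' measurableSet_Ioc]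
    simpa using hE
  have h2 : ∫ x, ‖g x‖ ^ 2 ∂periodMeasure = 0 := by
    rw [← integral_zero ℝ ℝ (μ := periodMeasure)]
    refine integral_congr_ae ?_
    filter_upwards [h0, h1] with x hx hx'
    rw [hx hx']
    simp
  rw [h2]
  simp

lemma ncard_Ico_int {p q : ℤ} (h : p ≤ q) : ((Set.Ico p q).ncard : ℝ) = q - p := by
  rw [← Finset.coe_Ico, Set.ncard_coe_finset, Int.card_Ico]
  have : ((q - p).toNat : ℤ) = q - p := Int.toNat_of_nonneg (by lia)
  exact_mod_cast this

lemma hasDensity_univ : HasDensity Set.univ 1 :=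
  ⟨0, fun p q h => by rw [Set.univ_inter, ncard_Ico_int h]; simp⟩

lemma hasDensity_empty : HasDensity ∅ 0 := ⟨0, fun p q _ => by simp⟩

/-! ### Unions of arcs, and sampling for one short arc -/

/-- `E` is a `1`-periodic set which is a union of right-open arcs whose left end points belong to
`P` modulo `1`. -/
structure IsArcSet (P : Finset ℝ) (E : Set ℝ) : Prop where
  meas : MeasurableSet E
  add_one_mem : ∀ t, t + 1 ∈ E ↔ t ∈ E
  right : ∀ t ∈ E, ∃ ε > 0, ∀ u, t ≤ u → u < t + ε → u ∈ E
  anti : ∀ s t, s < t → t < s + 1 → (∀ p ∈ P, ∀ k : ℤ, p + k ∉ Set.Ioc s t) → t ∈ E → s ∈ E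

lemma IsArcSet.add_int_mem {P : Finset ℝ} {E : Set ℝ} (h : IsArcSet P E) (t : ℝ) (k : ℤ) :
    t + k ∈ E ↔ t ∈ E := by
  induction k using Int.induction_on with
  | zero => simp
  | succ n ih =>
    rw [← ih, ← h.add_one_mem (t + (n : ℤ))]
    push_cast
    rw [add_assoc]
  | pred n ih =>
    rw [← ih, ← h.add_one_mem (t + ((-(n : ℤ) - 1 : ℤ) : ℝ))]
    push_cast
    ring_nf

lemma IsArcSet.fract_mem {P : Finset ℝ} {E : Set ℝ} (h : IsArcSet P E) (t : ℝ) :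
    Int.fract t ∈ E ↔ t ∈ E := by
  rw [← h.add_int_mem (Int.fract t) ⌊t⌋, Int.fract_add_floor]

/-- The first gap of a right-open set after one of its points. -/
lemma exists_arc_end {E : Set ℝ}
    (hr : ∀ t ∈ E, ∃ ε > 0, ∀ u, t ≤ u → u < t + ε → u ∈ E) {a y : ℝ} (ha : a ∈ E) (hay : a ≤ y)
    (hy : y ∉ E) : ∃ b, a < b ∧ b ≤ y ∧ (∀ x, a ≤ x → x < b → x ∈ E) ∧ b ∉ E := by
  set B : Set ℝ := {x | a ≤ x ∧ x ∉ E} with hB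
  have hne : B.Nonempty := ⟨y, hay, hy⟩
  have hbdd : BddBelow B := ⟨a, fun x hx => hx.1⟩
  have hin : ∀ x, a ≤ x → x < sInf B → x ∈ E := by
    intro x hax hxb
    by_contra hx
    exact absurd (csInf_le hbdd ⟨hax, hx⟩) (not_le.mpr hxb)
  have hge : ∀ x ∈ E, a ≤ x → (∀ u, a ≤ u → u < x → u ∈ E) → x < sInf B := by
    intro x hx hax hux
    obtain ⟨ε, hε, h⟩ := hr x hx
    have : x + ε ≤ sInf B := by
      refine le_csInf hne fun z hz => ?_
      by_contra hzx
      push Not at hzx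
      rcases lt_or_ge z x with h1 | h1
      · exact hz.2 (hux z hz.1 h1)
      · exact hz.2 (h z h1 hzx)
    linarith
  have hab : a < sInf B := hge a ha le_rfl fun u h1 h2 => absurd h1 (not_le.mpr h2)
  refine ⟨sInf B, hab, csInf_le hbdd ⟨hay, hy⟩, hin, fun hb => ?_⟩
  exact lt_irrefl _ (hge _ hb hab.le hin)

/-- If `b` is a first gap, then `b - 1` is a gap too, yet points of `E` lie just before `b`; passing
from `b - 1` to them within one period, membership would have to begin at a left end point. -/
lemma IsArcSet.eq_empty_or_univ {E : Set ℝ} (h : IsArcSet ∅ E) : E = ∅ ∨ E = Set.univ := by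
  by_contra hcon
  push Not at hcon
  obtain ⟨⟨t, ht⟩, h2⟩ := hcon
  obtain ⟨y, hy⟩ := (Set.ne_univ_iff_exists_notMem E).mp h2
  obtain ⟨b, hab, -, hin, hb⟩ := exists_arc_end h.right (y := y + (⌈t - y⌉ : ℤ)) ht
    (by linarith [Int.le_ceil (t - y)]) (by rwa [h.add_int_mem])
  have hb1 : b - 1 ∉ E := by
    rw [← h.add_one_mem, sub_add_cancel]; exact hb
  set s := max t (b - 1 / 2) with hs
  have hs1 : s < b := max_lt hab (by linarith)
  have hs2 : b - 1 / 2 ≤ s := le_max_right _ _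
  exact hb1 (h.anti (b - 1) s (by linarith) (by linarith) (by simp) (hin s (le_max_left _ _) hs1))

/-- An arc set with one left end point is an arc. -/
lemma IsArcSet.exists_length {a : ℝ} {E : Set ℝ} (h : IsArcSet {a} E) :
    ∃ β, 0 ≤ β ∧ β ≤ 1 ∧ ∀ x, a ≤ x → x < a + 1 → (x ∈ E ↔ x < a + β) := by
  have hanti : ∀ s t, a ≤ s → s < t → t < a + 1 → t ∈ E → s ∈ E := by
    intro s t has hst ht htE
    refine h.anti s t hst (by linarith) ?_ htE
    intro p hp k hk
    rw [Finset.mem_singleton] at hp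
    subst hp
    have h1 : (0 : ℝ) < k := by linarith [hk.1]
    have h2 : (k : ℝ) < 1 := by linarith [hk.2]
    norm_cast at h1 h2
    lia
  by_cases ha : a ∈ E
  · by_cases hall : ∀ y, a ≤ y → y < a + 1 → y ∈ E
    · exact ⟨1, zero_le_one, le_rfl, fun x h1 h2 => ⟨fun _ => h2, fun _ => hall x h1 h2⟩⟩
    · push Not at hall
      obtain ⟨y, hay, hy1, hy⟩ := hall
      obtain ⟨b, hab, hby, hin, hb⟩ := exists_arc_end h.right ha hay hy
      refine ⟨b - a, by linarith, by linarith, fun x h1 h2 => ⟨fun hx => ?_, fun hx => ?_⟩⟩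
      · by_contra hcon
        push Not at hcon
        rcases eq_or_lt_of_le hcon with h3 | h3
        · apply hb; convert hx using 1; linarith
        · exact hb (hanti b x hab.le (by linarith) h2 hx)
      · exact hin x h1 (by linarith)
  · refine ⟨0, le_rfl, zero_le_one, fun x h1 h2 => ⟨fun hx => ?_, fun hx => ?_⟩⟩
    · rcases eq_or_lt_of_le h1 with h3 | h3
      · exact absurd (h3 ▸ hx) ha
      · exact absurd (hanti a x le_rfl h3 h2 hx) ha
    · linarith

/-- Composition with `Int.fract` serves as the periodic extension, so the period can be cut at the
left end of an arc. It disagrees with `φ` only at the end point `1`, a null set. -/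
lemma setIntegral_comp_fract {V : Type*} [NormedAddCommGroup V] [NormedSpace ℝ V] (φ : ℝ → V)
    (a : ℝ) : ∫ x in Set.Ioc a (a + 1), φ (Int.fract x) = ∫ x in Set.Ioc (0 : ℝ) 1, φ x := by
  have hper : Function.Periodic (fun x : ℝ => φ (Int.fract x)) 1 := by
    intro x; simp
  rw [← intervalIntegral.integral_of_le (by linarith), hper.intervalIntegral_add_eq a 0, zero_add,
    intervalIntegral.integral_of_le zero_le_one, integral_Ioc_eq_integral_Ioo,
    integral_Ioc_eq_integral_Ioo]
  refine setIntegral_congr_fun measurableSet_Ioo fun x hx => ?_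
  rw [Int.fract_eq_self.mpr ⟨hx.1.le, hx.2⟩]

lemma memLp_comp_fract {g : ℝ → ℂ} (hm : Measurable g) (hg : MemLp g 2 periodMeasure) (a : ℝ) :
    MemLp (fun x => g (Int.fract x)) 2 (volume.restrict (Set.Ioc a (a + 1))) := by
  have hm' : Measurable fun x : ℝ => g (Int.fract x) := hm.comp measurable_fract
  rw [memLp_two_iff_integrable_sq_norm hm'.aestronglyMeasurable]
  have h1 := integrable_norm_sq hg
  have hper : Function.Periodic (fun x : ℝ => ‖g (Int.fract x)‖ ^ 2) 1 := by
    intro x; simp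
  have h2 : IntervalIntegrable (fun x : ℝ => ‖g (Int.fract x)‖ ^ 2) volume 0 (0 + 1) := by
    rw [zero_add, intervalIntegrable_iff_integrableOn_Ioo_of_le zero_le_one]
    rw [periodMeasure, ← IntegrableOn, integrableOn_Ioc_iff_integrableOn_Ioo] at h1
    refine h1.congr_fun (fun x hx => ?_) measurableSet_Ioo
    dsimp only
    rw [Int.fract_eq_self.mpr ⟨hx.1.le, hx.2⟩]
  have h3 := hper.intervalIntegrable one_ne_zero h2 a (a + 1)
  rwa [intervalIntegrable_iff_integrableOn_Ioc_of_le (by linarith)] at h3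

lemma coef_eq_shift (g : ℝ → ℂ) (n : ℤ) (a : ℝ) :
    coef g n = ∫ x in Set.Ioc a (a + 1), ech (-(n * x)) * g (Int.fract x) := by
  rw [coef, ← setIntegral_comp_fract _ a]
  congr 1
  ext x
  congr 1
  have : -((n : ℝ) * x) = -(n * Int.fract x) + ((-(n * ⌊x⌋) : ℤ) : ℝ) := by
    push_cast
    rw [Int.fract]; ring
  rw [this, ech_add_int]

lemma IsArcSet.volume_eq {a β : ℝ} {E : Set ℝ} (h : IsArcSet {a} E) (hβ0 : 0 ≤ β) (hβ1 : β ≤ 1)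
    (hβ : ∀ x, a ≤ x → x < a + 1 → (x ∈ E ↔ x < a + β)) :
    volume.real (E ∩ Set.Ioc 0 1) = β := by
  have h1 : ∫ x in Set.Ioc (0 : ℝ) 1, E.indicator (1 : ℝ → ℝ) x =
      volume.real (E ∩ Set.Ioc 0 1) := by
    rw [integral_indicator_one h.meas, Measure.real, Measure.restrict_apply h.meas, Measure.real]
  rw [← h1, ← setIntegral_comp_fract _ a, integral_Ioc_eq_integral_Ioo]
  have h2 : ∀ x ∈ Set.Ioo a (a + 1), E.indicator (1 : ℝ → ℝ) (Int.fract x) =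
      (Set.Iio (a + β)).indicator 1 x := by
    intro x hx
    have := hβ x hx.1.le hx.2
    by_cases hxE : x ∈ E
    · rw [Set.indicator_of_mem ((h.fract_mem x).mpr hxE),
        Set.indicator_of_mem (Set.mem_Iio.mpr (this.mp hxE))]
      rfl
    · rw [Set.indicator_of_notMem (fun h' => hxE ((h.fract_mem x).mp h')),
        Set.indicator_of_notMem (s := Set.Iio (a + β)) (fun h' => hxE (this.mpr h'))]
  rw [setIntegral_congr_fun measurableSet_Ioo h2, integral_indicator_one measurableSet_Iio,
    Measure.real, Measure.restrict_apply measurableSet_Iio]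
  have h3 : Set.Iio (a + β) ∩ Set.Ioo a (a + 1) = Set.Ioo a (a + β) := by
    ext x
    simp only [Set.mem_inter_iff, Set.mem_Iio, Set.mem_Ioo]
    constructor
    · rintro ⟨h4, h5, h6⟩; exact ⟨h5, h4⟩
    · rintro ⟨h4, h5⟩; exact ⟨h5, h4, by linarith⟩
  rw [h3, Real.volume_Ioo, add_sub_cancel_left, ENNReal.toReal_ofReal hβ0]

lemma round_div_bound (β : ℝ) (n : ℤ) : |((round (n / β) : ℤ) : ℝ) - n / β| ≤ 1 / 2 := by
  rw [abs_sub_comm]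
  exact abs_sub_round _

lemma round_div_injective {β : ℝ} (hβ : 0 < β) (hβ' : β ≤ 1 / 4) :
    Function.Injective fun n : ℤ => round ((n : ℝ) / β) := by
  intro n m hnm
  dsimp only at hnm
  have h1 := round_div_bound β n
  have h2 := round_div_bound β m
  rw [hnm] at h1
  rw [abs_le] at h1 h2
  have h3 : (n : ℝ) / β - m / β ≤ 1 := by linarith
  have h4 : (m : ℝ) / β - n / β ≤ 1 := by linarith
  rw [← sub_div, div_le_iff₀ hβ] at h3 h4
  have h5 : (n : ℝ) < m + 1 := by linarith
  have h6 : (m : ℝ) < n + 1 := by linarith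
  norm_cast at h5 h6
  lia

/-- Rounding sends halves up, so the condition that the rounded value lies in `[p, q)` cuts out an
interval of integers `n` of length `(q - p) β`, up to rounding its ends. -/
lemma hasDensity_round {β : ℝ} (hβ : 0 < β) (hβ' : β ≤ 1 / 4) :
    HasDensity (Set.range fun n : ℤ => round ((n : ℝ) / β)) β := by
  refine ⟨1, fun p q hpq => ?_⟩
  have himg : (Set.range fun n : ℤ => round ((n : ℝ) / β)) ∩ Set.Ico p q =
      (fun n : ℤ => round ((n : ℝ) / β)) '' Set.Ico ⌈(p - 1 / 2) * β⌉ ⌈(q - 1 / 2) * β⌉ := by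
    ext x
    have key : ∀ n : ℤ, (p ≤ round ((n : ℝ) / β) ∧ round ((n : ℝ) / β) < q) ↔
        (⌈(p - 1 / 2) * β⌉ ≤ n ∧ n < ⌈(q - 1 / 2) * β⌉) := by
      intro n
      rw [round_eq, Int.le_floor, Int.floor_lt, Int.ceil_le, Int.lt_ceil, ← sub_le_iff_le_add,
        ← lt_sub_iff_add_lt, le_div_iff₀ hβ, div_lt_iff₀ hβ]
    constructor
    · rintro ⟨⟨n, rfl⟩, hn⟩
      exact ⟨n, (key n).mp hn, rfl⟩
    · rintro ⟨n, hn, rfl⟩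
      exact ⟨⟨n, rfl⟩, (key n).mpr hn⟩
  have hle : ⌈((p : ℝ) - 1 / 2) * β⌉ ≤ ⌈((q : ℝ) - 1 / 2) * β⌉ := by
    apply Int.ceil_mono
    have : (p : ℝ) ≤ q := by exact_mod_cast hpq
    nlinarith
  rw [himg, Set.ncard_image_of_injective _ (round_div_injective hβ hβ'), ncard_Ico_int hle, abs_le]
  have h1 := Int.le_ceil (((p : ℝ) - 1 / 2) * β)
  have h2 := Int.ceil_lt_add_one (((p : ℝ) - 1 / 2) * β)
  have h3 := Int.le_ceil (((q : ℝ) - 1 / 2) * β)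
  have h4 := Int.ceil_lt_add_one (((q : ℝ) - 1 / 2) * β)
  constructor <;> linarith

/-- The exponentials with frequencies `n / β` are orthogonal and complete on the arc, and rounding
moves each frequency by at most `1/2`. -/
lemma IsArcSet.samples_round {a β : ℝ} {E : Set ℝ} (h : IsArcSet {a} E) (hβ : 0 < β)
    (hβ' : β ≤ 1 / 4) (hE : ∀ x, a ≤ x → x < a + 1 → (x ∈ E ↔ x < a + β)) :
    Samples (Set.range fun n : ℤ => round ((n : ℝ) / β)) E := by
  refine Samples.of_indicator h.meas (c := β / 9) (by positivity) fun g hm hL h0 => ?_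
  have hG := memLp_comp_fract hm hL a
  have hsub : Set.Ioc a (a + β) ⊆ Set.Ioc a (a + 1) :=
    Set.Ioc_subset_Ioc_right (by linarith)
  have hG' := hG.mono_measure (Measure.restrict_mono_set volume hsub)
  have hzero : ∀ᵐ x, x ∈ Set.Ioc a (a + 1) \ Set.Ioc a (a + β) → g (Int.fract x) = 0 := by
    have : ∀ᵐ x : ℝ, x ≠ a + 1 := by simp [ae_iff]
    filter_upwards [this] with x hx hx'
    apply h0
    rw [h.fract_mem, hE x hx'.1.1.le (lt_of_le_of_ne hx'.1.2 hx)]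
    intro hlt
    exact hx'.2 ⟨hx'.1.1, hlt.le⟩
  have hcoef : ∀ n : ℤ, coef g n = ∫ x in Set.Ioc a (a + β), ech (-(n * x)) * g (Int.fract x) := by
    intro n
    rw [coef_eq_shift g n a]
    refine setIntegral_eq_of_subset_of_ae_sdiff_eq_zero measurableSet_Ioc.nullMeasurableSet hsub ?_
    filter_upwards [hzero] with x hx hx'
    rw [hx hx', mul_zero]
  have hnorm : ∫ x, ‖g x‖ ^ 2 ∂periodMeasure =
      ∫ x in Set.Ioc a (a + β), ‖g (Int.fract x)‖ ^ 2 := by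
    rw [← setIntegral_comp_fract (fun x => ‖g x‖ ^ 2) a]
    refine setIntegral_eq_of_subset_of_ae_sdiff_eq_zero measurableSet_Ioc.nullMeasurableSet hsub ?_
    filter_upwards [hzero] with x hx hx'
    rw [hx hx']
    simp
  have hinj := round_div_injective hβ hβ'
  rw [hnorm, tsum_range (fun n : ℤ => ‖coef g n‖ ^ 2) hinj]
  have hsum := (hasSum_sq_coef hL).summable.comp_injective hinj
  have e1 : a + β / 2 - β / 2 = a := by ring
  have e2 : a + β / 2 + β / 2 = a + β := by ring
  have key := perturbed_frame_bound (x₀ := a + β / 2) hβ hβ' (g := fun x => g (Int.fract x))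
    (l := fun n => (round ((n : ℝ) / β) : ℤ))
  rw [e1, e2] at key
  have h2 := key hG' (round_div_bound β)
  simp only [Function.comp_def, hcoef] at hsum ⊢
  exact h2 hsum

/-! ### Triangular systems of sampled functions -/

lemma coef_add {g g' : ℝ → ℂ} (hg : MemLp g 2 periodMeasure) (hg' : MemLp g' 2 periodMeasure)
    (n : ℤ) : coef (g + g') n = coef g n + coef g' n := by
  have hi : ∀ {f : ℝ → ℂ}, MemLp f 2 periodMeasure →
      Integrable (fun x => ech (-(n * x)) * f x) periodMeasure := fun hf =>
    (hf.ech_mul (f := fun x => -(n * x)) (by fun_prop)).integrable (by norm_num)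
  rw [coef, coef, coef, ← integral_add (hi hg) (hi hg')]
  simp only [Pi.add_apply, mul_add]

lemma summable_sq_coef {g : ℝ → ℂ} (hg : MemLp g 2 periodMeasure) (Λ : Set ℤ) :
    Summable fun n : Λ => ‖coef g n‖ ^ 2 :=
  (hasSum_sq_coef hg).summable.subtype Λ

lemma tsum_sq_coef_le {g : ℝ → ℂ} (hg : MemLp g 2 periodMeasure) (Λ : Set ℤ) :
    ∑' n : Λ, ‖coef g n‖ ^ 2 ≤ ∫ x, ‖g x‖ ^ 2 ∂periodMeasure := by
  rw [← (hasSum_sq_coef hg).tsum_eq]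
  exact (hasSum_sq_coef hg).summable.tsum_subtype_le (fun n : ℤ => ‖coef g n‖ ^ 2) Λ
    (fun n => by positivity)

/-- Samples of a function control its part on the sampled set up to the part off that set. -/
lemma samples_le_of_split {Λ : Set ℤ} {A : Set ℝ} (hA : MeasurableSet A) {c : ℝ}
    (hc : ∀ g : ℝ → ℂ, Measurable g → MemLp g 2 periodMeasure →
      (∀ᵐ x ∂periodMeasure, x ∉ A → g x = 0) →
      c * ∫ x, ‖g x‖ ^ 2 ∂periodMeasure ≤ ∑' n : Λ, ‖coef g n‖ ^ 2)
    {g : ℝ → ℂ} (hm : Measurable g) (hg : MemLp g 2 periodMeasure) :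
    c * ∫ x, ‖A.indicator g x‖ ^ 2 ∂periodMeasure ≤
      2 * ∑' n : Λ, ‖coef g n‖ ^ 2 + 2 * ∫ x, ‖Aᶜ.indicator g x‖ ^ 2 ∂periodMeasure := by
  have h1 := hc (A.indicator g) (hm.indicator hA) (hg.indicator hA)
    (ae_of_all _ fun x hx => Set.indicator_of_notMem hx g)
  have hgA := hg.indicator hA
  have hgA' := hg.indicator hA.compl
  have h2 : ∀ n : Λ, ‖coef (A.indicator g) n‖ ^ 2 ≤
      2 * ‖coef g n‖ ^ 2 + 2 * ‖coef (Aᶜ.indicator g) n‖ ^ 2 := by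
    intro n
    have h3 : coef (A.indicator g) n = coef g n - coef (Aᶜ.indicator g) n := by
      rw [eq_sub_iff_add_eq, ← coef_add hgA hgA', Set.indicator_self_add_compl]
    have h4 : ‖coef (A.indicator g) n‖ ≤ ‖coef g n‖ + ‖coef (Aᶜ.indicator g) n‖ := by
      rw [h3]; exact norm_sub_le _ _
    nlinarith [norm_nonneg (coef (A.indicator g) n), norm_nonneg (coef g n),
      norm_nonneg (coef (Aᶜ.indicator g) n), sq_nonneg (‖coef g n‖ - ‖coef (Aᶜ.indicator g) n‖)]
  refine h1.trans (((summable_sq_coef hgA Λ).tsum_le_tsum h2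
    (((summable_sq_coef hg Λ).mul_left 2).add ((summable_sq_coef hgA' Λ).mul_left 2))).trans ?_)
  rw [((summable_sq_coef hg Λ).mul_left 2).tsum_add ((summable_sq_coef hgA' Λ).mul_left 2),
    tsum_mul_left, tsum_mul_left]
  have := tsum_sq_coef_le hgA' Λ
  linarith

/-- A triangular system of inequalities bounds all unknowns by the data. -/
lemma exists_triangular_bound {R : ℕ} (c : Fin R → ℝ) (hc : ∀ r, 0 < c r) {C : ℝ} (hC : 0 ≤ C) :
    ∃ D : ℝ, 0 < D ∧ ∀ x Q : Fin R → ℝ, (∀ r, 0 ≤ Q r) →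
      (∀ r, c r * x r ≤ 2 * Q r + C * ∑ r' with r' < r, x r') → ∑ r, x r ≤ D * ∑ r, Q r := by
  have key : ∀ r : Fin R, ∃ D : ℝ, 0 ≤ D ∧ ∀ x Q : Fin R → ℝ, (∀ r, 0 ≤ Q r) →
      (∀ r, c r * x r ≤ 2 * Q r + C * ∑ r' with r' < r, x r') → x r ≤ D * ∑ r, Q r := by
    intro r
    induction r using WellFoundedLT.induction with
    | ind r ih =>
    choose! D hD0 hD using ih
    have hsum0 : 0 ≤ ∑ r' with r' < r, D r' :=
      Finset.sum_nonneg fun r' hr' => hD0 r' (Finset.mem_filter.mp hr').2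
    refine ⟨(2 + C * ∑ r' with r' < r, D r') / c r, div_nonneg (by positivity) (hc r).le, ?_⟩
    intro x Q hQ hx
    have h1 : ∑ r' with r' < r, x r' ≤ (∑ r' with r' < r, D r') * ∑ r, Q r := by
      rw [Finset.sum_mul]
      exact Finset.sum_le_sum fun r' hr' => hD r' (Finset.mem_filter.mp hr').2 x Q hQ hx
    have h2 : Q r ≤ ∑ r, Q r := Finset.single_le_sum (fun r _ => hQ r) (Finset.mem_univ r)
    rw [div_mul_eq_mul_div, le_div_iff₀ (hc r)]
    have h3 := mul_le_mul_of_nonneg_left h1 hC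
    linarith [hx r]
  choose D hD0 hD using key
  refine ⟨1 + ∑ r, D r, by have := Finset.sum_nonneg fun r (_ : r ∈ Finset.univ) => hD0 r; linarith,
    fun x Q hQ hx => ?_⟩
  have h1 : ∑ r, x r ≤ (∑ r, D r) * ∑ r, Q r := by
    rw [Finset.sum_mul]
    exact Finset.sum_le_sum fun r _ => hD r x Q hQ hx
  have h2 : 0 ≤ ∑ r, Q r := Finset.sum_nonneg fun r _ => hQ r
  linarith

/-- Stable sampling of a vector-valued function whose components are, off their own sampled set,
controlled by the preceding components. -/
lemma exists_triangular_sampling {R : ℕ} {Λ : Fin R → Set ℤ} {A : Fin R → Set ℝ}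
    (hA : ∀ r, MeasurableSet (A r)) (hΛ : ∀ r, Samples (Λ r) (A r)) {C : ℝ} (hC : 0 ≤ C) :
    ∃ c : ℝ, 0 < c ∧ ∀ g : Fin R → ℝ → ℂ, (∀ r, Measurable (g r)) →
      (∀ r, MemLp (g r) 2 periodMeasure) →
      (∀ᵐ x ∂periodMeasure, ∀ r, x ∉ A r →
        ‖g r x‖ ^ 2 ≤ C * ∑ r' with r' < r, ‖(A r').indicator (g r') x‖ ^ 2) →
      c * ∑ r, ∫ x, ‖(A r).indicator (g r) x‖ ^ 2 ∂periodMeasure ≤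
        ∑ r, ∑' n : Λ r, ‖coef (g r) n‖ ^ 2 := by
  choose c hc hs using hΛ
  -- The factor `2` is the one before the off-set energy in `samples_le_of_split`.
  obtain ⟨D, hD, hD'⟩ := exists_triangular_bound c hc (C := 2 * C) (by positivity)
  refine ⟨D⁻¹, by positivity, fun g hm hg hdom => ?_⟩
  rw [inv_mul_le_iff₀ hD]
  refine hD' _ _ (fun r => tsum_nonneg fun _ => by positivity) fun r => ?_
  refine (samples_le_of_split (hA r) (hs r) (hm r) (hg r)).trans ?_
  have hint : ∀ r', Integrable (fun x => ‖(A r').indicator (g r') x‖ ^ 2) periodMeasure :=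
    fun r' => integrable_norm_sq ((hg r').indicator (hA r'))
  have h1 : ∫ x, ‖(A r)ᶜ.indicator (g r) x‖ ^ 2 ∂periodMeasure ≤
      C * ∑ r' with r' < r, ∫ x, ‖(A r').indicator (g r') x‖ ^ 2 ∂periodMeasure := by
    rw [← integral_finsetSum _ fun r' _ => hint r', ← integral_const_mul]
    refine integral_mono_ae (integrable_norm_sq ((hg r).indicator (hA r).compl))
      ((integrable_finsetSum _ fun r' _ => hint r').const_mul C) ?_
    filter_upwards [hdom] with x hx
    by_cases hxA : x ∈ A r
    · rw [Set.indicator_of_notMem (by simpa using hxA), norm_zero]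
      have : 0 ≤ ∑ r' with r' < r, ‖(A r').indicator (g r') x‖ ^ 2 := by positivity
      simpa using mul_nonneg hC this
    · rw [Set.indicator_of_mem (by simpa using hxA)]
      exact hx r hxA
  linarith

/-! ### Greedy row bases -/

section Greedy

variable {R : ℕ} {ι : Type*}

/-- The `r`-th row of a matrix, restricted to a set of columns. -/
def rowOn (m : Matrix (Fin R) ι ℂ) (K : Finset ι) (r : Fin R) : K → ℂ := fun i => m r i

open Classical in
/-- The lexicographically first basis of the rows of a matrix restricted to a set of columns. -/
noncomputable def greedy (m : Matrix (Fin R) ι ℂ) (K : Finset ι) : Finset (Fin R) :=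
  {r | rowOn m K r ∉ Submodule.span ℂ (rowOn m K '' {r' | r' < r})}

lemma mem_greedy {m : Matrix (Fin R) ι ℂ} {K : Finset ι} {r : Fin R} :
    r ∈ greedy m K ↔ rowOn m K r ∉ Submodule.span ℂ (rowOn m K '' {r' | r' < r}) := by
  simp [greedy]

lemma span_rows_le_span_greedy (m : Matrix (Fin R) ι ℂ) (K : Finset ι) (r : Fin R) :
    Submodule.span ℂ (rowOn m K '' {r' | r' < r}) ≤
      Submodule.span ℂ (rowOn m K '' {r' | r' ∈ greedy m K ∧ r' < r}) := by
  induction r using WellFoundedLT.induction with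
  | ind r ih =>
  rw [Submodule.span_le]
  rintro _ ⟨s, hs, rfl⟩
  by_cases hsg : s ∈ greedy m K
  · exact Submodule.subset_span ⟨s, ⟨hsg, hs⟩, rfl⟩
  · rw [mem_greedy, not_not] at hsg
    refine Submodule.span_mono (Set.image_mono ?_) (ih s hs hsg)
    rintro x ⟨hx, hx'⟩
    exact ⟨hx, hx'.trans hs⟩

lemma rowOn_mem_span_greedy (m : Matrix (Fin R) ι ℂ) (K : Finset ι) (r : Fin R) :
    rowOn m K r ∈ Submodule.span ℂ (rowOn m K '' (greedy m K : Set (Fin R))) := by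
  by_cases hr : r ∈ greedy m K
  · exact Submodule.subset_span ⟨r, hr, rfl⟩
  · rw [mem_greedy, not_not] at hr
    refine Submodule.span_mono (Set.image_mono ?_) (span_rows_le_span_greedy m K r hr)
    exact fun x hx => hx.1

lemma linearIndependent_greedy (m : Matrix (Fin R) ι ℂ) (K : Finset ι) :
    LinearIndependent ℂ fun r : greedy m K => rowOn m K r := by
  rw [Fintype.linearIndependent_iff]
  intro g hg
  by_contra hcon
  push Not at hcon
  have hne : (Finset.univ.filter fun r : greedy m K => g r ≠ 0).Nonempty := by
    obtain ⟨i, hi⟩ := hcon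
    exact ⟨i, by simpa using hi⟩
  obtain ⟨r, hr, hmax⟩ := Finset.exists_max_image _ id hne
  rw [Finset.mem_filter] at hr
  apply mem_greedy.mp r.2
  rw [← Finset.add_sum_erase _ _ (Finset.mem_univ r), add_eq_zero_iff_eq_neg] at hg
  have h1 : rowOn m K r = (g r)⁻¹ • -(∑ x ∈ Finset.univ.erase r, g x • rowOn m K x) := by
    rw [← hg, inv_smul_smul₀ hr.2]
  rw [h1]
  refine Submodule.smul_mem _ _ (Submodule.neg_mem _ (Submodule.sum_mem _ fun s hs => ?_))
  by_cases hs0 : g s = 0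
  · rw [hs0, zero_smul]; exact Submodule.zero_mem _
  · refine Submodule.smul_mem _ _ (Submodule.subset_span ⟨s, ?_, rfl⟩)
    have h2 : s ≤ r := hmax s (by simpa using hs0)
    exact lt_of_le_of_ne h2 (Finset.ne_of_mem_erase hs)

/-- A linear relation among rows on the columns `I` persists on fewer columns. This is what bounds
the number of sampled vertices. -/
lemma greedy_mono (m : Matrix (Fin R) ι ℂ) {K I : Finset ι} (h : K ⊆ I) :
    greedy m K ⊆ greedy m I := by
  intro r hr
  rw [mem_greedy] at hr ⊢
  intro hI
  apply hr
  let res : (I → ℂ) →ₗ[ℂ] (K → ℂ) := LinearMap.funLeft ℂ ℂ fun i : K => (⟨i, h i.2⟩ : I)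
  have h1 := Submodule.mem_map_of_mem (f := res) hI
  rwa [Submodule.map_span, ← Set.image_comp] at h1

/-- Cauchy–Schwarz applied to the coefficients of the linear combination. -/
lemma exists_bound_of_mem_span {κ : Type*} [Fintype κ] {u : Fin R → κ → ℂ} {S : Finset (Fin R)}
    {v : κ → ℂ} (hv : v ∈ Submodule.span ℂ (u '' (S : Set (Fin R)))) :
    ∃ C : ℝ, 0 ≤ C ∧ ∀ f : κ → ℂ, ‖v ⬝ᵥ f‖ ^ 2 ≤ C * ∑ r ∈ S, ‖u r ⬝ᵥ f‖ ^ 2 := by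
  rw [Submodule.mem_span_image_finset_iff_exists_fun] at hv
  obtain ⟨c, rfl⟩ := hv
  refine ⟨∑ r : S, ‖c r‖ ^ 2, by positivity, fun f => ?_⟩
  rw [sum_dotProduct, ← Finset.sum_coe_sort S]
  simp only [smul_dotProduct, smul_eq_mul]
  calc ‖∑ r : S, c r * (u r ⬝ᵥ f)‖ ^ 2 ≤ (∑ r : S, ‖c r‖ * ‖u r ⬝ᵥ f‖) ^ 2 := by
        gcongr
        refine (norm_sum_le _ _).trans (le_of_eq ?_)
        simp only [norm_mul]
    _ ≤ _ := Finset.sum_mul_sq_le_sq_mul_sq _ _ _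

variable [Fintype ι]

lemma dotProduct_eq_restrict {K : Finset ι} (v f : ι → ℂ) (hf : ∀ i ∉ K, f i = 0) :
    v ⬝ᵥ f = (fun i : K => v i) ⬝ᵥ (fun i : K => f i) := by
  rw [dotProduct, dotProduct, Finset.sum_coe_sort K fun i => v i * f i]
  symm
  refine Finset.sum_subset (Finset.subset_univ K) fun i _ hi => ?_
  rw [hf i hi, mul_zero]

/-- If the columns are independent, then the greedy rows are as many as the columns. -/
lemma card_greedy {m : Matrix (Fin R) ι ℂ} (hm : ∀ f : ι → ℂ, m.mulVec f = 0 → f = 0)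
    (K : Finset ι) : (greedy m K).card = K.card := by
  classical
  apply le_antisymm
  · have := (linearIndependent_greedy m K).fintype_card_le_finrank
    simpa using this
  -- A vector on `K` killed by the greedy rows is killed by all rows, since the greedy ones span
  -- them; its extension by zero then vanishes by `hm`, so `T` is injective.
  · let T : (K → ℂ) →ₗ[ℂ] (greedy m K → ℂ) :=
      LinearMap.pi fun r => dotProductBilin ℂ ℂ (rowOn m K r)
    have hT : Function.Injective T := by
      rw [← LinearMap.ker_eq_bot, LinearMap.ker_eq_bot']
      intro f hf
      have hf' : ∀ r ∈ greedy m K, rowOn m K r ⬝ᵥ f = 0 := fun r hr =>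
        congr_fun hf ⟨r, hr⟩
      let F : ι → ℂ := fun i => if h : i ∈ K then f ⟨i, h⟩ else 0
      have hF : F = 0 := by
        apply hm
        ext r
        obtain ⟨C, -, hC⟩ := exists_bound_of_mem_span (rowOn_mem_span_greedy m K r)
        have h1 := hC f
        rw [Finset.sum_eq_zero fun r hr => by rw [hf' r hr]; simp, mul_zero] at h1
        have h2 : rowOn m K r ⬝ᵥ f = 0 := by
          rw [← norm_eq_zero]
          nlinarith [norm_nonneg (rowOn m K r ⬝ᵥ f)]
        rw [Matrix.mulVec, dotProduct_eq_restrict (K := K) (m r) F fun i hi => dif_neg hi]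
        have hFf : (fun i : K => F i) = f := by
          ext i
          simp [F]
        rw [hFf]
        exact h2
      ext i
      have := congr_fun hF i
      simpa [F] using this
    have := LinearMap.finrank_le_finrank_of_injective hT
    simpa using this

/-- The greedy rows control the preceding rows, and the whole vector. -/
lemma exists_greedy_bound {m : Matrix (Fin R) ι ℂ} (hm : ∀ f : ι → ℂ, m.mulVec f = 0 → f = 0) :
    ∃ C : ℝ, 0 ≤ C ∧ ∀ (K : Finset ι) (f : ι → ℂ), (∀ i ∉ K, f i = 0) →
      (∀ r ∉ greedy m K, ‖m r ⬝ᵥ f‖ ^ 2 ≤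
        C * ∑ r' with r' ∈ greedy m K ∧ r' < r, ‖m r' ⬝ᵥ f‖ ^ 2) ∧
      ∑ i, ‖f i‖ ^ 2 ≤ C * ∑ r ∈ greedy m K, ‖m r ⬝ᵥ f‖ ^ 2 := by
  classical
  have h1 : ∀ (K : Finset ι) (r : Fin R), ∃ C : ℝ, 0 ≤ C ∧ (r ∉ greedy m K → ∀ f : K → ℂ,
      ‖rowOn m K r ⬝ᵥ f‖ ^ 2 ≤
        C * ∑ r' with r' ∈ greedy m K ∧ r' < r, ‖rowOn m K r' ⬝ᵥ f‖ ^ 2) := by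
    intro K r
    by_cases hr : r ∈ greedy m K
    · exact ⟨0, le_rfl, fun h => absurd hr h⟩
    · have h := span_rows_le_span_greedy m K r (by rwa [mem_greedy, not_not] at hr)
      obtain ⟨C, hC, hC'⟩ := exists_bound_of_mem_span
        (S := Finset.univ.filter fun r' => r' ∈ greedy m K ∧ r' < r) (by simpa using h)
      exact ⟨C, hC, fun _ => hC'⟩
  have h2 : ∀ (K : Finset ι) (i : ι), ∃ C : ℝ, 0 ≤ C ∧ ∀ h : i ∈ K, ∀ f : K → ℂ,
      ‖f ⟨i, h⟩‖ ^ 2 ≤ C * ∑ r ∈ greedy m K, ‖rowOn m K r ⬝ᵥ f‖ ^ 2 := by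
    intro K i
    by_cases hi : i ∈ K
    · have htop : Submodule.span ℂ (Set.range fun r : greedy m K => rowOn m K r) = ⊤ := by
        apply (linearIndependent_greedy m K).span_eq_top_of_card_eq_finrank'
        simpa using card_greedy hm K
      -- The greedy rows are `|K|` independent vectors in dimension `|K|`, so each coordinate
      -- functional is a combination of them.
      have h : (Pi.single ⟨i, hi⟩ 1 : K → ℂ) ∈
          Submodule.span ℂ (rowOn m K '' (greedy m K : Set (Fin R))) := by
        rw [Set.image_eq_range]
        exact htop ▸ Submodule.mem_top
      obtain ⟨C, hC, hC'⟩ := exists_bound_of_mem_span h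
      refine ⟨C, hC, fun _ f => ?_⟩
      have := hC' f
      rwa [single_dotProduct, one_mul] at this
    · exact ⟨0, le_rfl, fun h => absurd h hi⟩
  choose C₁ hC₁ hC₁' using h1
  choose C₂ hC₂ hC₂' using h2
  -- There are only finitely many column sets, rows and indices, so the sum of all constants is
  -- uniform in `K`.
  refine ⟨∑ K, ∑ r, C₁ K r + ∑ K, ∑ i, C₂ K i, ?_, fun K f hf => ?_⟩
  · exact add_nonneg (Finset.sum_nonneg fun K _ => Finset.sum_nonneg fun r _ => hC₁ K r)
      (Finset.sum_nonneg fun K _ => Finset.sum_nonneg fun r _ => hC₂ K r)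
  have hn1 : 0 ≤ ∑ K, ∑ r, C₁ K r :=
    Finset.sum_nonneg fun K _ => Finset.sum_nonneg fun r _ => hC₁ K r
  have hn2 : 0 ≤ ∑ K, ∑ i, C₂ K i :=
    Finset.sum_nonneg fun K _ => Finset.sum_nonneg fun r _ => hC₂ K r
  have hrow : ∀ r, m r ⬝ᵥ f = rowOn m K r ⬝ᵥ fun i : K => f i := fun r =>
    dotProduct_eq_restrict (m r) f hf
  simp_rw [hrow]
  constructor
  · intro r hr
    refine (hC₁' K r hr _).trans (mul_le_mul_of_nonneg_right ?_ (by positivity))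
    have h3 : C₁ K r ≤ ∑ r, C₁ K r :=
      Finset.single_le_sum (fun r _ => hC₁ K r) (Finset.mem_univ r)
    have h4 : ∑ r, C₁ K r ≤ ∑ K, ∑ r, C₁ K r :=
      Finset.single_le_sum (f := fun K => ∑ r, C₁ K r)
        (fun K _ => Finset.sum_nonneg fun r _ => hC₁ K r) (Finset.mem_univ K)
    linarith
  · have h3 : ∑ i, ‖f i‖ ^ 2 ≤
        (∑ i, C₂ K i) * ∑ r ∈ greedy m K, ‖rowOn m K r ⬝ᵥ fun i : K => f i‖ ^ 2 := by
      rw [Finset.sum_mul]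
      refine Finset.sum_le_sum fun i _ => ?_
      by_cases hi : i ∈ K
      · exact hC₂' K i hi fun i : K => f i
      · rw [hf i hi]
        rw [norm_zero, zero_pow two_ne_zero]
        exact mul_nonneg (hC₂ K i) (by positivity)
    refine h3.trans (mul_le_mul_of_nonneg_right ?_ (by positivity))
    have h4 : ∑ i, C₂ K i ≤ ∑ K, ∑ i, C₂ K i :=
      Finset.single_le_sum (f := fun K => ∑ i, C₂ K i)
        (fun K _ => Finset.sum_nonneg fun r _ => hC₂ K r) (Finset.mem_univ K)
    linarith

/-- For a Vandermonde matrix, the greedy rows are the first ones. -/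
lemma mem_greedy_vandermonde {M : ℕ} {x : Fin M → ℂ} (hx : Function.Injective x)
    (K : Finset (Fin M)) (s : Fin M) :
    s ∈ greedy (Matrix.of fun (s j : Fin M) => x j ^ (s : ℕ)) K ↔ (s : ℕ) < K.card := by
  classical
  set m : Matrix (Fin M) (Fin M) ℂ := Matrix.of fun (s j : Fin M) => x j ^ (s : ℕ) with hm
  have hinj : ∀ f : Fin M → ℂ, m.mulVec f = 0 → f = 0 := by
    intro f hf
    refine Matrix.eq_zero_of_forall_pow_sum_mul_pow_eq_zero hx fun i => ?_
    have := congr_fun hf i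
    rw [Matrix.mulVec, dotProduct] at this
    simpa [hm, mul_comm] using this
  have hsub : Finset.univ.filter (fun s : Fin M => (s : ℕ) < K.card) ⊆ greedy m K := by
    intro s hs
    rw [Finset.mem_filter] at hs
    rw [mem_greedy]
    intro hspan
    have hset : {r' : Fin M | r' < s} = (Finset.univ.filter fun r' => r' < s : Finset (Fin M)) := by
      ext; simp
    rw [hset, Submodule.mem_span_image_finset_iff_exists_fun] at hspan
    obtain ⟨c, hc⟩ := hspan
    -- A dependence of row `s` on the preceding rows gives a monic polynomial of degree `s` with
    -- `|K| > s` distinct roots.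
    let p : Polynomial ℂ := ∑ r' : (Finset.univ.filter fun r' => r' < s : Finset (Fin M)),
      Polynomial.C (c r') * Polynomial.X ^ ((r' : Fin M) : ℕ)
    have hdeg : p.degree < (s : ℕ) := by
      refine (Polynomial.degree_sum_le _ _).trans_lt ?_
      rw [Finset.sup_lt_iff (by exact_mod_cast WithBot.bot_lt_coe _)]
      intro r' hr'
      refine (Polynomial.degree_C_mul_X_pow_le _ _).trans_lt ?_
      have : ((r' : Fin M) : ℕ) < s := (Finset.mem_filter.mp r'.2).2
      exact_mod_cast this
    have hmon := Polynomial.monic_X_pow_sub hdeg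
    have hnat : (Polynomial.X ^ (s : ℕ) - p).natDegree = (s : ℕ) := by
      apply Polynomial.natDegree_eq_of_degree_eq_some
      rw [Polynomial.degree_sub_eq_left_of_degree_lt (by rwa [Polynomial.degree_X_pow]),
        Polynomial.degree_X_pow]
    refine hmon.ne_zero (Polynomial.eq_zero_of_natDegree_lt_card_of_eval_eq_zero _
      (hx.comp (Subtype.val_injective (p := (· ∈ K)))) (fun i => ?_) (by simpa [hnat] using hs.2))
    have := congr_fun hc i
    simp only [Finset.sum_apply, Pi.smul_apply, rowOn, hm, Matrix.of_apply, smul_eq_mul] at this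
    simp only [p, Function.comp, Polynomial.eval_sub, Polynomial.eval_pow, Polynomial.eval_X,
      Polynomial.eval_finsetSum, Polynomial.eval_mul, Polynomial.eval_C]
    rw [sub_eq_zero]
    exact this.symm
  have hcard : (Finset.univ.filter fun s : Fin M => (s : ℕ) < K.card).card = K.card := by
    rw [Fin.card_filter_val_lt]
    exact min_eq_right (by simpa using Finset.card_le_univ K)
  have heq := Finset.eq_of_subset_of_card_le hsub (by rw [hcard, card_greedy hinj])
  rw [← heq]
  simp

/-- Stable sampling of the products of a matrix with a vector whose support varies: each row is
sampled where it belongs to the greedy basis of the rows. -/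
lemma exists_greedy_sampling {m : Matrix (Fin R) ι ℂ} (hm : ∀ f : ι → ℂ, m.mulVec f = 0 → f = 0)
    {K : ℝ → Finset ι} {A : Fin R → Set ℝ} (hA : ∀ r, MeasurableSet (A r))
    (hAK : ∀ r t, t ∈ A r ↔ r ∈ greedy m (K t)) {Λ : Fin R → Set ℤ}
    (hΛ : ∀ r, Samples (Λ r) (A r)) :
    ∃ c : ℝ, 0 < c ∧ ∀ (f : ℝ → ι → ℂ) (g : Fin R → ℝ → ℂ), (∀ r, Measurable (g r)) →
      (∀ r, MemLp (g r) 2 periodMeasure) →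
      (∀ᵐ t ∂periodMeasure, ∀ i ∉ K t, f t i = 0) →
      (∀ᵐ t ∂periodMeasure, ∀ r, ‖g r t‖ = ‖m r ⬝ᵥ f t‖) →
      c * ∫ t, ∑ i, ‖f t i‖ ^ 2 ∂periodMeasure ≤ ∑ r, ∑' n : Λ r, ‖coef (g r) n‖ ^ 2 := by
  classical
  obtain ⟨C, hC, hbound⟩ := exists_greedy_bound hm
  obtain ⟨c, hc, hsamp⟩ := exists_triangular_sampling hA hΛ hC
  -- `C` may be zero, hence the denominator `C + 1`.
  refine ⟨c / (C + 1), by positivity, fun f g hgm hg hf hfg => ?_⟩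
  have hind : ∀ r t, ‖(A r).indicator (g r) t‖ ^ 2 =
      if r ∈ greedy m (K t) then ‖g r t‖ ^ 2 else 0 := by
    intro r t
    rw [Set.indicator_apply]
    simp only [hAK]
    split_ifs <;> simp
  have h1 := hsamp g hgm hg (by
    filter_upwards [hf, hfg] with t ht ht' r hr
    rw [ht']
    refine ((hbound (K t) (f t) ht).1 r (by rwa [← hAK])).trans (le_of_eq ?_)
    congr 1
    rw [Finset.sum_filter, Finset.sum_filter]
    refine Finset.sum_congr rfl fun r' _ => ?_
    rw [hind, ht']
    by_cases h2 : r' ∈ greedy m (K t) <;> simp [h2])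
  have hint : ∀ r, Integrable (fun x => ‖(A r).indicator (g r) x‖ ^ 2) periodMeasure :=
    fun r => integrable_norm_sq ((hg r).indicator (hA r))
  have h2 : ∫ t, ∑ i, ‖f t i‖ ^ 2 ∂periodMeasure ≤
      C * ∑ r, ∫ x, ‖(A r).indicator (g r) x‖ ^ 2 ∂periodMeasure := by
    rw [← integral_finsetSum _ fun r _ => hint r, ← integral_const_mul]
    refine integral_mono_of_nonneg (ae_of_all _ fun t => by positivity)
      ((integrable_finsetSum _ fun r _ => hint r).const_mul C) ?_
    filter_upwards [hf, hfg] with t ht ht'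
    refine ((hbound (K t) (f t) ht).2).trans (le_of_eq ?_)
    congr 1
    simp_rw [hind, ht']
    rw [← Finset.sum_filter, Finset.filter_univ_mem]
  have h3 : 0 ≤ ∑ r, ∫ x, ‖(A r).indicator (g r) x‖ ^ 2 ∂periodMeasure := by positivity
  rw [div_mul_eq_mul_div, div_le_iff₀ (by positivity)]
  calc c * ∫ t, ∑ i, ‖f t i‖ ^ 2 ∂periodMeasure
      ≤ c * (C * ∑ r, ∫ x, ‖(A r).indicator (g r) x‖ ^ 2 ∂periodMeasure) := by gcongr
    _ = (c * ∑ r, ∫ x, ‖(A r).indicator (g r) x‖ ^ 2 ∂periodMeasure) * C := by ring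
    _ ≤ (c * ∑ r, ∫ x, ‖(A r).indicator (g r) x‖ ^ 2 ∂periodMeasure) * (C + 1) := by
        gcongr; linarith
    _ ≤ _ := by gcongr

end Greedy

/-! ### Folding the circle and interleaving residue classes -/

section Fold

lemma intervalIntegrable_comp_fold {V : Type*} [NormedAddCommGroup V] {F : ℝ → V}
    (hF : Integrable F periodMeasure) {M j : ℕ} (hj : j < M) :
    IntervalIntegrable F volume ((j : ℝ) / M) (((j + 1 : ℕ) : ℝ) / M) := by
  have hM : (0 : ℝ) < M := by exact_mod_cast Nat.zero_lt_of_lt hj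
  have h : IntervalIntegrable F volume 0 1 :=
    (intervalIntegrable_iff_integrableOn_Ioc_of_le zero_le_one).mpr hF
  refine h.mono_set ?_
  rw [Set.uIcc_of_le zero_le_one, Set.uIcc_of_le (by gcongr; simp)]
  refine Set.Icc_subset_Icc (by positivity) ?_
  rw [div_le_one hM]
  exact_mod_cast hj

lemma integrable_comp_fold {V : Type*} [NormedAddCommGroup V] {F : ℝ → V}
    (hF : Integrable F periodMeasure) {M j : ℕ} (hj : j < M) :
    Integrable (fun t => F ((t + j) / M)) periodMeasure := by
  have hM : (0 : ℝ) < M := by exact_mod_cast Nat.zero_lt_of_lt hj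
  have h1 := ((intervalIntegrable_comp_fold hF hj).comp_mul_right (c := (1 / M : ℝ))).comp_add_right
    (j : ℝ)
  have e1 : (j : ℝ) / M / (1 / M) - j = 0 := by field_simp; ring
  have e2 : ((j + 1 : ℕ) : ℝ) / M / (1 / M) - j = 1 := by push_cast; field_simp; ring
  rw [e1, e2, intervalIntegrable_iff_integrableOn_Ioc_of_le zero_le_one] at h1
  simp only [mul_one_div] at h1
  exact h1

/-- Folding a period onto itself `M` times multiplies integrals by `M`. -/
lemma integral_fold {V : Type*} [NormedAddCommGroup V] [NormedSpace ℝ V] {F : ℝ → V}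
    (hF : Integrable F periodMeasure) {M : ℕ} (hM : 0 < M) :
    ∫ t, ∑ j ∈ Finset.range M, F ((t + j) / M) ∂periodMeasure =
      (M : ℝ) • ∫ x, F x ∂periodMeasure := by
  have hM' : (M : ℝ) ≠ 0 := by exact_mod_cast hM.ne'
  rw [integral_finsetSum _ fun j hj => integrable_comp_fold hF (Finset.mem_range.mp hj)]
  have h1 : ∀ j ∈ Finset.range M, ∫ t, F ((t + j) / M) ∂periodMeasure =
      (M : ℝ) • ∫ x in ((j : ℝ) / M)..(((j + 1 : ℕ) : ℝ) / M), F x := by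
    intro j _
    rw [← intervalIntegral.integral_of_le zero_le_one]
    simp_rw [add_div]
    rw [intervalIntegral.integral_comp_div_add F hM']
    congr 2
    · simp
    · push_cast; ring
  rw [Finset.sum_congr rfl h1, ← Finset.smul_sum,
    intervalIntegral.sum_integral_adjacent_intervals (a := fun j : ℕ => (j : ℝ) / M)
      fun j hj => intervalIntegrable_comp_fold hF hj]
  simp only [Nat.cast_zero, zero_div, div_self hM']
  rw [intervalIntegral.integral_of_le zero_le_one]

lemma memLp_comp_fold {g : ℝ → ℂ} (hm : Measurable g) (hg : MemLp g 2 periodMeasure) {M j : ℕ}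
    (hj : j < M) : MemLp (fun t => g ((t + j) / M)) 2 periodMeasure := by
  have hm' : Measurable fun t : ℝ => g ((t + j) / M) := by fun_prop
  rw [memLp_two_iff_integrable_sq_norm hm'.aestronglyMeasurable]
  exact integrable_comp_fold (integrable_norm_sq hg) hj

/-- The components of a function on the circle whose Fourier coefficients are, up to a constant,
those of the function in the residue classes modulo `M`. -/
noncomputable def foldFun (g : ℝ → ℂ) (M s : ℕ) (t : ℝ) : ℂ :=
  ∑ j ∈ Finset.range M, ech (-(s * ((t + j) / M))) * g ((t + j) / M)

lemma measurable_foldFun {g : ℝ → ℂ} (hm : Measurable g) (M s : ℕ) :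
    Measurable (foldFun g M s) := by
  unfold foldFun
  fun_prop

lemma memLp_foldFun {g : ℝ → ℂ} (hm : Measurable g) (hg : MemLp g 2 periodMeasure) (M s : ℕ) :
    MemLp (foldFun g M s) 2 periodMeasure :=
  memLp_finsetSum _ fun _ hj =>
    (memLp_comp_fold hm hg (Finset.mem_range.mp hj)).ech_mul (by fun_prop)

/-- With `x = (t + j) / M` one has `(M k + s) x = k t + s x + k j`, and the integer `k j` does not
affect the character. -/
lemma coef_foldFun {g : ℝ → ℂ} (hg : MemLp g 2 periodMeasure) {M : ℕ} (hM : 0 < M) (s : ℕ)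
    (k : ℤ) : coef (foldFun g M s) k = M * coef g (M * k + s) := by
  have hM' : (M : ℝ) ≠ 0 := by exact_mod_cast hM.ne'
  have h1 : ∀ t, ech (-(k * t)) * foldFun g M s t = ∑ j ∈ Finset.range M,
      (fun x => ech (-(((M * k + s : ℤ) : ℝ) * x)) * g x) ((t + j) / M) := by
    intro t
    rw [foldFun, Finset.mul_sum]
    refine Finset.sum_congr rfl fun j _ => ?_
    rw [← mul_assoc, ← ech_add]
    congr 1
    rw [← ech_add_int _ (-(k * j))]
    congr 1
    push_cast
    field_simp
    ring
  have h2 := integral_fold (F := fun x => ech (-(((M * k + s : ℤ) : ℝ) * x)) * g x)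
    ((hg.ech_mul (f := fun x => -(((M * k + s : ℤ) : ℝ) * x)) (by fun_prop)).integrable
      (by norm_num)) hM
  rw [coef, integral_congr_ae (ae_of_all _ h1), h2, coef, Complex.real_smul,
    Complex.ofReal_natCast]

open Classical in
/-- The number of branches of the `M`-fold covering over `t` that lie in `E`. -/
noncomputable def foldCount (E : Set ℝ) (M : ℕ) (t : ℝ) : ℕ :=
  ∑ j ∈ Finset.range M, if (t + j) / M ∈ E then 1 else 0

/-- The points over which more than `s` branches of the `M`-fold covering lie in `E`. -/
def foldLevel (E : Set ℝ) (M s : ℕ) : Set ℝ := {t | s < foldCount E M t}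

lemma foldCount_le (E : Set ℝ) (M : ℕ) (t : ℝ) : foldCount E M t ≤ M := by
  classical
  refine (Finset.sum_le_card_nsmul _ _ 1 fun j _ => ?_).trans (by simp)
  split_ifs <;> simp

lemma sum_foldLevel (E : Set ℝ) (M : ℕ) (t : ℝ) :
    ∑ s : Fin M, (foldLevel E M s).indicator (1 : ℝ → ℝ) t = foldCount E M t := by
  classical
  have h1 : ∀ s : Fin M, (foldLevel E M s).indicator (1 : ℝ → ℝ) t =
      if (s : ℕ) < foldCount E M t then 1 else 0 := by
    intro s
    simp [Set.indicator_apply, foldLevel]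
  simp_rw [h1]
  rw [Finset.sum_boole, Fin.card_filter_val_lt, min_eq_right (foldCount_le E M t)]

lemma foldCount_eq_sum_indicator (E : Set ℝ) (M : ℕ) (t : ℝ) :
    (foldCount E M t : ℝ) = ∑ j ∈ Finset.range M, E.indicator (1 : ℝ → ℝ) ((t + j) / M) := by
  classical
  rw [foldCount]
  push_cast
  refine Finset.sum_congr rfl fun j _ => ?_
  simp [Set.indicator_apply]

lemma measurable_foldCount {E : Set ℝ} (hE : MeasurableSet E) (M : ℕ) :
    Measurable (foldCount E M) := by
  classical
  unfold foldCount
  refine Finset.measurable_sum _ fun j _ => ?_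
  refine Measurable.ite ?_ measurable_const measurable_const
  exact (show Measurable fun t : ℝ => (t + j) / M by fun_prop) hE

lemma integral_indicator_period {E : Set ℝ} (hE : MeasurableSet E) :
    ∫ x, E.indicator (1 : ℝ → ℝ) x ∂periodMeasure = volume.real (E ∩ Set.Ioc 0 1) := by
  rw [integral_indicator_one hE, Measure.real, Measure.restrict_apply hE, Measure.real]

lemma integrable_indicator_period {E : Set ℝ} (hE : MeasurableSet E) :
    Integrable (E.indicator (1 : ℝ → ℝ)) periodMeasure :=
  (integrable_const 1).indicator hE

lemma integral_foldCount {E : Set ℝ} (hE : MeasurableSet E) {M : ℕ} (hM : 0 < M) :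
    ∫ t, (foldCount E M t : ℝ) ∂periodMeasure = M * volume.real (E ∩ Set.Ioc 0 1) := by
  simp_rw [foldCount_eq_sum_indicator]
  rw [integral_fold (integrable_indicator_period hE) hM, integral_indicator_period hE, smul_eq_mul]

lemma measurableSet_foldLevel {E : Set ℝ} (hE : MeasurableSet E) (M s : ℕ) :
    MeasurableSet (foldLevel E M s) :=
  measurable_foldCount hE M measurableSet_Ioi

/-- Layer-cake: the indicators of the level sets add up to the branch count. Hence interleaving sets
of the right densities gives the right density. -/
lemma sum_volume_foldLevel {E : Set ℝ} (hE : MeasurableSet E) {M : ℕ} (hM : 0 < M) :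
    ∑ s : Fin M, volume.real (foldLevel E M s ∩ Set.Ioc 0 1) =
      M * volume.real (E ∩ Set.Ioc 0 1) := by
  have hm := fun s : Fin M => measurableSet_foldLevel hE M s
  simp_rw [← integral_indicator_period (hm _)]
  rw [← integral_finsetSum _ fun s _ => integrable_indicator_period (hm s)]
  simp_rw [sum_foldLevel]
  exact integral_foldCount hE hM

variable {P : Finset ℝ} {E : Set ℝ}

/-- A unit shift permutes the branches cyclically. -/
lemma IsArcSet.foldCount_add_one (h : IsArcSet P E) {M : ℕ} (hM : 0 < M) (t : ℝ) :
    foldCount E M (t + 1) = foldCount E M t := by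
  classical
  have hM' : (M : ℝ) ≠ 0 := by exact_mod_cast hM.ne'
  let f : ℕ → ℕ := fun j => if (t + j) / M ∈ E then 1 else 0
  have h1 : foldCount E M (t + 1) = ∑ j ∈ Finset.range M, f (j + 1) := by
    refine Finset.sum_congr rfl fun j _ => ?_
    have : t + 1 + j = t + ((j + 1 : ℕ) : ℝ) := by push_cast; ring
    simp only [f, this]
  have h2 : f M = f 0 := by
    have e : (t + M) / M = t / M + 1 := by field_simp
    simp only [f, e, h.add_one_mem, Nat.cast_zero, add_zero]
  have h3 := Finset.sum_range_succ f M
  rw [Finset.sum_range_succ', h2] at h3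
  rw [h1]
  exact Nat.add_right_cancel h3

lemma IsArcSet.foldCount_add_int (h : IsArcSet P E) {M : ℕ} (hM : 0 < M) (t : ℝ) (k : ℤ) :
    foldCount E M (t + k) = foldCount E M t := by
  have hper : Function.Periodic (foldCount E M) 1 := h.foldCount_add_one hM
  simpa using hper.int_mul k t

lemma IsArcSet.foldCount_right (h : IsArcSet P E) {M : ℕ} (hM : 0 < M) (t : ℝ) :
    ∃ ε > 0, ∀ u, t ≤ u → u < t + ε → foldCount E M t ≤ foldCount E M u := by
  classical
  have hM' : (0 : ℝ) < M := by exact_mod_cast hM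
  have h1 : ∀ j : ℕ, ∃ ε > 0, ∀ u, t ≤ u → u < t + ε → (t + j) / M ∈ E → (u + j) / M ∈ E := by
    intro j
    by_cases hj : (t + j) / M ∈ E
    · obtain ⟨ε, hε, hε'⟩ := h.right _ hj
      refine ⟨ε * M, by positivity, fun u h1 h2 _ => hε' _ (by gcongr) ?_⟩
      rw [div_lt_iff₀ hM', add_mul, div_mul_cancel₀ _ hM'.ne']
      linarith
    · exact ⟨1, one_pos, fun u _ _ h' => absurd h' hj⟩
  choose ε hε hε' using h1
  have hne : (Finset.range M).Nonempty := ⟨0, Finset.mem_range.mpr hM⟩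
  refine ⟨(Finset.range M).inf' hne ε, (Finset.lt_inf'_iff hne).mpr fun j _ => hε j,
    fun u h1 h2 => Finset.sum_le_sum fun j hj => ?_⟩
  have h3 := hε' j u h1 (h2.trans_le (by gcongr; exact Finset.inf'_le ε hj))
  split_ifs with h4 h5 <;> simp_all

lemma IsArcSet.foldCount_anti (h : IsArcSet P E) {M : ℕ} (hM : 0 < M) {s t : ℝ} (hst : s < t)
    (hts : t < s + 1) (hP : ∀ p ∈ P, ∀ k : ℤ, M * p + k ∉ Set.Ioc s t) :
    foldCount E M t ≤ foldCount E M s := by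
  classical
  have hM' : (0 : ℝ) < M := by exact_mod_cast hM
  have hM1 : (1 : ℝ) ≤ M := by exact_mod_cast hM
  refine Finset.sum_le_sum fun j _ => ?_
  have h1 : (t + j) / M ∈ E → (s + j) / M ∈ E := by
    refine h.anti _ _ (by gcongr) ?_ fun p hp k hk => hP p hp (M * k - j) ?_
    · rw [div_lt_iff₀ hM', add_mul, div_mul_cancel₀ _ hM'.ne']
      linarith
    · have h2 := hk.1
      have h3 := hk.2
      rw [div_lt_iff₀ hM'] at h2
      rw [le_div_iff₀ hM'] at h3
      push_cast
      constructor <;> linarith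
  split_ifs with h4 h5 <;> simp_all

/-- The branch count can rise only at images of left end points. Tracking left end points alone
therefore keeps their number from growing under folding, whatever the right end points do. -/
lemma isArcSet_foldLevel (h : IsArcSet P E) {M : ℕ} (hM : 0 < M) (s : ℕ) :
    IsArcSet (P.image fun p => (M : ℝ) * p) (foldLevel E M s) where
  meas := measurableSet_foldLevel h.meas M s
  add_one_mem t := by
    rw [foldLevel, Set.mem_ofPred_eq, h.foldCount_add_one hM, Set.mem_ofPred_eq]
  right t ht := by
    obtain ⟨ε, hε, hε'⟩ := h.foldCount_right hM t
    exact ⟨ε, hε, fun u h1 h2 => lt_of_lt_of_le ht (hε' u h1 h2)⟩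
  anti u t hut htu hP ht := by
    refine lt_of_lt_of_le ht (h.foldCount_anti hM hut htu fun p hp k => ?_)
    exact hP _ (Finset.mem_image_of_mem _ hp) k

/-- The interleaving of the sets `Λ s` along the residue classes modulo `M`. -/
def interleave (M : ℕ) (Λ : Fin M → Set ℤ) : Set ℤ :=
  ⋃ s : Fin M, (fun k : ℤ => (M : ℤ) * k + (s : ℕ)) '' Λ s

lemma interleave_inj {M : ℕ} {s s' : Fin M} {k k' : ℤ}
    (h : (M : ℤ) * k + (s : ℕ) = (M : ℤ) * k' + (s' : ℕ)) : s = s' ∧ k = k' := by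
  have hM : (0 : ℤ) < M := by exact_mod_cast Nat.zero_lt_of_lt s.2
  have h1 : (s : ℤ) < M := by exact_mod_cast s.2
  have h2 : (s' : ℤ) < M := by exact_mod_cast s'.2
  have h3 : ((M : ℤ) * k + (s : ℕ)) % M = (s : ℕ) := by
    rw [Int.mul_add_emod_self_left, Int.emod_eq_of_lt (by lia) h1]
  have h4 : ((M : ℤ) * k' + (s' : ℕ)) % M = (s' : ℕ) := by
    rw [Int.mul_add_emod_self_left, Int.emod_eq_of_lt (by lia) h2]
  have h5 : ((s : ℕ) : ℤ) = (s' : ℕ) := by rw [← h3, ← h4, h]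
  refine ⟨Fin.ext (by exact_mod_cast h5), ?_⟩
  rw [h5] at h
  exact mul_left_cancel₀ hM.ne' (add_right_cancel h)

lemma sum_tsum_le_tsum_interleave {M : ℕ} {Λ : Fin M → Set ℤ} {f : ℤ → ℝ} (hf : Summable f)
    (h0 : ∀ n, 0 ≤ f n) :
    ∑ s : Fin M, ∑' k : Λ s, f ((M : ℤ) * k + (s : ℕ)) ≤ ∑' n : interleave M Λ, f n := by
  let e : (Σ s : Fin M, Λ s) → interleave M Λ := fun x =>
    ⟨(M : ℤ) * x.2 + (x.1 : ℕ), Set.mem_iUnion.mpr ⟨x.1, x.2, x.2.2, rfl⟩⟩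
  have he : Function.Injective e := by
    rintro ⟨s, k, hk⟩ ⟨s', k', hk'⟩ h
    obtain ⟨rfl, rfl⟩ := interleave_inj (Subtype.mk.inj h)
    rfl
  have h1 : Summable fun n : interleave M Λ => f n := hf.subtype _
  have h2 : Summable fun x : (Σ s : Fin M, Λ s) => f (e x) := h1.comp_injective he
  rw [← tsum_fintype (L := .unconditional _), ← Summable.tsum_sigma (f := fun x => f (e x)) h2]
  exact h2.tsum_le_tsum_of_inj e he (fun n _ => h0 n) (fun x => le_rfl) h1

/-- Up to unimodular factors, the functions `foldFun g M s` are the Vandermonde matrix in the roots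
of unity `ω` applied to the branch values of `g`, which are supported on the branches in `E`. Row
`s` is greedy over `t` exactly when more than `s` branches lie in `E`. -/
lemma samples_interleave (h : IsArcSet P E) {M : ℕ} (hM : 0 < M) {Λ : Fin M → Set ℤ}
    (hΛ : ∀ s, Samples (Λ s) (foldLevel E M s)) : Samples (interleave M Λ) E := by
  classical
  have hM' : (0 : ℝ) < M := by exact_mod_cast hM
  let ω : Fin M → ℂ := fun j => ech (-(j / M))
  have hω : Function.Injective ω := by
    intro i j hij
    have h1 : ech ((i : ℝ) / M - j / M) = 1 := by
      have : (i : ℝ) / M - j / M = -(j / M) - -(i / M) := by ring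
      rw [this, sub_eq_add_neg, ech_add, neg_neg]
      change ω j * _ = 1
      rw [← hij]
      change ech _ * _ = 1
      rw [← ech_add, neg_add_cancel, ech_zero]
    obtain ⟨n, hn⟩ := (ech_eq_one_iff _).mp h1
    rw [← sub_div, div_eq_iff hM'.ne'] at hn
    have h2 : ((i : ℕ) : ℤ) - (j : ℕ) = n * M := by exact_mod_cast hn
    have hi : ((i : ℕ) : ℤ) < M := by exact_mod_cast i.2
    have hj : ((j : ℕ) : ℤ) < M := by exact_mod_cast j.2
    have := @interleave_inj M i j 0 n (by lia)
    exact this.1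
  set m : Matrix (Fin M) (Fin M) ℂ := Matrix.of fun (s j : Fin M) => ω j ^ (s : ℕ) with hm
  have hinj : ∀ f : Fin M → ℂ, m.mulVec f = 0 → f = 0 := by
    intro f hf
    refine Matrix.eq_zero_of_forall_pow_sum_mul_pow_eq_zero hω fun i => ?_
    have := congr_fun hf i
    rw [Matrix.mulVec, dotProduct] at this
    simpa [hm, mul_comm] using this
  let K : ℝ → Finset (Fin M) := fun t => {j | (t + (j : ℕ)) / M ∈ E}
  have hK : ∀ t, (K t).card = foldCount E M t := by
    intro t
    rw [foldCount, Finset.sum_range, Finset.card_filter]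
  have hlevel : ∀ (s : Fin M) t, t ∈ foldLevel E M s ↔ s ∈ greedy m (K t) := by
    intro s t
    rw [mem_greedy_vandermonde hω, hK]
    rfl
  obtain ⟨c, hc, hsamp⟩ := exists_greedy_sampling hinj
    (fun s : Fin M => measurableSet_foldLevel h.meas M s) hlevel hΛ
  -- Folding multiplies the energy by `M` and the squared coefficients by `M ^ 2`, hence `c / M`.
  refine Samples.of_indicator h.meas (c := c / M) (by positivity) fun g hgm hg h0 => ?_
  let f : ℝ → Fin M → ℂ := fun t j => g ((t + (j : ℕ)) / M)
  have hf0 : ∀ t, ∀ j ∉ K t, f t j = 0 := by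
    intro t j hj
    exact h0 _ (by simpa [K] using hj)
  have hfold : ∀ (s : Fin M) t, ‖foldFun g M s t‖ = ‖m s ⬝ᵥ f t‖ := by
    intro s t
    have : foldFun g M s t = ech (-(s * (t / M))) * (m s ⬝ᵥ f t) := by
      rw [foldFun, Finset.sum_range, dotProduct, Finset.mul_sum]
      refine Finset.sum_congr rfl fun j _ => ?_
      rw [← mul_assoc]
      congr 1
      simp only [hm, Matrix.of_apply, ω]
      rw [ech_pow, ← ech_add]
      congr 1
      ring
    rw [this, norm_mul, norm_ech, one_mul]
  have h1 := hsamp f (fun s => foldFun g M s) (fun s => measurable_foldFun hgm M s)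
    (fun s => memLp_foldFun hgm hg M s) (ae_of_all _ hf0) (ae_of_all _ fun t r => hfold r t)
  have h2 : ∫ t, ∑ j, ‖f t j‖ ^ 2 ∂periodMeasure = M * ∫ x, ‖g x‖ ^ 2 ∂periodMeasure := by
    rw [← smul_eq_mul, ← integral_fold (integrable_norm_sq hg) hM]
    simp only [Finset.sum_range, f]
  have h3 : ∑ s : Fin M, ∑' n : Λ s, ‖coef (foldFun g M s) n‖ ^ 2 ≤
      (M : ℝ) ^ 2 * ∑' n : interleave M Λ, ‖coef g n‖ ^ 2 := by
    have h4 := sum_tsum_le_tsum_interleave (Λ := Λ) (hasSum_sq_coef hg).summable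
      (fun n => by positivity)
    refine le_trans (le_of_eq ?_) (mul_le_mul_of_nonneg_left h4 (by positivity))
    rw [Finset.mul_sum]
    refine Finset.sum_congr rfl fun s _ => ?_
    rw [← tsum_mul_left]
    congr 1
    ext k
    rw [coef_foldFun hg hM, norm_mul, mul_pow, Complex.norm_natCast]
  rw [h2] at h1
  have h4 := h1.trans h3
  rw [div_mul_eq_mul_div, div_le_iff₀ hM']
  have h5 : (M : ℝ) * (c * ∫ x, ‖g x‖ ^ 2 ∂periodMeasure) ≤
      M * ((∑' n : interleave M Λ, ‖coef g n‖ ^ 2) * M) := by linarith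
  exact le_of_mul_le_mul_left h5 hM'

/-- In each residue class the window shrinks to length `(q - p) / M` up to an error of at most one,
which costs `|d s|` in the discrepancy. -/
lemma hasDensity_interleave {M : ℕ} (hM : 0 < M) {Λ : Fin M → Set ℤ} {d : Fin M → ℝ}
    (h : ∀ s, HasDensity (Λ s) (d s)) : HasDensity (interleave M Λ) ((∑ s, d s) / M) := by
  have hM' : (0 : ℤ) < M := by exact_mod_cast hM
  have hMr : (0 : ℝ) < M := by exact_mod_cast hM
  choose C hC using h
  refine ⟨∑ s, (C s + |d s|), fun p q hpq => ?_⟩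
  have hcut : ∀ (s : Fin M) (x : ℤ), ∀ k : ℤ,
      (⌈((x : ℝ) - (s : ℕ)) / M⌉ ≤ k ↔ x ≤ (M : ℤ) * k + (s : ℕ)) := by
    intro s x k
    rw [Int.ceil_le, div_le_iff₀ hMr, sub_le_iff_le_add, mul_comm]
    exact_mod_cast Iff.rfl
  have hset : interleave M Λ ∩ Set.Ico p q = ⋃ s : Fin M,
      (fun k : ℤ => (M : ℤ) * k + (s : ℕ)) ''
        (Λ s ∩ Set.Ico ⌈((p : ℝ) - (s : ℕ)) / M⌉ ⌈((q : ℝ) - (s : ℕ)) / M⌉) := by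
    rw [interleave, Set.iUnion_inter]
    congr 1
    ext s n
    constructor
    · rintro ⟨⟨k, hk, rfl⟩, h1, h2⟩
      exact ⟨k, ⟨hk, (hcut s p k).mpr h1, not_le.mp fun h3 => not_le.mpr h2 ((hcut s q k).mp h3)⟩,
        rfl⟩
    · rintro ⟨k, ⟨hk, h1, h2⟩, rfl⟩
      exact ⟨⟨k, hk, rfl⟩, (hcut s p k).mp h1,
        not_le.mp fun h3 => not_le.mpr h2 ((hcut s q k).mpr h3)⟩
  have hfin : ∀ s : Fin M, ((fun k : ℤ => (M : ℤ) * k + (s : ℕ)) ''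
      (Λ s ∩ Set.Ico ⌈((p : ℝ) - (s : ℕ)) / M⌉ ⌈((q : ℝ) - (s : ℕ)) / M⌉)).Finite :=
    fun s => ((Set.finite_Ico _ _).inter_of_right _).image _
  rw [hset, Set.ncard_iUnion_of_finite hfin, finsum_eq_sum_of_fintype]
  swap
  · intro s s' hss
    rw [Function.onFun, Set.disjoint_left]
    rintro _ ⟨k, -, rfl⟩ ⟨k', -, hk'⟩
    exact hss (interleave_inj hk').1.symm
  push_cast
  rw [Finset.sum_div, Finset.sum_mul, ← Finset.sum_sub_distrib]
  refine (Finset.abs_sum_le_sum_abs _ _).trans (Finset.sum_le_sum fun s _ => ?_)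
  rw [Set.ncard_image_of_injective _ fun k k' hk => (interleave_inj hk).2]
  have hle : ⌈((p : ℝ) - (s : ℕ)) / M⌉ ≤ ⌈((q : ℝ) - (s : ℕ)) / M⌉ := by
    apply Int.ceil_mono
    gcongr
  have h1 := hC s _ _ hle
  have h2 : |d s * ((⌈((q : ℝ) - (s : ℕ)) / M⌉ : ℝ) - ⌈((p : ℝ) - (s : ℕ)) / M⌉) -
      d s / M * (q - p)| ≤ |d s| := by
    have e : d s * ((⌈((q : ℝ) - (s : ℕ)) / M⌉ : ℝ) - ⌈((p : ℝ) - (s : ℕ)) / M⌉) -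
        d s / M * (q - p) = d s * (((⌈((q : ℝ) - (s : ℕ)) / M⌉ : ℝ) - (q - (s : ℕ)) / M) -
          (⌈((p : ℝ) - (s : ℕ)) / M⌉ - (p - (s : ℕ)) / M)) := by
      field_simp
      ring
    rw [e, abs_mul]
    refine mul_le_of_le_one_right (abs_nonneg _) ?_
    have h3 := Int.le_ceil (((p : ℝ) - (s : ℕ)) / M)
    have h4 := Int.ceil_lt_add_one (((p : ℝ) - (s : ℕ)) / M)
    have h5 := Int.le_ceil (((q : ℝ) - (s : ℕ)) / M)
    have h6 := Int.ceil_lt_add_one (((q : ℝ) - (s : ℕ)) / M)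
    rw [abs_le]
    constructor <;> linarith
  rw [abs_le] at h1 h2 ⊢
  constructor <;> linarith [h1.1, h1.2, h2.1, h2.2]

end Fold

/-! ### Irredundant end points and two-valued foldings -/

section Irreducible

/-- No left end point can be dropped. -/
def IsIrredundant (Q : Finset ℝ) (E : Set ℝ) : Prop := ∀ q ∈ Q, ¬IsArcSet (Q.erase q) E

lemma exists_last_point {Q : Finset ℝ} (hQ : Q.Nonempty) (t : ℝ) :
    ∃ q ∈ Q, ∃ k : ℤ, q + k ≤ t ∧ t < q + k + 1 ∧
      ∀ q' ∈ Q, ∀ k' : ℤ, q' + k' ∉ Set.Ioc (q + k) t := by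
  obtain ⟨q, hq, hmax⟩ := Finset.exists_max_image Q (fun q => q + ⌊t - q⌋) hQ
  refine ⟨q, hq, ⌊t - q⌋, by linarith [Int.floor_le (t - q)],
    by linarith [Int.lt_floor_add_one (t - q)], fun q' hq' k' hk' => ?_⟩
  have h1 := hmax q' hq'
  have h2 : k' ≤ ⌊t - q'⌋ := Int.le_floor.mpr (by linarith [hk'.2])
  have h3 : (k' : ℝ) ≤ ⌊t - q'⌋ := by exact_mod_cast h2
  linarith [hk'.1]

lemma exists_next_point {Q : Finset ℝ} (hQ : Q.Nonempty) (t : ℝ) :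
    ∃ q ∈ Q, ∃ k : ℤ, t < q + k ∧ q + k ≤ t + 1 ∧
      ∀ q' ∈ Q, ∀ k' : ℤ, t < q' + k' → q + k ≤ q' + k' := by
  obtain ⟨q, hq, hmin⟩ := Finset.exists_min_image Q (fun q => q + ((⌊t - q⌋ + 1 : ℤ) : ℝ)) hQ
  refine ⟨q, hq, ⌊t - q⌋ + 1, ?_, ?_, fun q' hq' k' hk' => ?_⟩
  · push_cast; linarith [Int.lt_floor_add_one (t - q)]
  · push_cast; linarith [Int.floor_le (t - q)]
  · have h1 := hmin q' hq'
    have h2 : ⌊t - q'⌋ < k' := Int.floor_lt.mpr (by linarith)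
    have h3 : ((⌊t - q'⌋ + 1 : ℤ) : ℝ) ≤ k' := by exact_mod_cast h2
    linarith

variable {Q : Finset ℝ} {E : Set ℝ}

lemma IsArcSet.erase_of_congr (h : IsArcSet Q E) {q q' : ℝ} (hq : q ∈ Q) (hne : q ≠ q') {k : ℤ}
    (hk : q' - q = k) : IsArcSet (Q.erase q') E where
  meas := h.meas
  add_one_mem := h.add_one_mem
  right := h.right
  anti s t hst hts hP := by
    refine h.anti s t hst hts fun p hp j => ?_
    by_cases hpq : p = q'
    · have h1 := hP q (Finset.mem_erase.mpr ⟨hne, hq⟩) (k + j)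
      have h2 : q + ((k + j : ℤ) : ℝ) = p + j := by push_cast; rw [hpq]; linarith
      rwa [h2] at h1
    · exact hP p (Finset.mem_erase.mpr ⟨hpq, hp⟩) j

lemma IsIrredundant.sub_ne_int (hi : IsIrredundant Q E) (h : IsArcSet Q E) {q q' : ℝ} (hq : q ∈ Q)
    (hq' : q' ∈ Q) (hne : q ≠ q') (k : ℤ) : q' - q ≠ k := fun hk =>
  hi q' hq' (h.erase_of_congr hq hne hk)

/-- At an irredundant left end point the set begins. -/
lemma IsIrredundant.mem_and_gap (hi : IsIrredundant Q E) (h : IsArcSet Q E) {q : ℝ} (hq : q ∈ Q) :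
    q ∈ E ∧ ∃ s < q, ∀ y, s ≤ y → y < q → y ∉ E := by
  -- Only the condition `anti` can fail when `q` is dropped; its failure yields a window in which
  -- membership begins.
  have h1 : ∃ s t, s < t ∧ t < s + 1 ∧ (∀ p ∈ Q.erase q, ∀ k : ℤ, p + k ∉ Set.Ioc s t) ∧
      t ∈ E ∧ s ∉ E := by
    by_contra hcon
    push Not at hcon
    exact hi q hq ⟨h.meas, h.add_one_mem, h.right, hcon⟩
  obtain ⟨s, t, hst, hts, hav, ht, hs⟩ := h1
  have h2 : ∃ k : ℤ, q + k ∈ Set.Ioc s t := by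
    by_contra hcon
    push Not at hcon
    refine hs (h.anti s t hst hts (fun p hp k => ?_) ht)
    by_cases hpq : p = q
    · rw [hpq]; exact hcon k
    · exact hav p (Finset.mem_erase.mpr ⟨hpq, hp⟩) k
  obtain ⟨k, hk⟩ := h2
  -- The window is shorter than one period, so it contains a single translate of `q`.
  have honly : ∀ p ∈ Q, ∀ j : ℤ, p + j ∈ Set.Ioc s t → p + j = q + k := by
    intro p hp j hj
    by_cases hpq : p = q
    · subst hpq
      have h3 : (j : ℝ) < k + 1 := by linarith [hj.2, hk.1]
      have h4 : (k : ℝ) < j + 1 := by linarith [hk.2, hj.1]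
      have h5 : j = k := by
        have h3' : j < k + 1 := by exact_mod_cast h3
        have h4' : k < j + 1 := by exact_mod_cast h4
        lia
      rw [h5]
    · exact absurd hj (hav p (Finset.mem_erase.mpr ⟨hpq, hp⟩) j)
  constructor
  · rw [← h.add_int_mem q k]
    rcases eq_or_lt_of_le hk.2 with h3 | h3
    · rwa [h3]
    · refine h.anti _ t h3 (by linarith [hk.1]) (fun p hp j hj => ?_) ht
      have := honly p hp j ⟨hk.1.trans hj.1, hj.2⟩
      linarith [hj.1]
  · refine ⟨s - k, by linarith [hk.1], fun y hy1 hy2 hy => hs ?_⟩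
    rw [← h.add_int_mem y k] at hy
    rcases eq_or_lt_of_le (show s ≤ y + k by linarith) with h3 | h3
    · rwa [h3]
    · refine h.anti s _ h3 (by linarith [hk.2]) (fun p hp j hj => ?_) hy
      have := honly p hp j ⟨hj.1, by linarith [hj.2, hk.2]⟩
      linarith [hj.2]

/-- The gap just before `q` recurs one period later and stops the arc before `q + 1`. -/
lemma IsIrredundant.exists_end (hi : IsIrredundant Q E) (h : IsArcSet Q E) {q : ℝ} (hq : q ∈ Q) :
    ∃ b, q < b ∧ b < q + 1 ∧ (∀ x, q ≤ x → x < b → x ∈ E) ∧ b ∉ E := by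
  obtain ⟨hqE, s, hs, hgap⟩ := hi.mem_and_gap h hq
  have h1 : max s (q - 1 / 2) + 1 ∉ E := by
    rw [h.add_one_mem]
    exact hgap _ (le_max_left _ _) (max_lt hs (by linarith))
  have h2 : q ≤ max s (q - 1 / 2) + 1 := by linarith [le_max_right s (q - 1 / 2)]
  obtain ⟨b, hb1, hb2, hb3, hb4⟩ := exists_arc_end h.right hqE h2 h1
  refine ⟨b, hb1, ?_, hb3, hb4⟩
  have : max s (q - 1 / 2) < q := max_lt hs (by linarith)
  linarith

/-- This is the indicator of the periodic arc from `a` to `b`, written so that Hermite's identity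
can fold it. -/
lemma floor_sub_floor_eq {t a b : ℝ} (hab : a < b) (hb : b < a + 1) :
    ⌊t - a⌋ - ⌊t - b⌋ = if t < b + ⌊t - a⌋ then 1 else 0 := by
  have h1 := Int.floor_le (t - a)
  have h2 := Int.lt_floor_add_one (t - a)
  split_ifs with h
  · have : ⌊t - b⌋ = ⌊t - a⌋ - 1 := by
      rw [Int.floor_eq_iff]
      push_cast
      constructor <;> linarith
    lia
  · have : ⌊t - b⌋ = ⌊t - a⌋ := by
      rw [Int.floor_eq_iff]
      constructor <;> linarith
    lia

/-- The indicator function of an irredundant union of arcs in terms of the end points. -/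
lemma IsIrredundant.indicator_eq (hi : IsIrredundant Q E) (h : IsArcSet Q E) (hQ : Q.Nonempty)
    {b : ℝ → ℝ} (hb : ∀ q ∈ Q, q < b q ∧ b q < q + 1 ∧ (∀ x, q ≤ x → x < b q → x ∈ E) ∧ b q ∉ E)
    (t : ℝ) : E.indicator (1 : ℝ → ℤ) t = ∑ q ∈ Q, (⌊t - q⌋ - ⌊t - b q⌋) := by
  classical
  have h1 : ∀ q ∈ Q, ⌊t - q⌋ - ⌊t - b q⌋ = if t < b q + ⌊t - q⌋ then 1 else 0 :=
    fun q hq => floor_sub_floor_eq (hb q hq).1 (hb q hq).2.1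
  rw [Finset.sum_congr rfl h1]
  have hin : ∀ q ∈ Q, t < b q + ⌊t - q⌋ → ∀ y, q + ⌊t - q⌋ ≤ y → y ≤ t → y ∈ E := by
    intro q hq ht y hy1 hy2
    have := (hb q hq).2.2.1 (y - ⌊t - q⌋) (by linarith) (by linarith)
    rwa [← h.add_int_mem _ ⌊t - q⌋, sub_add_cancel] at this
  by_cases htE : t ∈ E
  · rw [Set.indicator_of_mem htE, Pi.one_apply]
    obtain ⟨q, hq, k, hk1, hk2, hlast⟩ := exists_last_point hQ t
    have hkf : ⌊t - q⌋ = k := by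
      rw [Int.floor_eq_iff]; constructor <;> linarith
    -- Otherwise `E` would resume between the end of this arc and `t` without a left end point.
    have hqb : t < b q + ⌊t - q⌋ := by
      rw [hkf]
      by_contra hcon
      push Not at hcon
      apply (hb q hq).2.2.2
      rw [← h.add_int_mem _ k]
      rcases eq_or_lt_of_le hcon with h3 | h3
      · rwa [h3]
      · refine h.anti _ t h3 (by linarith [(hb q hq).1]) (fun p hp j hj => ?_) htE
        exact hlast p hp j ⟨by linarith [hj.1, (hb q hq).1], hj.2⟩
    -- Exactly one arc contains `t`: one starting earlier would run through the gap before `q + k`.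
    rw [Finset.sum_eq_single q, if_pos hqb]
    · intro q' hq' hne
      refine if_neg fun hcon => ?_
      have h3 : q' + ⌊t - q'⌋ ≤ q + k := by
        by_contra h4
        push Not at h4
        exact hlast q' hq' _ ⟨h4, by linarith [Int.floor_le (t - q')]⟩
      rcases eq_or_lt_of_le h3 with h4 | h4
      · refine hi.sub_ne_int h hq hq' hne.symm (k - ⌊t - q'⌋) ?_
        push_cast
        linarith
      · obtain ⟨-, s, hs, hgap⟩ := hi.mem_and_gap h hq
        set y := max (s + k) (q' + ⌊t - q'⌋) with hy
        have hy1 : y < q + k := max_lt (by linarith) h4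
        have hyE : y ∈ E := hin q' hq' hcon y (le_max_right _ _) (by linarith)
        rw [← sub_add_cancel y (k : ℝ), h.add_int_mem] at hyE
        exact hgap (y - k) (by linarith [le_max_left (s + k) (q' + ⌊t - q'⌋)]) (by linarith) hyE
    · exact fun hcon => absurd hq hcon
  · rw [Set.indicator_of_notMem htE]
    symm
    refine Finset.sum_eq_zero fun q hq => if_neg fun hcon => htE ?_
    exact hin q hq hcon t (by linarith [Int.floor_le (t - q)]) le_rfl

lemma sum_int_add_ediv {M : ℕ} (hM : 0 < M) (n : ℤ) :
    ∑ j ∈ Finset.range M, (n + j) / (M : ℤ) = n := by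
  have hM' : (M : ℤ) ≠ 0 := by exact_mod_cast hM.ne'
  have hstep : ∀ n : ℤ, ∑ j ∈ Finset.range M, (n + 1 + j) / (M : ℤ) =
      ∑ j ∈ Finset.range M, (n + j) / (M : ℤ) + 1 := by
    intro n
    have h1 := Finset.sum_range_succ (fun j : ℕ => (n + j) / (M : ℤ)) M
    rw [Finset.sum_range_succ', Int.add_ediv_of_dvd_right (dvd_refl _), Int.ediv_self hM'] at h1
    have h2 : ∀ j : ℕ, (n + ((j + 1 : ℕ) : ℤ)) / (M : ℤ) = (n + 1 + j) / (M : ℤ) := by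
      intro j; congr 1; push_cast; ring
    simp only [h2, Nat.cast_zero, add_zero] at h1
    linarith
  induction n using Int.induction_on with
  | zero =>
    refine Finset.sum_eq_zero fun j hj => ?_
    rw [zero_add]
    exact Int.ediv_eq_zero_of_lt (by lia) (by exact_mod_cast Finset.mem_range.mp hj)
  | succ n ih => rw [hstep, ih]
  | pred n ih =>
    have := hstep (-n - 1)
    rw [sub_add_cancel, ih] at this
    linarith

/-- Hermite's identity. -/
lemma sum_floor_fold {M : ℕ} (hM : 0 < M) (t a : ℝ) :
    ∑ j ∈ Finset.range M, ⌊(t + j) / M - a⌋ = ⌊t - M * a⌋ := by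
  have hM' : (0 : ℝ) < M := by exact_mod_cast hM
  rw [← sum_int_add_ediv hM ⌊t - M * a⌋]
  refine Finset.sum_congr rfl fun j _ => ?_
  have h1 : (t + j) / M - a = (t - M * a + j) / M := by field_simp; ring
  rw [h1, Int.floor_eq_iff]
  have hfl := Int.floor_le (t - M * a)
  have hfl' := Int.lt_floor_add_one (t - M * a)
  have h2 := Int.mul_ediv_add_emod (⌊t - M * a⌋ + j) M
  have h3 := Int.emod_nonneg (⌊t - M * a⌋ + j) (by exact_mod_cast hM.ne' : (M : ℤ) ≠ 0)
  have h4 : (⌊t - M * a⌋ + j) % (M : ℤ) + 1 ≤ M :=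
    Int.emod_lt_of_pos _ (by exact_mod_cast hM)
  set d := (⌊t - M * a⌋ + j) / (M : ℤ)
  set r := (⌊t - M * a⌋ + j) % (M : ℤ)
  have h2' : (M : ℝ) * d + r = ⌊t - M * a⌋ + j := by exact_mod_cast h2
  have h3' : (0 : ℝ) ≤ r := by exact_mod_cast h3
  have h4' : (r : ℝ) + 1 ≤ M := by exact_mod_cast h4
  constructor
  · rw [le_div_iff₀ hM']; linarith
  · rw [div_lt_iff₀ hM']; linarith

/-- By Hermite's identity for each term, the branch count has the same form with all end points
multiplied by `M`. -/
lemma foldCount_eq_sum_floor {b : ℝ → ℝ}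
    (hE : ∀ t, E.indicator (1 : ℝ → ℤ) t = ∑ q ∈ Q, (⌊t - q⌋ - ⌊t - b q⌋)) {M : ℕ} (hM : 0 < M)
    (t : ℝ) : (foldCount E M t : ℤ) = ∑ q ∈ Q, (⌊t - M * q⌋ - ⌊t - M * b q⌋) := by
  classical
  have h1 : (foldCount E M t : ℤ) =
      ∑ j ∈ Finset.range M, E.indicator (1 : ℝ → ℤ) ((t + j) / M) := by
    rw [foldCount]
    push_cast
    refine Finset.sum_congr rfl fun j _ => ?_
    simp [Set.indicator_apply]
  rw [h1]
  simp_rw [hE]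
  rw [Finset.sum_comm]
  refine Finset.sum_congr rfl fun q _ => ?_
  rw [Finset.sum_sub_distrib, sum_floor_fold hM, sum_floor_fold hM]

open Classical in
/-- The jumps of the floor function. -/
lemma eventually_floor_jump (x a : ℝ) :
    ∀ᶠ y in 𝓝[<] x, ⌊x - a⌋ - ⌊y - a⌋ = if ∃ k : ℤ, x - a = k then 1 else 0 := by
  have h1 := Int.le_ceil (x - a)
  have h2 := Int.ceil_lt_add_one (x - a)
  have hlt : a + (⌈x - a⌉ - 1) < x := by linarith
  filter_upwards [Ioo_mem_nhdsLT hlt] with y hy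
  have h3 : ⌊y - a⌋ = ⌈x - a⌉ - 1 := by
    rw [Int.floor_eq_iff]
    push_cast
    constructor <;> linarith [hy.1, hy.2]
  rw [h3]
  split_ifs with h
  · obtain ⟨k, hk⟩ := h
    rw [hk, Int.floor_intCast, Int.ceil_intCast]
    lia
  · have h4 : ⌊x - a⌋ = ⌈x - a⌉ - 1 := by
      rw [Int.floor_eq_iff]
      push_cast
      refine ⟨by linarith, ?_⟩
      rw [sub_add_cancel]
      exact lt_of_le_of_ne h1 fun h5 => h ⟨_, h5⟩
    lia

open Classical in
lemma eventually_foldCount_jump {b : ℝ → ℝ}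
    (hE : ∀ t, E.indicator (1 : ℝ → ℤ) t = ∑ q ∈ Q, (⌊t - q⌋ - ⌊t - b q⌋)) {M : ℕ} (hM : 0 < M)
    (x : ℝ) : ∀ᶠ y in 𝓝[<] x, (foldCount E M x : ℤ) - foldCount E M y =
      (∑ q ∈ Q, if ∃ k : ℤ, x - M * q = k then 1 else 0) -
        ∑ q ∈ Q, if ∃ k : ℤ, x - M * b q = k then 1 else 0 := by
  have h1 : ∀ᶠ y in 𝓝[<] x, ∀ q ∈ Q, ⌊x - M * q⌋ - ⌊y - M * q⌋ =
      if ∃ k : ℤ, x - M * q = k then 1 else 0 :=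
    (Filter.eventually_all_finset Q).mpr fun q _ => eventually_floor_jump x (M * q)
  have h2 : ∀ᶠ y in 𝓝[<] x, ∀ q ∈ Q, ⌊x - M * b q⌋ - ⌊y - M * b q⌋ =
      if ∃ k : ℤ, x - M * b q = k then 1 else 0 :=
    (Filter.eventually_all_finset Q).mpr fun q _ => eventually_floor_jump x (M * b q)
  filter_upwards [h1, h2] with y hy1 hy2
  rw [foldCount_eq_sum_floor hE hM, foldCount_eq_sum_floor hE hM, ← Finset.sum_congr rfl hy1,
    ← Finset.sum_congr rfl hy2, ← Finset.sum_sub_distrib, ← Finset.sum_sub_distrib]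
  refine Finset.sum_congr rfl fun q _ => ?_
  ring

/-- If one of the level sets of the folding of an irredundant set is irredundant, then the folding
takes just two values, and the folded end points are distinct modulo `1`. -/
lemma foldCount_of_irredundant (h : IsArcSet Q E) (hQ : Q.Nonempty) {b : ℝ → ℝ}
    (hE : ∀ t, E.indicator (1 : ℝ → ℤ) t = ∑ q ∈ Q, (⌊t - q⌋ - ⌊t - b q⌋)) {M : ℕ} (hM : 0 < M)
    {s : ℕ} (hi : IsIrredundant (Q.image fun q => (M : ℝ) * q) (foldLevel E M s)) :
    (∀ t, foldCount E M t = s ∨ foldCount E M t = s + 1) ∧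
    (∀ p ∈ Q, ∀ q ∈ Q, p ≠ q → ∀ k : ℤ, M * p - M * q ≠ k) ∧
    (∀ p ∈ Q, ∀ q ∈ Q, ∀ k : ℤ, M * p - M * b q ≠ k) ∧
    (∀ p ∈ Q, ∀ q ∈ Q, p ≠ q → ∀ k : ℤ, M * b p - M * b q ≠ k) := by
  classical
  have hM' : (M : ℝ) ≠ 0 := by exact_mod_cast hM.ne'
  have hl := isArcSet_foldLevel h hM s
  have haa : ∀ p ∈ Q, ∀ q ∈ Q, p ≠ q → ∀ k : ℤ, M * p - M * q ≠ k := fun p hp q hq hne k =>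
    hi.sub_ne_int hl (Finset.mem_image_of_mem _ hq) (Finset.mem_image_of_mem _ hp)
      (fun h => hne (mul_left_cancel₀ hM' h).symm) k
  have hone : ∀ p ∈ Q, ∀ k : ℤ,
      (∑ q ∈ Q, if ∃ j : ℤ, (M * p + k : ℝ) - M * q = j then (1 : ℤ) else 0) = 1 := by
    intro p hp k
    rw [Finset.sum_eq_single p, if_pos ⟨k, by ring⟩]
    · intro q hq hne
      refine if_neg ?_
      rintro ⟨j, hj⟩
      refine haa p hp q hq hne.symm (j - k) ?_
      push_cast
      linarith
    · exact fun hcon => absurd hp hcon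
  -- The level set begins at every folded left end point, so there the count crosses from at most
  -- `s` to above `s`. By `hone` the jump is at most `1`.
  have hup : ∀ p ∈ Q, ∀ k : ℤ, s < foldCount E M (M * p + k) ∧
      ∀ᶠ y in 𝓝[<] (M * p + k : ℝ), foldCount E M y ≤ s := by
    intro p hp k
    obtain ⟨h1, u, hu, hgap⟩ := hi.mem_and_gap hl (Finset.mem_image_of_mem _ hp)
    rw [h.foldCount_add_int hM]
    refine ⟨h1, ?_⟩
    filter_upwards [Ioo_mem_nhdsLT (show u + k < M * p + k by linarith)] with y hy
    have h2 := hgap (y - k) (by linarith [hy.1]) (by linarith [hy.2])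
    rw [foldLevel, Set.mem_ofPred_eq, not_lt] at h2
    have h3 := h.foldCount_add_int hM (y - k) k
    rw [sub_add_cancel] at h3
    rwa [h3]
  have hnn : ∀ x : ℝ, 0 ≤ ∑ q ∈ Q, if ∃ j : ℤ, x - M * b q = j then (1 : ℤ) else 0 := by
    intro x
    refine Finset.sum_nonneg fun q _ => ?_
    split_ifs <;> simp
  have htwo : ∀ t, foldCount E M t = s ∨ foldCount E M t = s + 1 := by
    intro t
    have hQM : (Q.image fun q => (M : ℝ) * q).Nonempty := hQ.image _
    -- At the last left end point before `t` the count reaches at most `s + 1`, and it cannot rise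
    -- afterwards.
    have hle : foldCount E M t ≤ s + 1 := by
      obtain ⟨q, hq, k, hk1, hk2, hlast⟩ := exists_last_point hQM t
      obtain ⟨p, hp, rfl⟩ := Finset.mem_image.mp hq
      obtain ⟨y, hy1, hy2⟩ := ((hup p hp k).2.and
        (eventually_foldCount_jump hE hM (M * p + k))).exists
      rw [hone p hp k] at hy2
      have h1 : foldCount E M t ≤ foldCount E M (M * p + k) := by
        rcases eq_or_lt_of_le hk1 with h3 | h3
        · rw [h3]
        · exact h.foldCount_anti hM h3 hk2 fun q hq j => hlast _ (Finset.mem_image_of_mem _ hq) j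
      have := hnn (M * p + k)
      lia
    -- The count does not rise before the next left end point, and a jump of at most `1` there
    -- exceeds `s`.
    have hge : s ≤ foldCount E M t := by
      obtain ⟨q, hq, k, hk1, hk2, hnext⟩ := exists_next_point hQM t
      obtain ⟨p, hp, rfl⟩ := Finset.mem_image.mp hq
      obtain ⟨y, hy1, hy2⟩ := ((eventually_foldCount_jump hE hM (M * p + k)).and
        (Ioo_mem_nhdsLT hk1)).exists
      rw [hone p hp k] at hy1
      have h1 : foldCount E M y ≤ foldCount E M t := by
        refine h.foldCount_anti hM hy2.1 (by linarith [hy2.2]) fun q hq j hj => ?_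
        have := hnext _ (Finset.mem_image_of_mem _ hq) j hj.1
        linarith [hj.2, hy2.2]
      have h2 := (hup p hp k).1
      have := hnn (M * p + k)
      lia
    lia
  -- A right end point at the same place would cancel the upward jump.
  have hab : ∀ p ∈ Q, ∀ q ∈ Q, ∀ k : ℤ, M * p - M * b q ≠ k := by
    intro p hp q hq k hk
    have h0 := hone p hp 0
    have h1 := hup p hp 0
    rw [Int.cast_zero, add_zero] at h0 h1
    obtain ⟨y, hy1, hy2⟩ := (h1.2.and (eventually_foldCount_jump hE hM (M * p))).exists
    rw [h0] at hy2
    have h2 : 1 ≤ ∑ q ∈ Q, if ∃ j : ℤ, M * p - M * b q = j then (1 : ℤ) else 0 := by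
      refine le_trans ?_ (Finset.single_le_sum (fun q _ => ?_) hq)
      · rw [if_pos ⟨k, hk⟩]
      · split_ifs <;> simp
    have := h1.1
    lia
  refine ⟨htwo, haa, hab, fun p hp q hq hne k hk => ?_⟩
  obtain ⟨y, hy⟩ := (eventually_foldCount_jump hE hM (M * b p)).exists
  have h1 : (∑ q ∈ Q, if ∃ j : ℤ, M * b p - M * q = j then (1 : ℤ) else 0) = 0 := by
    refine Finset.sum_eq_zero fun q hq => if_neg ?_
    rintro ⟨j, hj⟩
    refine hab q hq p hp (-j) ?_
    push_cast
    linarith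
  -- Two coinciding right end points would lower the count by at least two, but it takes only the
  -- values `s` and `s + 1`.
  have h2 : 2 ≤ ∑ q ∈ Q, if ∃ j : ℤ, M * b p - M * b q = j then (1 : ℤ) else 0 := by
    have h3 : ∑ r ∈ ({p, q} : Finset ℝ), (if ∃ j : ℤ, M * b p - M * b r = j then (1 : ℤ) else 0) =
        2 := by
      rw [Finset.sum_pair hne, if_pos ⟨0, by simp⟩, if_pos ⟨k, hk⟩]
      norm_num
    rw [← h3]
    refine Finset.sum_le_sum_of_subset_of_nonneg ?_ fun r _ _ => ?_
    · intro r hr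
      rcases Finset.mem_insert.mp hr with rfl | hr
      · exact hp
      · rwa [Finset.mem_singleton.mp hr]
    · split_ifs <;> simp
  have h3 := htwo (M * b p)
  have h4 := htwo y
  lia

end Irreducible

/-! ### Exponential sums over the end points -/

section TwoValued

/-- The exponential sum of a real frequency off the integers is bounded. -/
lemma norm_sum_ech_le {θ : ℝ} (hθ : ech θ ≠ 1) (K : ℕ) :
    ‖∑ M ∈ Finset.range K, ech (((M + 1 : ℕ) : ℝ) * θ)‖ ≤ 2 / ‖ech θ - 1‖ := by
  have h1 : ∀ M ∈ Finset.range K, ech (((M + 1 : ℕ) : ℝ) * θ) = ech θ * ech θ ^ M := by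
    intro M _
    rw [← ech_pow, pow_succ']
  have h0 : 0 < ‖ech θ - 1‖ := norm_pos_iff.mpr (sub_ne_zero.mpr hθ)
  rw [Finset.sum_congr rfl h1, ← Finset.mul_sum, geom_sum_eq hθ, norm_mul, norm_ech, one_mul,
    norm_div]
  gcongr
  refine (norm_sub_le _ _).trans ?_
  rw [norm_pow, norm_ech, one_pow, norm_one]
  norm_num

/-- The mean square of a trigonometric sum with incongruent frequencies. -/
lemma exists_mean_square_bound {ι : Type*} [Fintype ι] (σ : ι → ℝ) (hσ : ∀ u, σ u ^ 2 = 1)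
    (x : ι → ℝ) (hx : ∀ u v, u ≠ v → ∀ k : ℤ, x u - x v ≠ k) :
    ∃ C : ℝ, ∀ K : ℕ, (Fintype.card ι : ℝ) * K - C ≤
      ∑ M ∈ Finset.range K, ‖∑ u, (σ u : ℂ) * ech (-(((M + 1 : ℕ) : ℝ) * x u))‖ ^ 2 := by
  classical
  -- Diagonal terms contribute exactly `K` each; in this constant they appear as `2 / 0 = 0`. The
  -- rest bounds the off-diagonal geometric sums.
  refine ⟨∑ u, ∑ v, 2 / ‖ech (x v - x u) - 1‖, fun K => ?_⟩
  have h1 : ∀ M : ℕ, ((‖∑ u, (σ u : ℂ) * ech (-(((M + 1 : ℕ) : ℝ) * x u))‖ ^ 2 : ℝ) : ℂ) =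
      ∑ u, ∑ v, ((σ u * σ v : ℝ) : ℂ) * ech (((M + 1 : ℕ) : ℝ) * (x v - x u)) := by
    intro M
    push_cast
    rw [← Complex.mul_conj', map_sum, Finset.sum_mul_sum]
    refine Finset.sum_congr rfl fun u _ => Finset.sum_congr rfl fun v _ => ?_
    rw [map_mul, Complex.conj_ofReal, ← ech_neg, neg_neg]
    rw [mul_mul_mul_comm, ← ech_add]
    congr 2
    ring
  have h2 : ((∑ M ∈ Finset.range K,
      ‖∑ u, (σ u : ℂ) * ech (-(((M + 1 : ℕ) : ℝ) * x u))‖ ^ 2 : ℝ) : ℂ) =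
      ∑ u, ∑ v, ((σ u * σ v : ℝ) : ℂ) *
        ∑ M ∈ Finset.range K, ech (((M + 1 : ℕ) : ℝ) * (x v - x u)) := by
    rw [Complex.ofReal_sum]
    simp_rw [h1]
    rw [Finset.sum_comm]
    refine Finset.sum_congr rfl fun u _ => ?_
    rw [Finset.sum_comm]
    refine Finset.sum_congr rfl fun v _ => ?_
    rw [Finset.mul_sum]
  set S : ℝ := ∑ M ∈ Finset.range K, ‖∑ u, (σ u : ℂ) * ech (-(((M + 1 : ℕ) : ℝ) * x u))‖ ^ 2
  have habs : ∀ u, |σ u| = 1 := fun u => by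
    rw [← pow_eq_one_iff_of_nonneg (abs_nonneg _) two_ne_zero, sq_abs]
    exact hσ u
  have h3 : ‖(S : ℂ) - (Fintype.card ι : ℝ) * K‖ ≤ ∑ u, ∑ v, 2 / ‖ech (x v - x u) - 1‖ := by
    have h4 : ((Fintype.card ι : ℝ) : ℂ) * K = ∑ u : ι, ∑ v : ι, if u = v then (K : ℂ) else 0 := by
      simp
    rw [h2, h4, ← Finset.sum_sub_distrib]
    refine (norm_sum_le _ _).trans (Finset.sum_le_sum fun u _ => ?_)
    rw [← Finset.sum_sub_distrib]
    refine (norm_sum_le _ _).trans (Finset.sum_le_sum fun v _ => ?_)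
    by_cases huv : u = v
    · subst huv
      rw [if_pos rfl, ← pow_two, hσ]
      simp [ech_zero]
    · rw [if_neg huv, sub_zero, norm_mul, Complex.norm_real, Real.norm_eq_abs, abs_mul, habs, habs,
        one_mul, one_mul]
      refine norm_sum_ech_le (fun h => ?_) K
      obtain ⟨k, hk⟩ := (ech_eq_one_iff _).mp h
      exact hx v u (Ne.symm huv) k hk
  have h5 : ‖(S : ℂ) - (Fintype.card ι : ℝ) * K‖ = |S - Fintype.card ι * K| := by
    rw [← Real.norm_eq_abs, ← Complex.norm_real]
    push_cast
    rfl
  rw [h5, abs_le] at h3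
  linarith [h3.1]

lemma coef_const (z : ℂ) {m : ℤ} (hm : m ≠ 0) : coef (fun _ => z) m = 0 := by
  have h1 : (2 * Real.pi * m * Complex.I : ℂ) ≠ 0 := by
    simp [Real.pi_ne_zero, hm]
  rw [coef, integral_mul_const, ← intervalIntegral.integral_of_le zero_le_one]
  have h2 : ∀ x : ℝ, ech (-(m * x)) = Complex.exp (-(2 * Real.pi * m * Complex.I) * x) := by
    intro x
    rw [ech]
    congr 1
    push_cast
    ring
  simp_rw [h2]
  rw [integral_exp_mul_complex (neg_ne_zero.mpr h1)]
  have h3 : Complex.exp (-(2 * Real.pi * m * Complex.I) * (1 : ℝ)) = 1 := by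
    rw [← h2, mul_one, ← Int.cast_neg, ech_int]
  rw [h3]
  simp

lemma memLp_of_bounded {f : ℝ → ℂ} (hf : Measurable f) (C : ℝ) (h : ∀ x, ‖f x‖ ≤ C) :
    MemLp f 2 periodMeasure :=
  MemLp.of_bound hf.aestronglyMeasurable C (ae_of_all _ h)

/-- Inside the period the sawtooth is the first Bernoulli polynomial plus `1/2`, and the constant
has no coefficient at `m ≠ 0`. -/
lemma coef_fract_zero {m : ℤ} (hm : m ≠ 0) :
    coef (fun t => ((Int.fract t : ℝ) : ℂ)) m = -1 / (2 * Real.pi * Complex.I * m) := by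
  have h1 := bernoulliFourierCoeff_eq one_ne_zero m
  rw [bernoulliFourierCoeff, fourierCoeffOn_eq_integral,
    intervalIntegral.integral_of_le zero_le_one] at h1
  simp only [fourier_eq_ech, sub_zero, div_one, one_smul, pow_one, Nat.factorial_one,
    Nat.cast_one] at h1
  rw [← h1]
  have h2 : (fun t : ℝ => ((Int.fract t : ℝ) : ℂ)) =ᵐ[periodMeasure]
      fun t => (bernoulliFun 1 t : ℂ) + (1 / 2 : ℂ) := by
    rw [periodMeasure, ← restrict_Ioo_eq_restrict_Ioc]
    filter_upwards [ae_restrict_mem measurableSet_Ioo] with t ht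
    rw [Int.fract_eq_self.mpr ⟨ht.1.le, ht.2⟩, bernoulliFun_one]
    push_cast
    ring
  have h3 : MemLp (fun t : ℝ => (bernoulliFun 1 t : ℂ)) 2 periodMeasure := by
    refine ((memLp_of_bounded (f := fun t : ℝ => ((Int.fract t : ℝ) : ℂ)) ?_ 1 fun x => ?_).sub
      (memLp_const (1 / 2 : ℂ))).ae_eq ?_
    · exact Complex.measurable_ofReal.comp measurable_fract
    · rw [Complex.norm_real, Real.norm_eq_abs, abs_of_nonneg (Int.fract_nonneg _)]
      exact (Int.fract_lt_one _).le
    · filter_upwards [h2] with t ht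
      simp [ht]
  have h4 := coef_add h3 (memLp_const (1 / 2 : ℂ)) m
  rw [coef_congr h2]
  rw [coef_const _ hm, add_zero] at h4
  rw [show (fun t : ℝ => (bernoulliFun 1 t : ℂ) + (1 / 2 : ℂ)) =
    (fun t : ℝ => (bernoulliFun 1 t : ℂ)) + fun _ => (1 / 2 : ℂ) from rfl, h4, coef]
  simp

lemma memLp_fract (a : ℝ) :
    MemLp (fun t => ((Int.fract (t - a) : ℝ) : ℂ)) 2 periodMeasure := by
  refine memLp_of_bounded ?_ 1 fun x => ?_
  · exact Complex.measurable_ofReal.comp (measurable_fract.comp (measurable_id.sub_const a))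
  · rw [Complex.norm_real, Real.norm_eq_abs, abs_of_nonneg (Int.fract_nonneg _)]
    exact (Int.fract_lt_one _).le

lemma coef_fract (a : ℝ) {m : ℤ} (hm : m ≠ 0) :
    coef (fun t => ((Int.fract (t - a) : ℝ) : ℂ)) m =
      ech (-(m * a)) * (-1 / (2 * Real.pi * Complex.I * m)) := by
  rw [coef_eq_shift _ m a, ← coef_fract_zero hm, coef, ← intervalIntegral.integral_of_le
    (by linarith), ← intervalIntegral.integral_of_le zero_le_one,
    ← intervalIntegral.integral_const_mul]
  have h1 := intervalIntegral.integral_comp_add_right (a := 0) (b := 1)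
    (fun x : ℝ => ech (-(m * x)) * ((Int.fract (Int.fract x - a) : ℝ) : ℂ)) a
  rw [zero_add, add_comm 1 a] at h1
  rw [← h1]
  congr 1
  ext x
  rw [← mul_assoc, ← ech_add]
  congr 2
  · ring
  · have : Int.fract (x + a) - a = x - (⌊x + a⌋ : ℤ) := by rw [Int.fract]; ring
    rw [this, Int.fract_sub_intCast]

lemma coef_finsetSum {ι : Type*} (s : Finset ι) {g : ι → ℝ → ℂ}
    (hg : ∀ i ∈ s, MemLp (g i) 2 periodMeasure) (n : ℤ) :
    coef (fun x => ∑ i ∈ s, g i x) n = ∑ i ∈ s, coef (g i) n := by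
  unfold coef
  simp_rw [Finset.mul_sum]
  exact integral_finsetSum _ fun i hi =>
    ((hg i hi).ech_mul (f := fun x => -(n * x)) (by fun_prop)).integrable (by norm_num)

lemma norm_coef_indicator_neg (G : Set ℝ) (m : ℤ) :
    ‖coef (G.indicator 1) (-m)‖ = ‖coef (G.indicator 1) m‖ := by
  have h1 : coef (G.indicator 1) (-m) = (starRingEnd ℂ) (coef (G.indicator 1) m) := by
    rw [coef, coef, ← integral_conj]
    congr 1
    ext x
    rw [map_mul, ← ech_neg]
    by_cases hx : x ∈ G <;> simp [hx]
  rw [h1, RCLike.norm_conj]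

/-- Bessel's inequality for the first two harmonics of an indicator function. -/
lemma sq_coef_indicator_le {G : Set ℝ} (hG : MeasurableSet G) :
    ‖coef (G.indicator 1) 1‖ ^ 2 + ‖coef (G.indicator 1) 2‖ ^ 2 ≤ 1 / 8 := by
  have hL : MemLp (G.indicator (1 : ℝ → ℂ)) 2 periodMeasure := (memLp_const 1).indicator hG
  have h1 := sum_le_hasSum ({0, 1, -1, 2, -2} : Finset ℤ) (fun _ _ => by positivity)
    (hasSum_sq_coef hL)
  set γ := volume.real (G ∩ Set.Ioc 0 1) with hγ
  have h2 : ∫ x, ‖G.indicator (1 : ℝ → ℂ) x‖ ^ 2 ∂periodMeasure = γ := by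
    rw [hγ, ← integral_indicator_period hG]
    congr 1
    ext x
    by_cases hx : x ∈ G <;> simp [hx]
  have h3 : coef (G.indicator 1) 0 = (γ : ℂ) := by
    rw [hγ, ← integral_indicator_period hG, ← integral_complex_ofReal, coef]
    congr 1
    ext x
    by_cases hx : x ∈ G <;> simp [hx, ech_zero]
  rw [h2, Finset.sum_insert (by decide), Finset.sum_insert (by decide),
    Finset.sum_insert (by decide), Finset.sum_insert (by decide), Finset.sum_singleton, h3,
    norm_coef_indicator_neg, norm_coef_indicator_neg, Complex.norm_real, Real.norm_eq_abs,
    sq_abs] at h1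
  -- Conjugate symmetry doubles the two harmonics, so twice their sum is at most `γ - γ ^ 2 ≤ 1 /
  -- 4`.
  nlinarith [sq_nonneg (γ - 1 / 2)]

variable {Q : Finset ℝ} {E : Set ℝ}

/-- If the folding takes just two values, then the exponential sums over its end points are
small. -/
lemma sq_norm_endpoint_sum_le (hE : MeasurableSet E) {b : ℝ → ℝ} {M s : ℕ}
    (hfl : ∀ t, (foldCount E M t : ℤ) = ∑ q ∈ Q, (⌊t - M * q⌋ - ⌊t - M * b q⌋))
    (htwo : ∀ t, foldCount E M t = s ∨ foldCount E M t = s + 1) :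
    ‖∑ q ∈ Q, (ech (-(M * q)) - ech (-(M * b q)))‖ ^ 2 +
      ‖∑ q ∈ Q, (ech (-(M * (2 * q))) - ech (-(M * (2 * b q))))‖ ^ 2 / 4 ≤ Real.pi ^ 2 / 2 := by
  classical
  have hG := measurableSet_foldLevel hE M s
  -- With only the values `s` and `s + 1`, the indicator is the count minus `s`: a constant plus
  -- sawtooths at the folded end points, whose coefficients are explicit.
  have hind : ∀ t, (foldLevel E M s).indicator (1 : ℝ → ℂ) t =
      ((∑ q ∈ Q, (M * b q - M * q) - s : ℝ) : ℂ) + ∑ q ∈ Q,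
        (((Int.fract (t - M * b q) : ℝ) : ℂ) - ((Int.fract (t - M * q) : ℝ) : ℂ)) := by
    intro t
    have h1 : (foldLevel E M s).indicator (1 : ℝ → ℂ) t = ((foldCount E M t : ℤ) : ℂ) - s := by
      rcases htwo t with h | h
      · rw [Set.indicator_of_notMem (by simp [foldLevel, h]), h]; simp
      · rw [Set.indicator_of_mem (by simp [foldLevel, h]), h]; simp
    have h2 : ∀ q ∈ Q, ((⌊t - M * q⌋ : ℂ) - (⌊t - M * b q⌋ : ℂ)) = ((M * b q - M * q : ℝ) : ℂ) +
        (((Int.fract (t - M * b q) : ℝ) : ℂ) - ((Int.fract (t - M * q) : ℝ) : ℂ)) := by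
      intro q _
      rw [Int.fract, Int.fract]
      push_cast
      ring
    rw [h1, hfl]
    push_cast
    rw [Finset.sum_congr rfl h2, Finset.sum_add_distrib]
    push_cast
    ring
  have hcoef : ∀ m : ℤ, m ≠ 0 → coef ((foldLevel E M s).indicator 1) m =
      (∑ q ∈ Q, (ech (-(M * (m * q))) - ech (-(M * (m * b q))))) *
        (1 / (2 * Real.pi * Complex.I * m)) := by
    intro m hm
    have hd : ∀ q ∈ Q, MemLp (fun t => ((Int.fract (t - M * b q) : ℝ) : ℂ) -
        ((Int.fract (t - M * q) : ℝ) : ℂ)) 2 periodMeasure :=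
      fun q _ => (memLp_fract _).sub (memLp_fract _)
    have h1 : (foldLevel E M s).indicator (1 : ℝ → ℂ) =
        (fun _ => ((∑ q ∈ Q, (M * b q - M * q) - s : ℝ) : ℂ)) + fun t => ∑ q ∈ Q,
          (((Int.fract (t - M * b q) : ℝ) : ℂ) - ((Int.fract (t - M * q) : ℝ) : ℂ)) :=
      funext hind
    rw [h1, coef_add (memLp_const _) (memLp_finsetSum _ hd), coef_const _ hm, zero_add,
      coef_finsetSum _ hd, Finset.sum_mul]
    refine Finset.sum_congr rfl fun q hq => ?_
    have h2 : (fun t => ((Int.fract (t - M * b q) : ℝ) : ℂ)) =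
        (fun t => ((Int.fract (t - M * b q) : ℝ) : ℂ) - ((Int.fract (t - M * q) : ℝ) : ℂ)) +
          fun t => ((Int.fract (t - M * q) : ℝ) : ℂ) := by
      ext t; simp
    have h3 := coef_fract (M * b q) hm
    rw [h2, coef_add (hd q hq) (memLp_fract _), coef_fract _ hm] at h3
    rw [eq_sub_of_add_eq h3]
    have e1 : (m : ℝ) * (M * b q) = M * (m * b q) := by ring
    have e2 : (m : ℝ) * (M * q) = M * (m * q) := by ring
    rw [e1, e2]
    ring
  have hnorm : ∀ m : ℤ, 0 < m → ‖coef ((foldLevel E M s).indicator 1) m‖ ^ 2 =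
      ‖∑ q ∈ Q, (ech (-(M * (m * q))) - ech (-(M * (m * b q))))‖ ^ 2 /
        (4 * Real.pi ^ 2 * m ^ 2) := by
    intro m hm
    rw [hcoef m hm.ne', norm_mul, mul_pow]
    have : ‖(1 / (2 * Real.pi * Complex.I * m) : ℂ)‖ = 1 / (2 * Real.pi * m) := by
      have hm' : (0 : ℝ) < m := by exact_mod_cast hm
      simp [abs_of_pos Real.pi_pos, abs_of_pos hm']
    rw [this]
    ring
  have h1 := sq_coef_indicator_le hG
  rw [hnorm 1 one_pos, hnorm 2 two_pos] at h1
  push_cast at h1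
  simp only [one_mul] at h1
  have hpi := Real.pi_pos
  have h2 := mul_le_mul_of_nonneg_left h1 (by positivity : 0 ≤ 4 * Real.pi ^ 2)
  rw [mul_add] at h2
  field_simp at h2
  field_simp
  linarith

/-- **Kozma–Nitzan**: an irredundant union of at least two arcs has a folding all of whose level
sets consist of fewer arcs. -/
lemma exists_fold_redundant (h : IsArcSet Q E) (hQ : 2 ≤ Q.card) :
    ∃ M : ℕ, 0 < M ∧ ∀ s, ¬IsIrredundant (Q.image fun q => (M : ℝ) * q) (foldLevel E M s) := by
  classical
  by_contra hcon
  push Not at hcon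
  have hne : Q.Nonempty := Finset.card_pos.mp (by lia)
  -- The trivial folding `M = 1` shows that `E` itself is irredundant, so its right end points `b`
  -- are available.
  have hlev : foldLevel E 1 0 = E := by
    ext t
    rw [foldLevel, Set.mem_ofPred_eq, foldCount, Finset.sum_range_one]
    by_cases ht : t ∈ E <;> simp [ht]
  have hi : IsIrredundant Q E := by
    obtain ⟨s, hs⟩ := hcon 1 one_pos
    simp only [Nat.cast_one, one_mul, Finset.image_id'] at hs
    rcases Nat.eq_zero_or_pos s with rfl | hpos
    · rwa [hlev] at hs
    · exfalso
      obtain ⟨q, hq⟩ := hne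
      have hl := isArcSet_foldLevel h one_pos s
      simp only [Nat.cast_one, one_mul, Finset.image_id'] at hl
      have h1 : s < foldCount E 1 q := (hs.mem_and_gap hl hq).1
      have h2 := foldCount_le E 1 q
      lia
  choose! b hb using fun q (hq : q ∈ Q) => hi.exists_end h hq
  have hind := hi.indicator_eq h hne hb
  have hall : ∀ M : ℕ, 0 < M → ∃ s, _ := fun M hM => (hcon M hM).imp fun s hs =>
    foldCount_of_irredundant h hne hind hM hs
  let ι := Q × Bool
  let σ : ι → ℝ := fun u => if u.2 then 1 else -1
  let x : ι → ℝ := fun u => if u.2 then u.1 else b u.1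
  have hσ : ∀ u, σ u ^ 2 = 1 := by
    rintro ⟨q, _ | _⟩ <;> simp [σ]
  have hx : ∀ M : ℕ, 0 < M → ∀ u v : ι, u ≠ v → ∀ k : ℤ, M * x u - M * x v ≠ k := by
    intro M hM u v huv k
    obtain ⟨s, -, haa, hab, hbb⟩ := hall M hM
    obtain ⟨⟨p, hp⟩, _ | _⟩ := u <;> obtain ⟨⟨q, hq⟩, _ | _⟩ := v
    · exact hbb p hp q hq (fun hpq => huv (by subst hpq; rfl)) k
    · intro hk
      refine hab q hq p hp (-k) ?_
      simp only [x] at hk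
      push_cast
      simp only [Bool.false_eq_true, if_false, if_true] at hk
      linarith
    · exact hab p hp q hq k
    · exact haa p hp q hq (fun hpq => huv (by subst hpq; rfl)) k
  have hsum : ∀ (M : ℕ) (c : ℝ), ∑ u, (σ u : ℂ) * ech (-((M : ℝ) * (c * x u))) =
      ∑ q ∈ Q, (ech (-(M * (c * q))) - ech (-(M * (c * b q)))) := by
    intro M c
    rw [Fintype.sum_prod_type, ← Finset.sum_coe_sort Q]
    refine Finset.sum_congr rfl fun q _ => ?_
    simp [σ, x, sub_eq_add_neg]
  have hcard : (Fintype.card ι : ℝ) = 2 * Q.card := by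
    simp [ι, mul_comm]
  obtain ⟨C₁, hC₁⟩ := exists_mean_square_bound σ hσ (fun u => 1 * x u) (fun u v huv k => by
    simpa using hx 1 one_pos u v huv k)
  obtain ⟨C₂, hC₂⟩ := exists_mean_square_bound σ hσ (fun u => 2 * x u) (fun u v huv k => by
    simpa using hx 2 two_pos u v huv k)
  have hub : ∀ M : ℕ, ‖∑ u, (σ u : ℂ) * ech (-(((M + 1 : ℕ) : ℝ) * (1 * x u)))‖ ^ 2 +
      ‖∑ u, (σ u : ℂ) * ech (-(((M + 1 : ℕ) : ℝ) * (2 * x u)))‖ ^ 2 / 4 ≤ Real.pi ^ 2 / 2 := by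
    intro M
    obtain ⟨s, htwo, -⟩ := hall (M + 1) M.succ_pos
    rw [hsum, hsum]
    simp only [one_mul]
    exact sq_norm_endpoint_sum_le h.meas (foldCount_eq_sum_floor hind M.succ_pos) htwo
  -- There are `2 |Q| ≥ 4` incongruent end points, and they remain incongruent after doubling, so
  -- the mean is at least `4 (1 + 1 / 4) = 5`, while `π ^ 2 / 2 < 5`.
  have hfinal : ∀ K : ℕ, 5 * (K : ℝ) - (C₁ + C₂ / 4) ≤ Real.pi ^ 2 / 2 * K := by
    intro K
    have h1 := Finset.sum_le_sum fun M (_ : M ∈ Finset.range K) => hub M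
    rw [Finset.sum_add_distrib, ← Finset.sum_div, Finset.sum_const, Finset.card_range,
      nsmul_eq_mul] at h1
    have h2 := hC₁ K
    have h3 := hC₂ K
    rw [hcard] at h2 h3
    have h4 : (2 : ℝ) ≤ Q.card := by exact_mod_cast hQ
    have h5 : (2 : ℝ) * K ≤ Q.card * K := by gcongr
    linarith
  obtain ⟨K, hK⟩ := exists_nat_gt ((C₁ + C₂ / 4) / (5 - Real.pi ^ 2 / 2))
  have hpi : 0 < 5 - Real.pi ^ 2 / 2 := by
    have := Real.pi_lt_d2
    nlinarith [Real.pi_pos]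
  rw [div_lt_iff₀ hpi] at hK
  linarith [hfinal K]

end TwoValued

/-! ### The induction on the number of arcs -/

section KozmaNitzan

/-- Dirichlet puts some `k α` within `1/5` of an integer. If it falls short by `η`, then `⌊1 / η⌋`
multiples of it have fractional part less than `η`. -/
lemma exists_fract_mul_le (α : ℝ) : ∃ M : ℕ, 0 < M ∧ Int.fract (M * α) ≤ 1 / 4 := by
  obtain ⟨k, hk, -, hk'⟩ := Real.exists_nat_abs_mul_sub_round_le α (n := 4) (by norm_num)
  set r := round (k * α) with hr
  have hk'' : |(k : ℝ) * α - r| ≤ 1 / 5 := hk'.trans (by norm_num)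
  rw [abs_le] at hk''
  rcases le_or_gt 0 ((k : ℝ) * α - r) with h0 | h0
  · refine ⟨k, hk, ?_⟩
    have : Int.fract ((k : ℝ) * α) = k * α - r :=
      Int.fract_eq_iff.mpr ⟨h0, by linarith [hk''.2], r, by ring⟩
    linarith [hk''.2]
  · set η := (r : ℝ) - k * α with hη
    have hη0 : 0 < η := by linarith
    have h1 := Nat.floor_le (a := 1 / η) (by positivity)
    have h2 := Nat.lt_floor_add_one (1 / η)
    set j := ⌊1 / η⌋₊
    rw [le_div_iff₀ hη0] at h1
    rw [div_lt_iff₀ hη0] at h2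
    have hj : 0 < j := by
      rcases Nat.eq_zero_or_pos j with h3 | h3
      · rw [h3] at h2; push_cast at h2; linarith [hk''.1]
      · exact h3
    refine ⟨j * k, Nat.mul_pos hj hk, ?_⟩
    have : Int.fract (((j * k : ℕ) : ℝ) * α) = 1 - j * η := by
      refine Int.fract_eq_iff.mpr ⟨by linarith, by nlinarith, j * r - 1, ?_⟩
      push_cast
      rw [hη]
      ring
    rw [this]
    linarith [hk''.1]

lemma samples_of_volume_eq_one {E : Set ℝ} (h : volume.real (E ∩ Set.Ioc 0 1) = 1) :
    ∃ Λ : Set ℤ, Samples Λ E ∧ HasDensity Λ (volume.real (E ∩ Set.Ioc 0 1)) :=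
  ⟨Set.univ, samples_univ E, by rw [h]; exact hasDensity_univ⟩

lemma samples_of_volume_eq_zero {E : Set ℝ} (h : volume.real (E ∩ Set.Ioc 0 1) = 0) :
    ∃ Λ : Set ℤ, Samples Λ E ∧ HasDensity Λ (volume.real (E ∩ Set.Ioc 0 1)) := by
  refine ⟨∅, samples_empty ?_, by rw [h]; exact hasDensity_empty⟩
  refine (measureReal_eq_zero_iff ?_).mp h
  exact ((measure_mono Set.inter_subset_right).trans_lt (by simp)).ne

lemma IsArcSet.samples_of_small_arc {a : ℝ} {E : Set ℝ} (h : IsArcSet {a} E)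
    (hs : volume.real (E ∩ Set.Ioc 0 1) ≤ 1 / 4) :
    ∃ Λ : Set ℤ, Samples Λ E ∧ HasDensity Λ (volume.real (E ∩ Set.Ioc 0 1)) := by
  obtain ⟨β, hβ0, hβ1, hβ⟩ := h.exists_length
  have hv := h.volume_eq hβ0 hβ1 hβ
  rcases eq_or_lt_of_le hβ0 with h0 | h0
  · exact samples_of_volume_eq_zero (hv.trans h0.symm)
  · rw [hv] at hs ⊢
    exact ⟨_, h.samples_round h0 hs hβ, hasDensity_round h0 hs⟩

lemma IsArcSet.samples_of_fold {P : Finset ℝ} {E : Set ℝ} (h : IsArcSet P E) {M : ℕ} (hM : 0 < M)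
    (hl : ∀ s : Fin M, ∃ Λ : Set ℤ, Samples Λ (foldLevel E M s) ∧
      HasDensity Λ (volume.real (foldLevel E M s ∩ Set.Ioc 0 1))) :
    ∃ Λ : Set ℤ, Samples Λ E ∧ HasDensity Λ (volume.real (E ∩ Set.Ioc 0 1)) := by
  choose Λ hΛ hd using hl
  refine ⟨interleave M Λ, samples_interleave h hM hΛ, ?_⟩
  have h1 := hasDensity_interleave hM hd
  have hM' : (M : ℝ) ≠ 0 := by exact_mod_cast hM.ne'
  rwa [sum_volume_foldLevel h.meas hM, mul_div_cancel_left₀ _ hM'] at h1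

/-- **Kozma–Nitzan**: a finite union of arcs of the circle is stably sampled by a set of integers
whose density is the measure of the union. -/
theorem IsArcSet.exists_samples {P : Finset ℝ} {E : Set ℝ} (h : IsArcSet P E) :
    ∃ Λ : Set ℤ, Samples Λ E ∧ HasDensity Λ (volume.real (E ∩ Set.Ioc 0 1)) := by
  classical
  induction hn : P.card using Nat.strong_induction_on generalizing P E with
  | _ n ih =>
  have hdrop : ∀ {Q : Finset ℝ} {G : Set ℝ}, Q.card ≤ n → ¬IsIrredundant Q G →
      ∃ Λ : Set ℤ, Samples Λ G ∧ HasDensity Λ (volume.real (G ∩ Set.Ioc 0 1)) := by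
    intro Q G hQ hG
    rw [IsIrredundant] at hG
    push Not at hG
    obtain ⟨q, hq, hqG⟩ := hG
    exact ih _ (lt_of_lt_of_le (Finset.card_erase_lt_of_mem hq) hQ) hqG rfl
  by_cases hi : IsIrredundant P E
  swap
  · exact hdrop hn.le hi
  have himg : ∀ M : ℕ, (P.image fun q => (M : ℝ) * q).card ≤ n := fun M =>
    Finset.card_image_le.trans hn.le
  rcases lt_trichotomy n 1 with h0 | h1 | h2
  · have hP : P = ∅ := Finset.card_eq_zero.mp (by lia)
    subst hP
    rcases h.eq_empty_or_univ with rfl | rfl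
    · exact samples_of_volume_eq_zero (by simp)
    · exact samples_of_volume_eq_one (by simp)
  · obtain ⟨a, rfl⟩ := Finset.card_eq_one.mp (hn.trans h1)
    set α := volume.real (E ∩ Set.Ioc 0 1) with hα
    obtain ⟨M, hM, hMα⟩ := exists_fract_mul_le α
    refine h.samples_of_fold hM fun s => ?_
    by_cases hs : IsIrredundant (({a} : Finset ℝ).image fun q => (M : ℝ) * q) (foldLevel E M s)
    swap
    · exact hdrop (himg M) hs
    have hl := isArcSet_foldLevel h hM s
    choose! b hb using fun q (hq : q ∈ ({a} : Finset ℝ)) => hi.exists_end h hq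
    have htwo := (foldCount_of_irredundant h (Finset.singleton_nonempty a)
      (hi.indicator_eq h (Finset.singleton_nonempty a) hb) hM hs).1
    -- The count has mean `M α` and exceeds `s` by the indicator of the level set.
    have hv : volume.real (foldLevel E M s ∩ Set.Ioc 0 1) = M * α - (s : ℕ) := by
      rw [← integral_indicator_period hl.meas, hα, ← integral_foldCount h.meas hM]
      have h3 : ((s : ℕ) : ℝ) = ∫ _, ((s : ℕ) : ℝ) ∂periodMeasure := by simp
      rw [h3, ← integral_sub _ (integrable_const _)]
      · congr 1
        ext t
        rcases htwo t with h4 | h4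
        · rw [Set.indicator_of_notMem (by simp [foldLevel, h4]), h4]; simp
        · rw [Set.indicator_of_mem (by simp [foldLevel, h4]), h4]; simp
      · simp_rw [foldCount_eq_sum_indicator]
        exact integrable_finsetSum _ fun j hj =>
          integrable_comp_fold (integrable_indicator_period h.meas) (Finset.mem_range.mp hj)
    rw [Finset.image_singleton] at hl
    obtain ⟨β, hβ0, hβ1, hβ⟩ := hl.exists_length
    have hvβ := hl.volume_eq hβ0 hβ1 hβ
    -- Either the level set has full measure, or its length is the fractional part of `M α`, at most
    -- `1/4`.
    rcases eq_or_lt_of_le hβ1 with h5 | h5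
    · exact samples_of_volume_eq_one (hvβ.trans h5)
    · refine hl.samples_of_small_arc (le_trans (le_of_eq ?_) hMα)
      rw [hv, eq_comm, Int.fract_eq_iff]
      rw [hvβ] at hv
      exact ⟨by linarith, by linarith, (s : ℕ), by push_cast; ring⟩
  · obtain ⟨M, hM, hred⟩ := exists_fold_redundant h (by lia)
    exact h.samples_of_fold hM fun s => hdrop (himg M) (hred s)

end KozmaNitzan

/-! ### From intervals and signals to the circle -/

section Main

/-- `E` is a measurable `1`-periodic set which is constant on the right-closed intervals that miss
`D` modulo `1`. -/
structure IsStepSet (D : Finset ℝ) (E : Set ℝ) : Prop where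
  meas : MeasurableSet E
  add_one_mem : ∀ t, t + 1 ∈ E ↔ t ∈ E
  const : ∀ s t, s < t → (∀ p ∈ D, ∀ k : ℤ, p + k ∉ Set.Ioc s t) → (t ∈ E ↔ s ∈ E)

lemma IsStepSet.mono {D D' : Finset ℝ} {E : Set ℝ} (h : IsStepSet D E) (hD : D ⊆ D') :
    IsStepSet D' E :=
  ⟨h.meas, h.add_one_mem, fun s t hst hp => h.const s t hst fun p hpD => hp p (hD hpD)⟩

/-- Step sets over a common `D` are, unlike arc sets, closed under Boolean combinations, as the
greedy sets require. Here the jump points serve as possible left end points. -/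
lemma IsStepSet.isArcSet {D : Finset ℝ} {E : Set ℝ} (h : IsStepSet D E) : IsArcSet D E where
  meas := h.meas
  add_one_mem := h.add_one_mem
  anti s t hst _ hp ht := (h.const s t hst hp).mp ht
  right t ht := by
    rcases D.eq_empty_or_nonempty with rfl | hD
    · refine ⟨1, one_pos, fun u hu _ => ?_⟩
      rcases eq_or_lt_of_le hu with rfl | hu
      · exact ht
      · exact (h.const t u hu (by simp)).mpr ht
    · obtain ⟨q, -, k, hk1, -, hnext⟩ := exists_next_point hD t
      refine ⟨q + k - t, by linarith, fun u hu hu' => ?_⟩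
      rcases eq_or_lt_of_le hu with rfl | hu
      · exact ht
      · refine (h.const t u hu fun p hp j hj => ?_).mpr ht
        have := hnext p hp j hj.1
        linarith [hj.2]

/-- A finite union of intervals in one period agrees almost everywhere with a step set. -/
lemma IsFiniteUnionOfIntervals.exists_stepSet {A : Set ℝ} (hA : IsFiniteUnionOfIntervals A)
    (hAp : A ⊆ freqPeriod) : ∃ (D : Finset ℝ) (E : Set ℝ), IsStepSet D E ∧ (A = ∅ → E = ∅) ∧
      ∀ᵐ x ∂(volume.restrict freqPeriod), x ∈ A ↔ x ∈ E := by
  classical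
  obtain ⟨S, hS, rfl⟩ := hA
  have hsub : ∀ J ∈ S, J ⊆ Set.Icc (-1 / 2) (1 / 2) := fun J hJ x hx =>
    hAp (Set.mem_biUnion hJ hx)
  -- For empty `J` both `sInf J` and `sSup J` default to `0`, so the half-open interval replacing
  -- `J` is empty too.
  have hne : ∀ J : Set ℝ, ∀ x, sInf J ≤ x → x < sSup J → J.Nonempty := by
    intro J x h1 h2
    rw [Set.nonempty_iff_ne_empty]
    rintro rfl
    rw [Real.sInf_empty] at h1
    rw [Real.sSup_empty] at h2
    linarith
  refine ⟨S.image sInf ∪ S.image sSup, {t | ∃ J ∈ S, ∃ k : ℤ, sInf J ≤ t - k ∧ t - k < sSup J},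
    ⟨?_, ?_, ?_⟩, ?_, ?_⟩
  · have : {t : ℝ | ∃ J ∈ S, ∃ k : ℤ, sInf J ≤ t - k ∧ t - k < sSup J} =
        ⋃ J ∈ S, ⋃ k : ℤ, (fun t : ℝ => t - k) ⁻¹' Set.Ico (sInf J) (sSup J) := by
      ext t
      simp only [Set.mem_ofPred_eq, Set.mem_iUnion, Set.mem_preimage, Set.mem_Ico, exists_prop]
    rw [this]
    refine Finset.measurableSet_biUnion S fun J _ => MeasurableSet.iUnion fun k => ?_
    exact (measurable_id.sub_const _) measurableSet_Ico
  · intro t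
    constructor
    · rintro ⟨J, hJ, k, h1, h2⟩
      exact ⟨J, hJ, k - 1, by push_cast; linarith, by push_cast; linarith⟩
    · rintro ⟨J, hJ, k, h1, h2⟩
      exact ⟨J, hJ, k + 1, by push_cast; linarith, by push_cast; linarith⟩
  · intro s t hst hp
    constructor
    · rintro ⟨J, hJ, k, h1, h2⟩
      refine ⟨J, hJ, k, ?_, by linarith⟩
      by_contra hcon
      push Not at hcon
      exact hp (sInf J) (Finset.mem_union_left _ (Finset.mem_image_of_mem _ hJ)) k
        ⟨by linarith, by linarith⟩
    · rintro ⟨J, hJ, k, h1, h2⟩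
      refine ⟨J, hJ, k, by linarith, ?_⟩
      by_contra hcon
      push Not at hcon
      exact hp (sSup J) (Finset.mem_union_right _ (Finset.mem_image_of_mem _ hJ)) k
        ⟨by linarith, by linarith⟩
  · intro hempty
    rw [Set.eq_empty_iff_forall_notMem]
    rintro t ⟨J, hJ, k, h1, h2⟩
    obtain ⟨x, hx⟩ := hne J _ h1 h2
    rw [Set.eq_empty_iff_forall_notMem] at hempty
    exact hempty x (Set.mem_biUnion hJ hx)
  -- Avoiding the ends `±1/2` of the period leaves only the translate `k = 0`.
  · have hfin : ∀ᵐ x : ℝ, x ∉ ((S.image sInf ∪ S.image sSup ∪ {-1 / 2, 1 / 2} : Finset ℝ) :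
        Set ℝ) := by
      rw [ae_iff]
      simp only [not_not, Set.ofPred_mem_eq]
      exact (Finset.finite_toSet _).measure_zero _
    filter_upwards [ae_restrict_of_ae hfin, ae_restrict_mem (by exact measurableSet_Icc)]
      with x hx hxp
    simp only [Finset.mem_coe, Finset.mem_union, Finset.mem_insert, Finset.mem_singleton,
      not_or] at hx
    obtain ⟨⟨hxi, hxs⟩, hx1, hx2⟩ := hx
    have hlo : -1 / 2 < x := lt_of_le_of_ne hxp.1 (Ne.symm hx1)
    have hhi : x < 1 / 2 := lt_of_le_of_ne hxp.2 hx2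
    constructor
    · intro hxA
      obtain ⟨J, hJ, hxJ⟩ := Set.mem_iUnion₂.mp hxA
      refine ⟨J, hJ, 0, ?_, ?_⟩
      · simpa using csInf_le (bddBelow_Icc.mono (hsub J hJ)) hxJ
      · rw [Int.cast_zero, sub_zero]
        refine lt_of_le_of_ne (le_csSup (bddAbove_Icc.mono (hsub J hJ)) hxJ) fun h => hxs ?_
        rw [h]
        exact Finset.mem_image_of_mem _ hJ
    · rintro ⟨J, hJ, k, h1, h2⟩
      have hJne := hne J _ h1 h2
      have h3 : -1 / 2 ≤ sInf J := le_csInf hJne fun y hy => (hsub J hJ hy).1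
      have h4 : sSup J ≤ 1 / 2 := csSup_le hJne fun y hy => (hsub J hJ hy).2
      have h5 : (k : ℝ) < 1 := by linarith
      have h6 : (-1 : ℝ) < k := by linarith
      have hk : k = 0 := by
        have h5' : k < 1 := by exact_mod_cast h5
        have h6' : -1 < k := by exact_mod_cast h6
        lia
      subst hk
      rw [Int.cast_zero, sub_zero] at h1 h2
      have h7 : sInf J < x := lt_of_le_of_ne h1 fun h => hxi (by
        rw [← h]; exact Finset.mem_image_of_mem _ hJ)
      obtain ⟨y, hy, hyx⟩ := (csInf_lt_iff (bddBelow_Icc.mono (hsub J hJ)) hJne).mp h7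
      obtain ⟨z, hz, hxz⟩ := (lt_csSup_iff (bddAbove_Icc.mono (hsub J hJ)) hJne).mp h2
      exact Set.mem_biUnion hJ ((hS J hJ).out hy hz ⟨hyx.le, hxz.le⟩)

lemma volume_stepSet_eq {A E : Set ℝ} (hE : MeasurableSet E) (hper : ∀ t, t + 1 ∈ E ↔ t ∈ E)
    (hAp : A ⊆ freqPeriod) (hAE : ∀ᵐ x ∂(volume.restrict freqPeriod), x ∈ A ↔ x ∈ E) :
    volume.real (E ∩ Set.Ioc 0 1) = volume.real A := by
  have hp : Function.Periodic (E.indicator (1 : ℝ → ℝ)) 1 := by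
    intro t
    by_cases ht : t ∈ E
    · rw [Set.indicator_of_mem ht, Set.indicator_of_mem ((hper t).mpr ht)]; rfl
    · rw [Set.indicator_of_notMem ht, Set.indicator_of_notMem (fun h => ht ((hper t).mp h))]
  have h1 := hp.intervalIntegral_add_eq 0 (-1 / 2)
  rw [zero_add, intervalIntegral.integral_of_le zero_le_one,
    intervalIntegral.integral_of_le (by norm_num), integral_indicator_period hE,
    integral_indicator_one hE] at h1
  rw [h1]
  have h2 : (volume.restrict freqPeriod) A = (volume.restrict freqPeriod) E :=
    measure_congr (by filter_upwards [hAE] with x hx; exact propext hx)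
  have h3 : volume.restrict freqPeriod = volume.restrict (Set.Ioc (-1 / 2 : ℝ) (-1 / 2 + 1)) := by
    rw [freqPeriod, restrict_Ioc_eq_restrict_Icc]
    norm_num
  rw [Measure.real, Measure.real, ← h3, ← h2,
    Measure.restrict_apply' (show MeasurableSet freqPeriod from measurableSet_Icc),
    Set.inter_eq_left.mpr hAp]

/-- A property which is invariant under integer shifts and holds almost everywhere in one period
holds almost everywhere in the other. -/
lemma ae_period_of_ae_freqPeriod {p : ℝ → Prop} (hp : ∀ t, p (t - 1) → p t)
    (h : ∀ᵐ t ∂(volume.restrict freqPeriod), p t) : ∀ᵐ t ∂periodMeasure, p t := by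
  rw [ae_restrict_iff' measurableSet_Ioc]
  rw [ae_restrict_iff' (by exact measurableSet_Icc)] at h
  have h2 := (measurePreserving_sub_right volume (1 : ℝ)).quasiMeasurePreserving.ae h
  filter_upwards [h, h2] with t h1 h2 ht
  rcases le_or_gt t (1 / 2) with h3 | h3
  · exact h1 ⟨by linarith [ht.1], h3⟩
  · exact hp t (h2 ⟨by linarith, by linarith [ht.2]⟩)

lemma measurePreserving_coe_circle : MeasurePreserving ((↑) : ℝ → UnitAddCircle) periodMeasure
    (AddCircle.haarAddCircle (T := (1 : ℝ))) := by
  have h := UnitAddCircle.measurePreserving_mk 0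
  rw [zero_add] at h
  have h2 := AddCircle.volume_eq_smul_haarAddCircle (T := (1 : ℝ))
  rw [ENNReal.ofReal_one, one_smul] at h2
  rw [← h2]
  exact h

lemma coef_comp_coe (g : UnitAddCircle → ℂ) (n : ℤ) :
    coef (fun t : ℝ => g t) n = fourierCoeff g n := by
  rw [fourierCoeff_eq_intervalIntegral g n 0, zero_add,
    intervalIntegral.integral_of_le zero_le_one, coef, div_one, one_smul]
  congr 1
  ext t
  rw [fourier_eq_ech, smul_eq_mul, div_one]
  congr 2
  push_cast
  ring

lemma measurable_Lp_comp_coe (g : Lp ℂ 2 (AddCircle.haarAddCircle (T := (1 : ℝ)))) :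
    Measurable fun t : ℝ => g (t : UnitAddCircle) :=
  (Lp.stronglyMeasurable g).measurable.comp AddCircle.measurable_mk'

lemma memLp_Lp_comp_coe (g : Lp ℂ 2 (AddCircle.haarAddCircle (T := (1 : ℝ)))) :
    MemLp (fun t : ℝ => g (t : UnitAddCircle)) 2 periodMeasure :=
  (Lp.memLp g).comp_measurePreserving measurePreserving_coe_circle

/-- The Fourier coefficients of the discrete-time Fourier transform are the samples. -/
lemma fourierCoeff_dtft {x : ℤ → ℂ} (hx : Memℓp x 2) (n : ℤ) :
    fourierCoeff (dtft x) n = x (-n) := by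
  have hy : Memℓp (fun n : ℤ => x (-n)) 2 := by
    have h1 := (memℓp_gen_iff (by norm_num)).mp hx
    exact (memℓp_gen_iff (by norm_num)).mpr (h1.comp_injective neg_injective)
  let y : lp (fun _ : ℤ => ℂ) 2 := ⟨_, hy⟩
  have h1 := (fourierBasis (T := (1 : ℝ))).hasSum_repr_symm y
  -- `dtft` pairs `x n` with the character of index `-n`; hence the reflected instants in
  -- `samplingSet`.
  rw [← (Equiv.neg ℤ).hasSum_iff] at h1
  have h2 : dtft x = fourierBasis.repr.symm y := by
    rw [dtft, ← h1.tsum_eq]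
    congr 1
    ext1 n
    simp [y, coe_fourierBasis]
  rw [h2, ← fourierBasis_repr, LinearIsometryEquiv.apply_symm_apply]

lemma summable_sq_norm {N : ℕ} (X : DTVGS N) : Summable fun p : Fin N × ℤ => ‖X p‖ ^ 2 := by
  have h := (memℓp_gen_iff (by norm_num)).mp (lp.memℓp X)
  simpa using h

lemma norm_sq_eq_tsum {N : ℕ} (X : DTVGS N) : ‖X‖ ^ 2 = ∑' p : Fin N × ℤ, ‖X p‖ ^ 2 := by
  have h := lp.norm_rpow_eq_tsum (p := 2) (by norm_num) X
  simpa using h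

lemma memℓp_vertex {N : ℕ} (X : DTVGS N) (v : Fin N) : Memℓp (fun n : ℤ => X (v, n)) 2 := by
  refine (memℓp_gen_iff (by norm_num)).mpr ?_
  simpa [Function.comp_def] using (summable_sq_norm X).comp_injective (Prod.mk_right_injective v)

variable {N : ℕ} {U : Matrix (Fin N) (Fin N) ℝ}

/-- Inversion of the graph Fourier transform. -/
lemma dtft_eq_sum_jft (hU : U ∈ Matrix.orthogonalGroup (Fin N) ℝ) (X : DTVGS N) (v : Fin N) :
    dtft (fun n => X (v, n)) = ∑ i, ((U v i : ℝ) : ℂ) • jft U X i := by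
  have h1 : ∀ w, ∑ i, U v i * U w i = if v = w then 1 else 0 := by
    intro w
    have h2 := congr_fun₂ ((Matrix.mem_orthogonalGroup_iff (Fin N) ℝ).mp hU) v w
    rw [Matrix.mul_apply, Matrix.one_apply] at h2
    simpa using h2
  unfold jft
  simp_rw [Finset.smul_sum, smul_smul]
  rw [Finset.sum_comm]
  simp_rw [← Finset.sum_smul]
  have h3 : ∀ w, ∑ i, ((U v i : ℝ) : ℂ) * ((U w i : ℝ) : ℂ) = if v = w then 1 else 0 := by
    intro w
    have := congr_arg (fun r : ℝ => (r : ℂ)) (h1 w)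
    push_cast at this
    rw [this]
    split_ifs <;> simp
  simp_rw [h3]
  simp

lemma map_mulVec_eq_zero (hU : U ∈ Matrix.orthogonalGroup (Fin N) ℝ) (f : Fin N → ℂ)
    (hf : (U.map ((↑) : ℝ → ℂ)).mulVec f = 0) : f = 0 := by
  have h1 : (U.transpose.map ((↑) : ℝ → ℂ)) * (U.map ((↑) : ℝ → ℂ)) = 1 := by
    have h2 := (Matrix.mem_orthogonalGroup_iff' (Fin N) ℝ).mp hU
    ext i j
    have h3 := congr_arg (fun r : ℝ => (r : ℂ)) (congr_fun₂ h2 i j)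
    rw [Matrix.mul_apply, Matrix.one_apply] at h3
    rw [Matrix.mul_apply, Matrix.one_apply]
    push_cast at h3
    simpa [apply_ite] using h3
  rw [← Matrix.one_mulVec f, ← h1, ← Matrix.mulVec_mulVec, hf, Matrix.mulVec_zero]

end Main

/-! ### Assembly of the critical sampling set -/

section Critical

variable {N : ℕ}

/-- The greedy basis depends on `t` only through `K t`, which takes finitely many values and is
constant between points of `D`. -/
lemma isStepSet_greedy {R : ℕ} (m : Matrix (Fin R) (Fin N) ℂ) {D : Finset ℝ} {E : Fin N → Set ℝ}
    (hE : ∀ i, IsStepSet D (E i)) {K : ℝ → Finset (Fin N)} (hK : ∀ t i, i ∈ K t ↔ t ∈ E i)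
    (r : Fin R) : IsStepSet D {t | r ∈ greedy m (K t)} where
  meas := by
    have h1 : {t | r ∈ greedy m (K t)} =
        ⋃ J ∈ {J : Finset (Fin N) | r ∈ greedy m J}, ⋂ i, {t | i ∈ J ↔ t ∈ E i} := by
      ext t
      simp only [Set.mem_ofPred_eq, Set.mem_iUnion, Set.mem_iInter, exists_prop]
      constructor
      · exact fun h => ⟨K t, h, hK t⟩
      · rintro ⟨J, hJ, h⟩
        have : K t = J := by
          ext i
          rw [hK, h]
        rwa [this]
    rw [h1]
    refine MeasurableSet.biUnion (Set.to_countable _) fun J _ => MeasurableSet.iInter fun i => ?_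
    by_cases hi : i ∈ J
    · simpa [hi] using (hE i).meas
    · have h2 : {t | i ∈ J ↔ t ∈ E i} = (E i)ᶜ := by
        ext t
        simp [hi]
      rw [h2]
      exact (hE i).meas.compl
  add_one_mem t := by
    have : K (t + 1) = K t := by
      ext i
      rw [hK, hK, (hE i).add_one_mem]
    rw [Set.mem_ofPred_eq, this, Set.mem_ofPred_eq]
  const s t hst hp := by
    have : K t = K s := by
      ext i
      rw [hK, hK, (hE i).const s t hst hp]
    rw [Set.mem_ofPred_eq, this, Set.mem_ofPred_eq]

/-- The sampling pattern that takes the instants `-k`, `k ∈ Λ v`, at each vertex `v`. -/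
def samplingSet (Λ : Fin N → Set ℤ) : Set (Fin N × ℤ) := {p | -p.2 ∈ Λ p.1}

lemma sum_tsum_le_tsum_samplingSet {Λ : Fin N → Set ℤ} {f : Fin N × ℤ → ℝ} (hf : Summable f)
    (h0 : ∀ p, 0 ≤ f p) :
    ∑ v, ∑' k : Λ v, f (v, -k) ≤ ∑' p : samplingSet Λ, f p := by
  let e : (Σ v, Λ v) → samplingSet Λ := fun x =>
    ⟨(x.1, -x.2), by simp [samplingSet]⟩
  have he : Function.Injective e := by
    rintro ⟨v, k, hk⟩ ⟨w, l, hl⟩ h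
    have h1 := Prod.ext_iff.mp (Subtype.ext_iff.mp h)
    obtain rfl : v = w := h1.1
    obtain rfl : k = l := neg_injective h1.2
    rfl
  have h1 : Summable fun p : samplingSet Λ => f p := hf.subtype _
  have h2 : Summable fun x : (Σ v, Λ v) => f (e x) := h1.comp_injective he
  rw [← tsum_fintype (L := .unconditional _), ← Summable.tsum_sigma (f := fun x => f (e x)) h2]
  exact h2.tsum_le_tsum_of_inj e he (fun n _ => h0 n) (fun x => le_rfl) h1

/-- Bounded discrepancy makes the quotient converge, so the lower limit is a limit. -/
lemma totalSamplingRatio_samplingSet (hN : 0 < N) {Λ : Fin N → Set ℤ} {d : Fin N → ℝ}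
    (h : ∀ v, HasDensity (Λ v) (d v)) :
    totalSamplingRatio (samplingSet Λ) = (∑ v, d v) / N := by
  choose C hC using h
  have hN' : (0 : ℝ) < N := by exact_mod_cast hN
  have hcount : ∀ n : ℕ,
      ((samplingSet Λ ∩ (Set.univ ×ˢ Set.Icc (-(n : ℤ)) (n : ℤ))).ncard : ℝ) =
        ∑ v, ((Λ v ∩ Set.Ico (-(n : ℤ)) (n + 1)).ncard : ℝ) := by
    intro n
    have hset : samplingSet Λ ∩ (Set.univ ×ˢ Set.Icc (-(n : ℤ)) (n : ℤ)) =
        ⋃ v, (fun k : ℤ => (v, -k)) '' (Λ v ∩ Set.Ico (-(n : ℤ)) (n + 1)) := by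
      ext ⟨v, k⟩
      simp only [samplingSet, Set.mem_inter_iff, Set.mem_ofPred_eq, Set.mem_prod, Set.mem_univ,
        true_and, Set.mem_Icc, Set.mem_iUnion, Set.mem_image, Set.mem_Ico, Prod.mk.injEq]
      constructor
      · rintro ⟨h1, h2, h3⟩
        exact ⟨v, -k, ⟨h1, by lia, by lia⟩, rfl, by simp⟩
      · rintro ⟨w, l, ⟨h1, h2, h3⟩, rfl, rfl⟩
        exact ⟨by simpa using h1, by lia, by lia⟩
    rw [hset, Set.ncard_iUnion_of_finite, finsum_eq_sum_of_fintype]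
    · push_cast
      refine Finset.sum_congr rfl fun v _ => ?_
      rw [Set.ncard_image_of_injective]
      intro k l hkl
      simpa using hkl
    · exact fun v => ((Set.finite_Ico _ _).inter_of_right _).image _
    · intro v w hvw
      rw [Function.onFun, Set.disjoint_left]
      rintro _ ⟨k, -, rfl⟩ ⟨l, -, hl⟩
      exact hvw (Prod.mk.inj hl).1.symm
  -- The window has `2 n + 1` instants but the ratio divides by `2 n`; the extra instant accounts
  -- for `|d v|`.
  have hbound : ∀ n : ℕ, |(∑ v, ((Λ v ∩ Set.Ico (-(n : ℤ)) (n + 1)).ncard : ℝ)) -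
      (∑ v, d v) * (2 * n)| ≤ ∑ v, (C v + |d v|) := by
    intro n
    rw [Finset.sum_mul, ← Finset.sum_sub_distrib]
    refine (Finset.abs_sum_le_sum_abs _ _).trans (Finset.sum_le_sum fun v _ => ?_)
    have h1 := hC v (-(n : ℤ)) (n + 1) (by lia)
    push_cast at h1
    have h2 := neg_abs_le (d v)
    have h3 := le_abs_self (d v)
    rw [abs_le] at h1 ⊢
    constructor <;> linarith [h1.1, h1.2]
  refine Tendsto.liminf_eq ?_
  rw [tendsto_iff_norm_sub_tendsto_zero]
  have hlim : Tendsto (fun n : ℕ => (∑ v, (C v + |d v|)) / (2 * N) / (n : ℝ)) atTop (𝓝 0) :=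
    tendsto_const_div_atTop_nhds_zero_nat _
  refine tendsto_of_tendsto_of_tendsto_of_le_of_le' tendsto_const_nhds hlim
    (Eventually.of_forall fun n => norm_nonneg _) ?_
  filter_upwards [eventually_gt_atTop 0] with n hn
  have hn' : (0 : ℝ) < n := by exact_mod_cast hn
  rw [hcount, Real.norm_eq_abs]
  have e1 : (∑ v, ((Λ v ∩ Set.Ico (-(n : ℤ)) (n + 1)).ncard : ℝ)) / (2 * n * N) - (∑ v, d v) / N =
      ((∑ v, ((Λ v ∩ Set.Ico (-(n : ℤ)) (n + 1)).ncard : ℝ)) - (∑ v, d v) * (2 * n)) /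
        (2 * n * N) := by
    field_simp
  rw [e1, abs_div, abs_of_pos (by positivity : (0 : ℝ) < 2 * n * N), div_div,
    show (2 * N * n : ℝ) = 2 * n * N by ring]
  gcongr
  exact hbound n

variable {U : Matrix (Fin N) (Fin N) ℝ}

lemma ae_dtft_eq (hU : U ∈ Matrix.orthogonalGroup (Fin N) ℝ) (X : DTVGS N) :
    ∀ᵐ t : ℝ ∂periodMeasure, ∀ v, dtft (fun n => X (v, n)) (t : UnitAddCircle) =
      ∑ i, ((U v i : ℝ) : ℂ) * jft U X i (t : UnitAddCircle) := by
  rw [ae_all_iff]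
  intro v
  refine measurePreserving_coe_circle.quasiMeasurePreserving.ae
    (p := fun z => dtft (fun n => X (v, n)) z = ∑ i, ((U v i : ℝ) : ℂ) * jft U X i z) ?_
  rw [dtft_eq_sum_jft hU X v]
  have h1 : ∀ᵐ z ∂(AddCircle.haarAddCircle (T := (1 : ℝ))), ∀ i,
      (((U v i : ℝ) : ℂ) • jft U X i : Lp ℂ 2 _) z = ((U v i : ℝ) : ℂ) * jft U X i z := by
    rw [ae_all_iff]
    intro i
    filter_upwards [Lp.coeFn_smul ((U v i : ℝ) : ℂ) (jft U X i)] with z hz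
    rw [hz]
    rfl
  filter_upwards [h1, Lp.coeFn_finsetSum Finset.univ
    fun i => ((U v i : ℝ) : ℂ) • jft U X i] with z hz hz'
  rw [hz', Finset.sum_apply]
  exact Finset.sum_congr rfl fun i _ => hz i

/-- The energy of a signal is controlled by that of its spectral functions. -/
lemma norm_sq_le_spectral (hU : U ∈ Matrix.orthogonalGroup (Fin N) ℝ) :
    ∃ D : ℝ, 0 < D ∧ ∀ X : DTVGS N,
      ‖X‖ ^ 2 ≤ D * ∫ t : ℝ, ∑ i, ‖jft U X i (t : UnitAddCircle)‖ ^ 2 ∂periodMeasure := by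
  refine ⟨1 + ∑ v, ∑ i, ‖((U v i : ℝ) : ℂ)‖ ^ 2, by positivity, fun X => ?_⟩
  set J : ℝ := ∫ t : ℝ, ∑ i, ‖jft U X i (t : UnitAddCircle)‖ ^ 2 ∂periodMeasure with hJ
  have hJ0 : 0 ≤ J := by positivity
  have hint : Integrable (fun t : ℝ => ∑ i, ‖jft U X i (t : UnitAddCircle)‖ ^ 2) periodMeasure :=
    integrable_finsetSum _ fun i _ => integrable_norm_sq (memLp_Lp_comp_coe _)
  have h1 : ‖X‖ ^ 2 = ∑ v, ∑' n : ℤ, ‖X (v, n)‖ ^ 2 := by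
    rw [norm_sq_eq_tsum, (summable_sq_norm X).tsum_prod, tsum_fintype]
  have h2 : ∀ v, ∑' n : ℤ, ‖X (v, n)‖ ^ 2 =
      ∫ t : ℝ, ‖dtft (fun n => X (v, n)) (t : UnitAddCircle)‖ ^ 2 ∂periodMeasure := by
    intro v
    rw [← (hasSum_sq_coef (memLp_Lp_comp_coe _)).tsum_eq, ← (Equiv.neg ℤ).tsum_eq]
    refine tsum_congr fun n => ?_
    rw [coef_comp_coe, fourierCoeff_dtft (memℓp_vertex X v)]
    rfl
  have h3 : ∀ v, ∫ t : ℝ, ‖dtft (fun n => X (v, n)) (t : UnitAddCircle)‖ ^ 2 ∂periodMeasure ≤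
      (∑ i, ‖((U v i : ℝ) : ℂ)‖ ^ 2) * J := by
    intro v
    rw [hJ, ← integral_const_mul]
    refine integral_mono_ae (integrable_norm_sq (memLp_Lp_comp_coe _)) (hint.const_mul _) ?_
    filter_upwards [ae_dtft_eq hU X] with t ht
    rw [ht v]
    calc ‖∑ i, ((U v i : ℝ) : ℂ) * jft U X i (t : UnitAddCircle)‖ ^ 2
        ≤ (∑ i, ‖((U v i : ℝ) : ℂ)‖ * ‖jft U X i (t : UnitAddCircle)‖) ^ 2 := by
          gcongr
          refine (norm_sum_le _ _).trans (le_of_eq ?_)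
          simp only [norm_mul]
      _ ≤ _ := Finset.sum_mul_sq_le_sq_mul_sq _ _ _
  rw [h1]
  simp_rw [h2]
  refine (Finset.sum_le_sum fun v _ => h3 v).trans ?_
  rw [← Finset.sum_mul]
  gcongr
  linarith

end Critical

theorem mainTheorem6 (N : ℕ) (hN : 0 < N)
    (W : Matrix (Fin N) (Fin N) ℝ) (hW : W.IsSymm)
    (U : Matrix (Fin N) (Fin N) ℝ) (hU : IsGraphFourierMatrix W U)
    (F : Fin N → Set ℝ) (hF : ∀ i, IsFiniteUnionOfIntervals (F i))
    (hFp : ∀ i, F i ⊆ freqPeriod) :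
    ∃ S : Set (Fin N × ℤ),
      IsCriticalSamplingSet U F S ∧ (sampledVertices S).ncard ≤ vertexBandwidth F := by
  classical
  obtain ⟨hUo, -⟩ := hU
  choose D E hE hE0 hFE using fun i => (hF i).exists_stepSet (hFp i)
  set D' : Finset ℝ := Finset.univ.biUnion D
  have hE' : ∀ i, IsStepSet D' (E i) := fun i =>
    (hE i).mono (Finset.subset_biUnion_of_mem D (Finset.mem_univ i))
  set m : Matrix (Fin N) (Fin N) ℂ := U.map ((↑) : ℝ → ℂ) with hm
  have hinj := map_mulVec_eq_zero hUo
  let K : ℝ → Finset (Fin N) := fun t => {i | t ∈ E i}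
  have hK : ∀ t i, i ∈ K t ↔ t ∈ E i := by simp [K]
  -- Nonempty null supports count here as they do in `vertexBandwidth`; `hE0` ensures that empty
  -- ones are never active.
  let I : Finset (Fin N) := {i | (F i).Nonempty}
  have hKI : ∀ t, K t ⊆ I := by
    intro t i hi
    rw [hK] at hi
    simp only [I, Finset.mem_filter, Finset.mem_univ, true_and]
    rw [Set.nonempty_iff_ne_empty]
    intro h
    rw [hE0 i h] at hi
    exact hi
  let A : Fin N → Set ℝ := fun v => {t | v ∈ greedy m (K t)}
  have hA : ∀ v, IsStepSet D' (A v) := isStepSet_greedy m hE' hK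
  -- A vertex outside `greedy m I` has `A v = ∅` by `greedy_mono`. Choosing `Λ = ∅` there, and not
  -- merely a set of density zero, leaves the vertex unsampled.
  have hex : ∀ v, ∃ Λ : Set ℤ, Samples Λ (A v) ∧
      HasDensity Λ (volume.real (A v ∩ Set.Ioc 0 1)) ∧ (v ∉ greedy m I → Λ = ∅) := by
    intro v
    by_cases hv : v ∈ greedy m I
    · obtain ⟨Λ, h1, h2⟩ := (hA v).isArcSet.exists_samples
      exact ⟨Λ, h1, h2, fun h => absurd hv h⟩
    · have hAv : A v = ∅ := by
        rw [Set.eq_empty_iff_forall_notMem]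
        exact fun t ht => hv (greedy_mono m (hKI t) ht)
      rw [hAv]
      exact ⟨∅, samples_empty (by simp), by simpa using hasDensity_empty, fun _ => rfl⟩
  choose Λ hΛ hd hΛ0 using hex
  refine ⟨samplingSet Λ, ⟨?_, ?_⟩, ?_⟩
  · obtain ⟨c, hc, hsamp⟩ := exists_greedy_sampling hinj (K := K) (fun v => (hA v).meas)
      (fun _ _ => Iff.rfl) hΛ
    obtain ⟨C, hC, hnorm⟩ := norm_sq_le_spectral hUo
    refine ⟨c / C, 1, by positivity, fun X hX => ⟨?_, ?_⟩⟩
    · have h1 := hsamp (fun t i => jft U X i (t : UnitAddCircle))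
        (fun v t => dtft (fun n => X (v, n)) (t : UnitAddCircle))
        (fun v => measurable_Lp_comp_coe _) (fun v => memLp_Lp_comp_coe _) ?_ ?_
      · have h2 : ∑ v, ∑' k : Λ v,
            ‖coef (fun t : ℝ => dtft (fun n => X (v, n)) (t : UnitAddCircle)) k‖ ^ 2 =
              ∑ v, ∑' k : Λ v, ‖X (v, -k)‖ ^ 2 := by
          refine Finset.sum_congr rfl fun v _ => tsum_congr fun k => ?_
          rw [coef_comp_coe, fourierCoeff_dtft (memℓp_vertex X v)]
        rw [h2] at h1
        refine le_trans ?_ (h1.trans (sum_tsum_le_tsum_samplingSet (summable_sq_norm X)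
          fun p => by positivity))
        rw [div_mul_eq_mul_div, div_le_iff₀ hC, mul_assoc]
        gcongr
        rw [mul_comm]
        exact hnorm X
      · have h2 : ∀ i, ∀ᵐ t ∂periodMeasure, t ∉ E i → jft U X i (t : UnitAddCircle) = 0 := by
          intro i
          refine ae_period_of_ae_freqPeriod (fun t ht htE => ?_) ?_
          · have h3 := ht (by
              rw [← (hE i).add_one_mem, sub_add_cancel]
              exact htE)
            have h4 : ((t - 1 : ℝ) : UnitAddCircle) = (t : UnitAddCircle) := by
              rw [AddCircle.coe_sub, AddCircle.coe_period, sub_zero]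
            rwa [h4] at h3
          · filter_upwards [hX i, hFE i] with t h3 h4 h5
            exact h3 fun h6 => h5 (h4.mp h6)
        rw [← ae_all_iff] at h2
        filter_upwards [h2] with t ht i hi
        exact ht i fun h => hi ((hK t i).mpr h)
      · filter_upwards [ae_dtft_eq hUo X] with t ht v
        rw [ht v]
        rfl
    · rw [one_mul, norm_sq_eq_tsum]
      exact (summable_sq_norm X).tsum_subtype_le (fun p => ‖X p‖ ^ 2) _ fun p => by positivity
  · rw [totalSamplingRatio_samplingSet hN hd, jointBandwidth]
    congr 1
    have h1 : ∀ i, volume.real (F i) = ∫ t, (E i).indicator (1 : ℝ → ℝ) t ∂periodMeasure := by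
      intro i
      rw [integral_indicator_period (hE i).meas,
        volume_stepSet_eq (hE i).meas (hE i).add_one_mem (hFp i) (hFE i)]
    simp_rw [h1, ← fun v => integral_indicator_period (hA v).meas]
    rw [← integral_finsetSum _ fun v _ => integrable_indicator_period (hA v).meas,
      ← integral_finsetSum _ fun i _ => integrable_indicator_period (hE i).meas]
    congr 1
    ext t
    -- The ratio is exact because, at each frequency, the greedy rows are as many as the active
    -- indices.
    have h2 : ∀ v, (A v).indicator (1 : ℝ → ℝ) t = if v ∈ greedy m (K t) then 1 else 0 := by
      intro v
      simp [Set.indicator_apply, A]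
    have h3 : ∀ i, (E i).indicator (1 : ℝ → ℝ) t = if i ∈ K t then 1 else 0 := by
      intro i
      simp [Set.indicator_apply, hK]
    simp_rw [h2, h3]
    rw [Finset.sum_boole, Finset.sum_boole, Finset.filter_univ_mem, Finset.filter_univ_mem,
      card_greedy hinj]
  · have h1 : sampledVertices (samplingSet Λ) ⊆ (greedy m I : Set (Fin N)) := by
      rintro _ ⟨⟨v, n⟩, hvn, rfl⟩
      by_contra hv
      simp only [samplingSet, Set.mem_ofPred_eq] at hvn
      rw [hΛ0 v hv] at hvn
      exact hvn
    refine (Set.ncard_le_ncard h1 (Finset.finite_toSet _)).trans ?_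
    rw [Set.ncard_coe_finset, card_greedy hinj, ← Set.ncard_coe_finset, vertexBandwidth]
    refine Set.ncard_le_ncard (fun i hi => ?_) (Set.toFinite _)
    have hi' : (F i).Nonempty := by simpa [I] using hi
    obtain ⟨f, hf⟩ := hi'
    exact Set.mem_biUnion (Set.mem_iUnion.mpr ⟨i, hf⟩) hf
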